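/- Let $n\ge 0$ be an integer, $\hbar,m,T,M>0$, $I=(0,T)$, $a^2=\hbar^2/2m$, $Lu=a^2\Delta_x u+i\hbar\,\partial_t u$, and let $$K_f(x,y,t)=\Bigl(\frac{m}{2\pi\hbar i t}\Bigr)^{n/2}e^{im|x-y|^2/2\hbar t}\qquad(x,y\in\mathbb R^n,\ t\ne0)$$ be the free Schrödinger kernel. For $g\in L^2(\mathbb R^n)$ and $t\neq 0$ the integral $\int_{\mathbb R^n}K_f(\cdot,y,t)g(y)\,dy$ is understood in the sense of Abel summability in the mean, i.e. as the limit in $L^2(\mathbb R^n)$, as $\varepsilon\to0^+$, of $\int_{\mathbb R^n}e^{-\varepsilon|y|^2}K_f(\cdot,y,t)g(y)\,dy$. Let $\mathcal B$ be a complex Banach space, continuously embedded in $L^2(\mathbb R^n)$, on which the free propagators act: there are bounded linear operators $U(t):\mathcal B\to\mathcal B$, $t\in\mathbb R$, with $U(0)=\mathrm{Id}$ and $U(t)b=\int K_f(\cdot,y,t)b(y)\,dy$ for $t\neq0$, such that $t\mapsto U(t)b$ is continuous for every $b\in\mathcal B$. Let $f\in\mathcal B$ be a function with $(1+|y|^2)f(y)\in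 L^1(\mathbb R^n)$, let $F:I\to\mathcal B$ be strongly measurable with $\|F(\cdot,t)\|_{\mathcal B}\le\xi(t)$ for almost every $t\in I$, and let $\|\xi\|_{L^\infty(I)}\le M$. Put $$\Pi(x,t)=\int_{\mathbb R^n}K_f(x,y,t)f(y)\,dy,\qquad \Phi(\cdot,t)=-\frac i\hbar\int_0^t\int_{\mathbb R^n}K_f(\cdot,y,t-\tau)F(y,\tau)\,dy\,d\tau .$$ 1. The initial-value problem $Lu=F$ in $\mathbb R^n\times I$ (in the sense of distributions), $u(\cdot,0)=f$ (with $u(\cdot,t)\to f$ in $\mathcal B$ as $t\to0^+$), has a solution $u\in L^\infty(I;\mathcal B)$. It is unique up to equality for almost every $t\in I$, and $u(\cdot,t)=\Pi(\cdot,t)+\Phi(\cdot,t)$ almost everywhere in $\mathbb R^n$, for every $t\in I$. 2. For all $x$ and all $t\ne0$ the integral $\Pi(x,t)$ converges absolutely; $\Pi$ is $C^2$ in $x$ and differentiable in $t$ there, and $L\Pi(x,t)=0$. 3. For $t\in[0,T]$ the integral over $\tau$ in $\Phi(\cdot,t)$ converges as a Bochner integral in $\mathcal B$. If $F(\cdot,\tau)\in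 L^1(\mathbb R^n)$ for almost every $\tau\in I$, then for every $t\in I$ and almost every $x$ the value $\Phi(x,t)$ is given by the iterated integral with ordinary Lebesgue integrals. 4. If $\|U(s)\|\le C$ for all $s\in[0,T]$, then $\|\Phi(\cdot,t)\|_{\mathcal B}\le\frac{C}{\hbar}\,M\,t$ for all $t\in[0,T]$. In any case $\Phi(\cdot,t)\to0$ in $\mathcal B$ as $t\to0^+$. 5. $\mathcal B=L^2(\mathbb R^n)$ is such a space, and there every $U(t)$ is unitary. -/

import Mathlib

open MeasureTheory Filter Topology Set

noncomputable section

/-- The Euclidean space `ℝⁿ`. -/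
abbrev Space (n : ℕ) := EuclideanSpace ℝ (Fin n)

/-- The complex Hilbert space `L²(ℝⁿ)`. -/
abbrev LTwo (n : ℕ) := Lp ℂ 2 (volume : Measure (Space n))

/-- The free Schrödinger kernel
`K_f(x, y, t) = (m / (2 π ħ i t))^{n/2} exp (i m |x - y|² / (2 ħ t))`, `t ≠ 0`
(principal branch of the power). -/
def freeKernel {n : ℕ} (ħ m : ℝ) (x y : Space n) (t : ℝ) : ℂ :=
  ((m : ℂ) / (2 * Real.pi * ħ * Complex.I * t)) ^ ((n : ℂ) / 2) *
    Complex.exp (Complex.I * m * (‖x - y‖ : ℂ) ^ 2 / (2 * ħ * t))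

/-- The Poisson integral `Π(x, t) = ∫ K_f(x, y, t) f(y) dy`. -/
def poissonIntegral {n : ℕ} (ħ m : ℝ) (f : Space n → ℂ) (x : Space n) (t : ℝ) : ℂ :=
  ∫ y, freeKernel ħ m x y t * f y

/-- `h(x) = ∫ K_f(x, y, t) g(y) dy` for `g, h ∈ L²(ℝⁿ)`, the integral being taken in the sense of
Abel summability, in the mean: the absolutely convergent integrals with the Abel factor
`exp (-ε |y|²)` converge to `h` in `L²(ℝⁿ)` as `ε → 0+`. -/
def HasKernelIntegral {n : ℕ} (ħ m t : ℝ) (g h : LTwo n) : Prop :=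
  Tendsto
    (fun ε : ℝ => eLpNorm
      (fun x => (∫ y, (Real.exp (-ε * ‖y‖ ^ 2) : ℂ) * (freeKernel ħ m x y t * g y)) - h x)
      2 volume)
    (𝓝[>] 0) (𝓝 0)

/-- The bounded operators `U t` on the Banach space `B` of functions (embedded in `L²(ℝⁿ)` by `j`)
are the free propagators `e^{-i t H₀ / ħ}`: `U t` is given by the kernel `K_f(x, y, t)` for
`t ≠ 0`, `U 0` is the identity (`K_f(x, y, 0) = δ(x - y)`), and `t ↦ U t b` is continuous. -/
structure IsFreePropagator {n : ℕ} (ħ m : ℝ) {B : Type*} [NormedAddCommGroup B] [NormedSpace ℂ B]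
    (j : B →L[ℂ] LTwo n) (U : ℝ → B →L[ℂ] B) : Prop where
  kernel : ∀ t : ℝ, t ≠ 0 → ∀ b : B, HasKernelIntegral ħ m t (j b) (j (U t b))
  zero : U 0 = ContinuousLinearMap.id ℂ B
  continuous : ∀ b : B, Continuous fun t => U t b

/-- The source term `Φ(t) = -(i/ħ) ∫₀ᵗ ∫ K_f(·, y, t - τ) F(y, τ) dy dτ`, as an element of `B`:
the inner integral is `U (t - τ) (F τ)`, the outer one is a Bochner integral. -/
def sourceTerm {B : Type*} [NormedAddCommGroup B] [NormedSpace ℂ B]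
    (ħ : ℝ) (U : ℝ → B →L[ℂ] B) (F : ℝ → B) (t : ℝ) : B :=
  (-(Complex.I / ħ)) • ∫ τ in (0 : ℝ)..t, U (t - τ) (F τ)

/-- `u ∈ L^∞(I; B)`, `I = (0, T)`, solves `a² Δu + i ħ ∂ₜu = F` with `a² = ħ² / (2 m)` in `ℝⁿ × I`
in the sense of distributions, and `u(·, 0) = f`, the initial value being attained in `B`. -/
structure IsSolution {n : ℕ} (ħ m T : ℝ) {B : Type*} [NormedAddCommGroup B] [NormedSpace ℂ B]
    (j : B →L[ℂ] LTwo n) (f : B) (F u : ℝ → B) : Prop where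
  memLp : MemLp u ⊤ (volume.restrict (Ioo 0 T))
  equation : ∀ φ : Space n → ℝ → ℂ,
    ContDiff ℝ (⊤ : ℕ∞) (Function.uncurry φ) →
    HasCompactSupport (Function.uncurry φ) →
    tsupport (Function.uncurry φ) ⊆ univ ×ˢ Ioo 0 T →
    ∫ t in Ioo 0 T, ∫ x, j (u t) x *
        (((ħ ^ 2 / (2 * m) : ℝ) : ℂ) * Laplacian.laplacian (fun z => φ z t) x
          - Complex.I * ħ * deriv (fun s => φ x s) t)
      = ∫ t in Ioo 0 T, ∫ x, j (F t) x * φ x t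
  initial : u 0 = f
  continuous_initial : ContinuousWithinAt u (Ici 0) 0

end

/-! The Schrödinger kernel is the heat kernel at the imaginary time `iħt/(2m)`, so the propagators
should be the Fourier multiplier group `e^{isΔ}` with `s = ħt/(2m)`. On L¹ ∩ L² this follows by
approaching the imaginary axis from the right half plane, where symbol and kernel are integrable
(`freeGroup_ae_eq_integral`). The Abel factor puts every L² function into L¹ ∩ L², and since the
group is isometric the factor can be removed in the limit (`hasKernelIntegral_iff`). Hence `j`
intertwines `U` with `e^{isΔ}`, whatever the space `B` is (`IsFreePropagator.apply_eq`).

In `B` itself only Banach–Steinhaus is needed: `U` is bounded on compact time intervals and jointly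
continuous in time and vector, so the Duhamel integral is a Bochner integral of size O(t). For the
Poisson integral, two space derivatives or one time derivative of the kernel grow at most like |y|²;
the weight 1 + |y|² allows differentiation under the integral, and the equation is inherited from
the kernel.

Existence: after pulling back by the group, a mild solution is a constant plus a primitive of the
pulled back source. Pulling back the test function as well turns the weak equation into an
integration by parts in time (`integral_inner_primitive`, `integral_integral_freeGroup_mul`).

Uniqueness: the difference `w` of two solutions tends to 0 at time 0 and solves the homogeneous
equation weakly. For a fixed frequency this would be an ODE, but the exceptional null set of
frequencies depends on the test function in time. Instead `w` is paired with functions whose Fourier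
transform is supported in a ball. The pairings with `(4π²|ξ|²)ᵏ g` form a hierarchy in which each
member is, up to a factor, the weak derivative of the one before. The bounds grow geometrically, so
iterated integration gains a factorial and kills the first member
(`ae_eq_zero_of_weakDeriv_hierarchy`). Band-limited functions are not compactly supported, which is
why the weak equation is first extended to Schwartz functions by cut-offs. -/

open scoped FourierTransform SchwartzMap ComplexConjugate

/-! ### Convergence in L² and multiplication by unimodular functions. -/

section LTwoGeneral

variable {α : Type*} {mα : MeasurableSpace α} {μ : Measure α}

theorem lpTwo_norm_sq (h : Lp ℂ 2 μ) : ‖h‖ ^ 2 = ∫ x, ‖h x‖ ^ 2 ∂μ := by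
  have h1 : inner ℂ h h = ((‖h‖ ^ 2 : ℝ) : ℂ) := by
    rw [inner_self_eq_norm_sq_to_K]; push_cast; rfl
  rw [L2.inner_def] at h1
  have h2 : ∀ x, inner ℂ (h x) (h x) = ((‖h x‖ ^ 2 : ℝ) : ℂ) := fun x => by
    rw [inner_self_eq_norm_sq_to_K]; push_cast; rfl
  simp_rw [h2] at h1
  rw [integral_complex_ofReal] at h1
  exact_mod_cast h1.symm

theorem integrable_norm_sq_of_memLp {E : Type*} [NormedAddCommGroup E] {f : α → E}
    (hf : MemLp f 2 μ) : Integrable (fun x => ‖f x‖ ^ 2) μ :=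
  hf.integrable_norm_pow two_ne_zero

/-- Dominated convergence in `L²`. -/
theorem tendsto_lpTwo_of_dominated {ι : Type*} {l : Filter ι} [l.IsCountablyGenerated]
    {Φ : ι → Lp ℂ 2 μ} {Φ₀ : Lp ℂ 2 μ} {F : ι → α → ℂ} {f : α → ℂ} {b : α → ℝ}
    (hb : MemLp b 2 μ) (hΦ : ∀ᶠ n in l, Φ n =ᵐ[μ] F n) (hΦ₀ : Φ₀ =ᵐ[μ] f)
    (hF : ∀ᶠ n in l, ∀ᵐ x ∂μ, ‖F n x‖ ≤ b x)
    (hlim : ∀ᵐ x ∂μ, Tendsto (fun n => F n x) l (𝓝 (f x))) :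
    Tendsto Φ l (𝓝 Φ₀) := by
  have hf2 : MemLp (fun x => ‖f x‖) 2 μ := ((memLp_congr_ae hΦ₀).1 (Lp.memLp Φ₀)).norm
  have hsq : Tendsto (fun n => ‖Φ n - Φ₀‖ ^ 2) l (𝓝 0) := by
    have hz : Tendsto (fun n => ∫ x, ‖(Φ n - Φ₀ : Lp ℂ 2 μ) x‖ ^ 2 ∂μ) l (𝓝 (∫ _, (0 : ℝ) ∂μ)) := by
      have hG : Tendsto (fun n => ∫ x, ‖F n x - f x‖ ^ 2 ∂μ) l (𝓝 (∫ _, (0 : ℝ) ∂μ)) := by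
        -- The limit is already known to lie in L², so `b + ‖f‖` dominates the difference without
        -- proving `‖f‖ ≤ b`.
        refine tendsto_integral_filter_of_dominated_convergence (fun x => ‖b x + ‖f x‖‖ ^ 2) ?_ ?_
          (integrable_norm_sq_of_memLp (hb.add hf2)) ?_
        · filter_upwards [hΦ] with n hn
          exact ((((Lp.aestronglyMeasurable (Φ n)).congr hn).sub
            ((Lp.aestronglyMeasurable Φ₀).congr hΦ₀)).norm.pow 2)
        · filter_upwards [hF] with n hn
          filter_upwards [hn] with x hx
          rw [Real.norm_of_nonneg (by positivity)]
          gcongr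
          refine (norm_sub_le _ _).trans (le_trans ?_ (le_abs_self _))
          gcongr
        · filter_upwards [hlim] with x hx
          have : Tendsto (fun n => ‖F n x - f x‖ ^ 2) l (𝓝 (‖f x - f x‖ ^ 2)) :=
            ((hx.sub_const _).norm.pow 2)
          simpa using this
      refine hG.congr' ?_
      filter_upwards [hΦ] with n hn
      refine integral_congr_ae ?_
      filter_upwards [hn, hΦ₀, Lp.coeFn_sub (Φ n) Φ₀] with x h1 h2 h3
      rw [h3, Pi.sub_apply, h1, h2]
    simp_rw [lpTwo_norm_sq]
    simpa using hz
  rw [tendsto_iff_norm_sub_tendsto_zero]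
  have := hsq.sqrt
  simpa [Real.sqrt_sq (norm_nonneg _)] using this

/-- A limit in `L²` and an almost everywhere pointwise limit coincide almost everywhere. -/
theorem lpTwo_ae_eq_of_tendsto {ι : Type*} {l : Filter ι} [l.IsCountablyGenerated] [l.NeBot]
    {Φ : ι → Lp ℂ 2 μ} {Φ₀ : Lp ℂ 2 μ} {F : ι → α → ℂ} {f : α → ℂ}
    (hΦ : ∀ᶠ n in l, Φ n =ᵐ[μ] F n) (hlim : Tendsto Φ l (𝓝 Φ₀))
    (hF : ∀ᵐ x ∂μ, Tendsto (fun n => F n x) l (𝓝 (f x))) :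
    Φ₀ =ᵐ[μ] f := by
  -- Convergence in L² yields almost everywhere convergence only along a subsequence, so the filter
  -- is first replaced by a sequence.
  obtain ⟨u, hu⟩ := exists_seq_tendsto l
  have h1 : TendstoInMeasure μ (fun n => (Φ (u n) : α → ℂ)) atTop Φ₀ :=
    tendstoInMeasure_of_tendsto_Lp (hlim.comp hu)
  obtain ⟨ns, hns, hae⟩ := h1.exists_seq_tendsto_ae
  have h2 : ∀ᶠ k in atTop, Φ (u k) =ᵐ[μ] F (u k) := hu.eventually hΦ
  obtain ⟨N, hN⟩ := eventually_atTop.1 h2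
  have h3 : ∀ᵐ x ∂μ, ∀ k ≥ N, Φ (u k) x = F (u k) x := by
    rw [ae_all_iff]; intro k
    by_cases hk : k ≥ N
    · filter_upwards [hN k hk] with x hx _ using hx
    · exact Eventually.of_forall fun x h => absurd h hk
  filter_upwards [hae, hF, h3] with x hx1 hx2 hx3
  refine tendsto_nhds_unique hx1 (((hx2.comp hu).comp hns.tendsto_atTop).congr' ?_)
  filter_upwards [eventually_ge_atTop N] with k hk
  exact (hx3 _ (hk.trans (hns.id_le k))).symm

theorem memLp_unimodular_mul {e : α → ℂ} (he : Measurable e) (h1 : ∀ x, ‖e x‖ = 1)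
    (g : Lp ℂ 2 μ) : MemLp (fun x => e x * g x) 2 μ :=
  (Lp.memLp g).of_le (he.aestronglyMeasurable.mul (Lp.aestronglyMeasurable g))
    (Eventually.of_forall fun x => by rw [norm_mul, h1, one_mul])

/-- Multiplication by a measurable function of modulus one, as an isometry of `L²`. -/
noncomputable def unimodularMul (e : α → ℂ) (he : Measurable e) (h1 : ∀ x, ‖e x‖ = 1) :
    Lp ℂ 2 μ →ₗᵢ[ℂ] Lp ℂ 2 μ where
  toFun g := (memLp_unimodular_mul he h1 g).toLp _
  map_add' f g := by
    ext1
    filter_upwards [(memLp_unimodular_mul he h1 (f + g)).coeFn_toLp,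
      (memLp_unimodular_mul he h1 f).coeFn_toLp, (memLp_unimodular_mul he h1 g).coeFn_toLp,
      Lp.coeFn_add f g, Lp.coeFn_add ((memLp_unimodular_mul he h1 f).toLp _)
        ((memLp_unimodular_mul he h1 g).toLp _)] with x h1 h2 h3 h4 h5
    rw [h1, h5, h4, Pi.add_apply, Pi.add_apply, h2, h3, mul_add]
  map_smul' c g := by
    ext1
    filter_upwards [(memLp_unimodular_mul he h1 (c • g)).coeFn_toLp,
      (memLp_unimodular_mul he h1 g).coeFn_toLp,
      Lp.coeFn_smul c g, Lp.coeFn_smul c ((memLp_unimodular_mul he h1 g).toLp _)]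
      with x h1 h2 h3 h4
    rw [h1, RingHom.id_apply, h4, h3, Pi.smul_apply, Pi.smul_apply, h2, smul_eq_mul, smul_eq_mul]
    ring
  norm_map' g := by
    change ‖(memLp_unimodular_mul he h1 g).toLp _‖ = ‖g‖
    rw [Lp.norm_toLp, Lp.norm_def]
    congr 1
    refine eLpNorm_congr_norm_ae (Eventually.of_forall fun x => ?_)
    rw [norm_mul, h1, one_mul]

theorem unimodularMul_coe (e : α → ℂ) (he : Measurable e) (h1 : ∀ x, ‖e x‖ = 1) (g : Lp ℂ 2 μ) :
    unimodularMul e he h1 g =ᵐ[μ] fun x => e x * g x :=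
  (memLp_unimodular_mul he h1 g).coeFn_toLp

end LTwoGeneral

/-! ### The free group as a Fourier multiplier. -/

/-- The Fourier multiplier `exp (-4 π² z |ξ|²)` of the (complex) heat semigroup. -/
noncomputable def gaussSymbol {n : ℕ} (z : ℂ) (ξ : Space n) : ℂ :=
  Complex.exp (-(4 * Real.pi ^ 2 * z) * (‖ξ‖ : ℂ) ^ 2)

theorem continuous_gaussSymbol {n : ℕ} :
    Continuous fun p : ℂ × Space n => gaussSymbol p.1 p.2 := by
  unfold gaussSymbol; fun_prop

theorem continuous_gaussSymbol_right {n : ℕ} (z : ℂ) : Continuous (gaussSymbol (n := n) z) := by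
  unfold gaussSymbol; fun_prop

theorem norm_gaussSymbol {n : ℕ} (z : ℂ) (ξ : Space n) :
    ‖gaussSymbol z ξ‖ = Real.exp (-(4 * Real.pi ^ 2 * z.re) * ‖ξ‖ ^ 2) := by
  unfold gaussSymbol
  rw [Complex.norm_exp]
  congr 1
  have : -(4 * (Real.pi : ℂ) ^ 2 * z) * (‖ξ‖ : ℂ) ^ 2
      = ((-(4 * Real.pi ^ 2) * ‖ξ‖ ^ 2 : ℝ) : ℂ) * z := by push_cast; ring
  rw [this, Complex.re_ofReal_mul]; ring

theorem norm_gaussSymbol_le {n : ℕ} {z : ℂ} (hz : 0 ≤ z.re) (ξ : Space n) :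
    ‖gaussSymbol z ξ‖ ≤ 1 := by
  rw [norm_gaussSymbol, Real.exp_le_one_iff]
  have : 0 ≤ 4 * Real.pi ^ 2 * z.re * ‖ξ‖ ^ 2 := by positivity
  linarith

theorem norm_gaussSymbol_imag {n : ℕ} (s : ℝ) (ξ : Space n) :
    ‖gaussSymbol (s * Complex.I) ξ‖ = 1 := by
  rw [norm_gaussSymbol]; simp

theorem gaussSymbol_add {n : ℕ} (z w : ℂ) (ξ : Space n) :
    gaussSymbol (z + w) ξ = gaussSymbol z ξ * gaussSymbol w ξ := by
  unfold gaussSymbol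
  rw [← Complex.exp_add]; congr 1; ring

theorem gaussSymbol_zero {n : ℕ} (ξ : Space n) : gaussSymbol 0 ξ = 1 := by simp [gaussSymbol]

/-- Multiplication by `exp (-4 π² i s |ξ|²)`. -/
noncomputable def freeMul (n : ℕ) (s : ℝ) : LTwo n →ₗᵢ[ℂ] LTwo n :=
  unimodularMul (gaussSymbol (s * Complex.I)) (continuous_gaussSymbol_right _).measurable
    (norm_gaussSymbol_imag s)

/-- The group `exp (i s Δ)` on `L²`. -/
noncomputable def freeGroup (n : ℕ) (s : ℝ) : LTwo n →ₗᵢ[ℂ] LTwo n :=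
  (Lp.fourierTransformₗᵢ (Space n) ℂ).symm.toLinearIsometry.comp
    ((freeMul n s).comp (Lp.fourierTransformₗᵢ (Space n) ℂ).toLinearIsometry)

theorem freeGroup_apply {n : ℕ} (s : ℝ) (g : LTwo n) :
    freeGroup n s g = 𝓕⁻ (freeMul n s (𝓕 g)) := rfl

theorem freeMul_coe {n : ℕ} (s : ℝ) (g : LTwo n) :
    freeMul n s g =ᵐ[volume] fun ξ => gaussSymbol (s * Complex.I) ξ * g ξ :=
  unimodularMul_coe _ _ _ g

theorem freeMul_zero {n : ℕ} (g : LTwo n) : freeMul n 0 g = g := by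
  ext1
  filter_upwards [freeMul_coe 0 g] with ξ h
  rw [h]; simp [gaussSymbol_zero]

theorem freeMul_add {n : ℕ} (s r : ℝ) (g : LTwo n) :
    freeMul n (s + r) g = freeMul n s (freeMul n r g) := by
  ext1
  filter_upwards [freeMul_coe (s + r) g, freeMul_coe s (freeMul n r g), freeMul_coe r g]
    with ξ h1 h2 h3
  rw [h1, h2, h3, ← mul_assoc, ← gaussSymbol_add]; push_cast; ring_nf

theorem freeMul_continuous {n : ℕ} (g : LTwo n) : Continuous fun s => freeMul n s g := by
  rw [continuous_iff_continuousAt]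
  intro s
  refine tendsto_lpTwo_of_dominated (F := fun r ξ => gaussSymbol (r * Complex.I) ξ * g ξ)
    (b := fun ξ => ‖g ξ‖) (Lp.memLp g).norm (Eventually.of_forall fun r => freeMul_coe r g)
    (freeMul_coe s g) (Eventually.of_forall fun r => Eventually.of_forall fun ξ => ?_)
    (Eventually.of_forall fun ξ => ?_)
  · rw [norm_mul, norm_gaussSymbol_imag, one_mul]
  · refine Tendsto.mul_const _ ?_
    have : Continuous fun r : ℝ => gaussSymbol (r * Complex.I) ξ :=
      continuous_gaussSymbol.comp (by fun_prop : Continuous fun r : ℝ => ((r : ℂ) * Complex.I, ξ))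
    exact this.tendsto s

theorem freeGroup_zero {n : ℕ} (g : LTwo n) : freeGroup n 0 g = g := by
  rw [freeGroup_apply, freeMul_zero, FourierTransform.fourierInv_fourier_eq]

theorem freeGroup_add {n : ℕ} (s r : ℝ) (g : LTwo n) :
    freeGroup n (s + r) g = freeGroup n s (freeGroup n r g) := by
  rw [freeGroup_apply, freeMul_add, freeGroup_apply, freeGroup_apply,
    FourierTransform.fourier_fourierInv_eq]

theorem freeGroup_continuous {n : ℕ} (g : LTwo n) : Continuous fun s => freeGroup n s g :=
  (Lp.fourierTransformₗᵢ (Space n) ℂ).symm.continuous.comp (freeMul_continuous (𝓕 g))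

theorem freeGroup_neg_apply {n : ℕ} (s : ℝ) (g : LTwo n) :
    freeGroup n (-s) (freeGroup n s g) = g := by
  rw [← freeGroup_add, neg_add_cancel, freeGroup_zero]

theorem freeGroup_surjective {n : ℕ} (s : ℝ) : Function.Surjective (freeGroup n s) := fun g =>
  ⟨freeGroup n (-s) g, by rw [← freeGroup_add, add_neg_cancel, freeGroup_zero]⟩

/-- Unitarity: the adjoint is the inverse. This is what moves the evolution from the solution onto
the test function. -/
theorem inner_freeGroup {n : ℕ} (s : ℝ) (f g : LTwo n) :
    inner ℂ f (freeGroup n s g) = inner ℂ (freeGroup n (-s) f) g := by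
  rw [← (freeGroup n (-s)).inner_map_map f, freeGroup_neg_apply]

/-- The flow is jointly continuous. -/
theorem freeGroup_continuous_uncurry {n : ℕ} :
    Continuous fun p : ℝ × LTwo n => freeGroup n p.1 p.2 := by
  rw [continuous_iff_continuousAt]
  rintro ⟨s, g⟩
  rw [ContinuousAt, tendsto_iff_norm_sub_tendsto_zero]
  have h1 : Tendsto (fun p : ℝ × LTwo n => ‖p.2 - g‖ + ‖freeGroup n p.1 g - freeGroup n s g‖)
      (𝓝 (s, g)) (𝓝 (‖g - g‖ + ‖freeGroup n s g - freeGroup n s g‖)) := by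
    have hc : Continuous fun p : ℝ × LTwo n => freeGroup n p.1 g :=
      (freeGroup_continuous g).comp continuous_fst
    exact (((continuous_snd.sub continuous_const).norm.add
      (hc.sub continuous_const).norm).tendsto (s, g))
  simp only [sub_self, norm_zero, add_zero] at h1
  refine squeeze_zero (fun _ => norm_nonneg _) (fun p => ?_) h1
  calc ‖freeGroup n p.1 p.2 - freeGroup n s g‖
      = ‖freeGroup n p.1 (p.2 - g) + (freeGroup n p.1 g - freeGroup n s g)‖ := by
        rw [map_sub]; congr 1; abel
    _ ≤ _ := by
        refine (norm_add_le _ _).trans ?_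
        rw [LinearIsometry.norm_map]

/-! ### The inverse Fourier transform on L¹ ∩ L². -/

theorem continuous_neg_innerₗ {n : ℕ} :
    Continuous fun p : Space n × Space n => (-innerₗ (Space n)) p.1 p.2 := by
  simp only [LinearMap.neg_apply, innerₗ_apply_apply]; fun_prop

/-- The inverse Fourier transform of an integrable function is continuous. -/
theorem continuous_fourierInv_of_integrable {n : ℕ} {f : Space n → ℂ} (hf : Integrable f) :
    Continuous (𝓕⁻ f) :=
  VectorFourier.fourierIntegral_continuous Real.continuous_fourierChar
    continuous_neg_innerₗ hf

/-- On `L¹ ∩ L²` the inverse Fourier transform of `L²` is given by the integral. -/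
theorem lpTwo_fourierInv_ae_eq {n : ℕ} (f : LTwo n) (hf : Integrable f) :
    (𝓕⁻ f : LTwo n) =ᵐ[volume] 𝓕⁻ (f : Space n → ℂ) := by
  have hcont := continuous_fourierInv_of_integrable hf
  refine ae_eq_of_integral_contDiff_smul_eq
    ((Lp.memLp (𝓕⁻ f : LTwo n)).locallyIntegrable (by norm_num)) hcont.locallyIntegrable ?_
  intro g hg hgs
  have hg' : HasCompactSupport fun x => (g x : ℂ) := hgs.comp_left (g := Complex.ofReal) rfl
  have hgd : ContDiff ℝ (⊤ : ℕ∞) fun x => (g x : ℂ) := Complex.ofRealCLM.contDiff.comp hg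
  set ψ : 𝓢(Space n, ℂ) := hg'.toSchwartzMap hgd with hψ
  -- The L² transform agrees with the distributional one, which moves the transform onto `ψ`; Fubini
  -- for the integrable `f` moves it back as an integral.
  have key := DFunLike.congr_fun (Lp.fourierInv_toTemperedDistribution_eq f) ψ
  rw [TemperedDistribution.fourierInv_apply, Lp.toTemperedDistribution_apply,
    Lp.toTemperedDistribution_apply, SchwartzMap.fourierInv_coe] at key
  have h2 : ∫ x, (𝓕⁻ (ψ : Space n → ℂ)) x • f x = ∫ x, ψ x • 𝓕⁻ (f : Space n → ℂ) x := by
    have := VectorFourier.integral_fourierIntegral_smul_eq_flip (L := -innerₗ (Space n))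
      (e := Real.fourierChar) (μ := volume) (ν := volume) (f := (ψ : Space n → ℂ))
      (g := (f : Space n → ℂ))
      Real.continuous_fourierChar continuous_neg_innerₗ ψ.integrable hf
    have hflip : (-innerₗ (Space n)).flip = -innerₗ (Space n) := by
      ext x y; simp [real_inner_comm]
    rw [hflip] at this
    exact this
  rw [h2] at key
  exact key.symm

/-! ### The complex heat kernel and the kernel of the free group. -/

/-- The (complex) heat kernel `(4 π z)^{-n/2} exp (-|x|² / (4 z))`. -/
noncomputable def gaussKernel {n : ℕ} (z : ℂ) (x : Space n) : ℂ :=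
  (1 / (4 * Real.pi * z)) ^ ((n : ℂ) / 2) * Complex.exp (-(‖x‖ : ℂ) ^ 2 / (4 * z))

theorem freeKernel_eq_gaussKernel {n : ℕ} {ħ m : ℝ} (hħ : 0 < ħ) (hm : 0 < m) (x y : Space n)
    (t : ℝ) : freeKernel ħ m x y t = gaussKernel ((ħ / (2 * m) * t : ℝ) * Complex.I) (x - y) := by
  unfold freeKernel gaussKernel
  have h1 : (ħ : ℂ) ≠ 0 := by exact_mod_cast hħ.ne'
  have h2 : (m : ℂ) ≠ 0 := by exact_mod_cast hm.ne'
  have h3 : (Real.pi : ℂ) ≠ 0 := by exact_mod_cast Real.pi_ne_zero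
  have hI := Complex.I_ne_zero
  -- At `t = 0` both sides are built from the same divisions by zero and agree by convention.
  rcases eq_or_ne t 0 with rfl | ht
  · simp
  have h4 : (t : ℂ) ≠ 0 := by exact_mod_cast ht
  congr 2
  · push_cast
    field_simp
    norm_num
  · push_cast
    field_simp
    rw [Complex.I_sq]
    ring

theorem continuous_gaussKernel_right {n : ℕ} (z : ℂ) : Continuous (gaussKernel (n := n) z) := by
  unfold gaussKernel; fun_prop

/-- Since Re(1/z) = Re z / |z|² ≥ 0, the exponential has modulus at most one, also on the imaginary
axis. -/
theorem norm_gaussKernel_le {n : ℕ} {z : ℂ} (hz : 0 ≤ z.re) (x : Space n) :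
    ‖gaussKernel z x‖ ≤ ‖(1 / (4 * Real.pi * z)) ^ ((n : ℂ) / 2)‖ := by
  unfold gaussKernel
  rw [norm_mul, Complex.norm_exp]
  refine mul_le_of_le_one_right (norm_nonneg _) (Real.exp_le_one_iff.2 ?_)
  have : -(‖x‖ : ℂ) ^ 2 / (4 * z) = ((-(‖x‖ ^ 2) / 4 : ℝ) : ℂ) * z⁻¹ := by
    push_cast; rw [div_mul_eq_div_div, div_eq_mul_inv]
  rw [this, Complex.re_ofReal_mul, Complex.inv_re]
  have : 0 ≤ z.re / Complex.normSq z := div_nonneg hz (Complex.normSq_nonneg _)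
  nlinarith [sq_nonneg ‖x‖]

/-- Inversion keeps the sign of the real part and reverses that of the imaginary part. Thus the
principal power in the kernel is regular on the slit plane, which contains the open right half plane
and the punctured imaginary axis. -/
theorem inv_four_pi_mem_slitPlane {z : ℂ} (hz : z ∈ Complex.slitPlane) :
    1 / (4 * Real.pi * z) ∈ Complex.slitPlane := by
  have h0 : (4 * (Real.pi : ℂ) * z) = ((4 * Real.pi : ℝ) : ℂ) * z := by push_cast; ring
  have hne : 4 * (Real.pi : ℂ) * z ≠ 0 := by
    simp [Complex.slitPlane_ne_zero hz]
  have hpos : 0 < Complex.normSq (4 * (Real.pi : ℂ) * z) := Complex.normSq_pos.2 hne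
  rw [one_div, Complex.mem_slitPlane_iff, Complex.inv_re, Complex.inv_im]
  generalize Complex.normSq (4 * (Real.pi : ℂ) * z) = N at hpos
  rw [h0, Complex.re_ofReal_mul, Complex.im_ofReal_mul]
  have hpi := Real.pi_pos
  rcases Complex.mem_slitPlane_iff.1 hz with h | h
  · left; positivity
  · right; simp [h, hpos.ne', hpi.ne']

theorem ne_zero_of_mem_slitPlane {z : ℂ} (hz : z ∈ Complex.slitPlane) : z ≠ 0 :=
  Complex.slitPlane_ne_zero hz

theorem continuousAt_gaussPrefactor (n : ℕ) {z : ℂ} (hz : z ∈ Complex.slitPlane) :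
    ContinuousAt (fun w : ℂ => (1 / (4 * Real.pi * w)) ^ ((n : ℂ) / 2)) z := by
  refine ContinuousAt.cpow ?_ continuousAt_const (inv_four_pi_mem_slitPlane hz)
  refine continuousAt_const.div (by fun_prop) ?_
  have := ne_zero_of_mem_slitPlane hz
  have h3 : (Real.pi : ℂ) ≠ 0 := by exact_mod_cast Real.pi_ne_zero
  simp [this, h3]

theorem continuousAt_gaussKernel {n : ℕ} {z : ℂ} (hz : z ∈ Complex.slitPlane) (x : Space n) :
    ContinuousAt (fun p : ℂ × Space n => gaussKernel p.1 p.2) (z, x) := by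
  unfold gaussKernel
  refine ContinuousAt.mul ?_ ?_
  · exact (continuousAt_gaussPrefactor n hz).comp (f := Prod.fst) (x := (z, x)) continuousAt_fst
  · refine Complex.continuous_exp.continuousAt.comp (ContinuousAt.div (by fun_prop) (by fun_prop) ?_)
    simpa using ne_zero_of_mem_slitPlane hz

theorem imag_mem_slitPlane {s : ℝ} (hs : s ≠ 0) : (s : ℂ) * Complex.I ∈ Complex.slitPlane := by
  rw [Complex.mem_slitPlane_iff]; right; simpa using hs

theorem integrable_gaussSymbol {n : ℕ} {z : ℂ} (hz : 0 < z.re) :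
    Integrable (gaussSymbol (n := n) z) := by
  have hb : 0 < (4 * (Real.pi : ℂ) ^ 2 * z).re := by
    have : (4 * (Real.pi : ℂ) ^ 2 * z) = ((4 * Real.pi ^ 2 : ℝ) : ℂ) * z := by push_cast; ring
    rw [this, Complex.re_ofReal_mul]; positivity
  refine (GaussianFourier.integrable_cexp_neg_mul_sq_norm_add (V := Space n) hb 0 0).congr
    (Eventually.of_forall fun ξ => ?_)
  simp [gaussSymbol]

theorem memLp_gaussSymbol {n : ℕ} {z : ℂ} (hz : 0 < z.re) :
    MemLp (gaussSymbol (n := n) z) 2 := by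
  rw [memLp_two_iff_integrable_sq_norm (continuous_gaussSymbol_right z).aestronglyMeasurable]
  refine (integrable_gaussSymbol (n := n) (z := 2 * z) (by simpa using hz)).norm.congr
    (Eventually.of_forall fun ξ => ?_)
  change ‖gaussSymbol (2 * z) ξ‖ = _
  rw [two_mul z, gaussSymbol_add, norm_mul]; exact (sq _).symm

theorem memLp_gaussSymbol_mul {n : ℕ} {z : ℂ} (hz : 0 ≤ z.re) (g : LTwo n) :
    MemLp (fun ξ => gaussSymbol z ξ * g ξ) 2 :=
  (Lp.memLp g).of_le
    ((continuous_gaussSymbol_right z).aestronglyMeasurable.mul (Lp.aestronglyMeasurable g))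
    (Eventually.of_forall fun ξ => by
      rw [norm_mul]; exact mul_le_of_le_one_left (norm_nonneg _) (norm_gaussSymbol_le hz ξ))

theorem integrable_gaussSymbol_mul {n : ℕ} {z : ℂ} (hz : 0 < z.re) (g : LTwo n) :
    Integrable (fun ξ => gaussSymbol z ξ * g ξ) :=
  MemLp.integrable_mul (memLp_gaussSymbol hz) (Lp.memLp g)

/-- Transform of a Gaussian; the character centres the result at `x`. -/
theorem fourier_gaussSymbol {n : ℕ} {z : ℂ} (hz : 0 < z.re) (x y : Space n) :
    𝓕 (fun ξ => gaussSymbol z ξ * Complex.exp (2 * Real.pi * Complex.I * (inner ℝ x ξ : ℝ))) y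
      = gaussKernel z (x - y) := by
  have hb : 0 < (4 * (Real.pi : ℂ) ^ 2 * z).re := by
    have : (4 * (Real.pi : ℂ) ^ 2 * z) = ((4 * Real.pi ^ 2 : ℝ) : ℂ) * z := by push_cast; ring
    rw [this, Complex.re_ofReal_mul]; positivity
  have hz0 : z ≠ 0 := fun h => by simp [h] at hz
  have h3 : (Real.pi : ℂ) ≠ 0 := by exact_mod_cast Real.pi_ne_zero
  have h := fourier_gaussian_innerProductSpace' (V := Space n) hb x y
  unfold gaussSymbol gaussKernel
  simp_rw [← Complex.exp_add]
  refine h.trans ?_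
  congr 2
  · field_simp
  · simp
  · field_simp

/-- Convolution of an `L²` function with the heat kernel, on the Fourier side. -/
theorem integral_gaussKernel_mul {n : ℕ} {z : ℂ} (hz : 0 < z.re) (w : LTwo n) (x : Space n) :
    ∫ y, gaussKernel z (x - y) * w y = 𝓕⁻ (fun ξ => gaussSymbol z ξ * (𝓕 w : LTwo n) ξ) x := by
  set q : Space n → ℂ :=
    fun ξ => gaussSymbol z ξ * Complex.exp (2 * Real.pi * Complex.I * (inner ℝ x ξ : ℝ)) with hq
  have hexp : ∀ ξ : Space n,
      ‖Complex.exp (2 * Real.pi * Complex.I * (inner ℝ x ξ : ℝ))‖ = 1 := fun ξ => by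
    rw [Complex.norm_exp]; simp
  have hqc : Continuous q := (continuous_gaussSymbol_right z).mul (by fun_prop)
  have hqn : ∀ ξ, ‖q ξ‖ = ‖gaussSymbol z ξ‖ := fun ξ => by
    rw [hq]; simp only [norm_mul, hexp, mul_one]
  have hq1 : Integrable (fun ξ => conj (q ξ)) :=
    (integrable_gaussSymbol hz).mono (Complex.continuous_conj.comp hqc).aestronglyMeasurable
      (Eventually.of_forall fun ξ => by rw [RCLike.norm_conj, hqn])
  have hq2 : MemLp (fun ξ => conj (q ξ)) 2 :=
    (memLp_gaussSymbol hz).of_le (Complex.continuous_conj.comp hqc).aestronglyMeasurable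
      (Eventually.of_forall fun ξ => by rw [RCLike.norm_conj, hqn])
  set P : LTwo n := hq2.toLp _ with hP
  have hPq : P =ᵐ[volume] fun ξ => conj (q ξ) := hq2.coeFn_toLp
  -- Conjugation exchanges the transform and its inverse, so the convolution at `x` is the inner
  -- product of `𝓕⁻ P` with `w`, and Parseval applies.
  have hinv : (𝓕⁻ P : LTwo n) =ᵐ[volume] fun y => conj (gaussKernel z (x - y)) := by
    filter_upwards [lpTwo_fourierInv_ae_eq P (hq1.congr hPq.symm)] with y hy
    rw [hy, Real.fourierInv_congr_ae hPq, ← fourier_gaussSymbol hz, Real.fourierInv_eq,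
      Real.fourier_eq, ← integral_conj]
    congr 1; ext ξ
    have hc : (Real.fourierChar (inner ℝ ξ y) : ℂ)
        = conj (Real.fourierChar (-inner ℝ ξ y) : ℂ) := by
      rw [AddChar.map_neg_eq_inv, Circle.coe_inv_eq_conj, Complex.conj_conj]
    rw [Circle.smul_def, Circle.smul_def, smul_eq_mul, smul_eq_mul, hc, ← map_mul]
  have hin : inner ℂ P (𝓕 w) = inner ℂ (𝓕⁻ P) w := by
    rw [← Lp.inner_fourier_eq (𝓕⁻ P) w, FourierTransform.fourier_fourierInv_eq]
  rw [L2.inner_def, L2.inner_def] at hin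
  have e1 : ∫ y, inner ℂ ((𝓕⁻ P : LTwo n) y) (w y) = ∫ y, gaussKernel z (x - y) * w y := by
    refine integral_congr_ae ?_
    filter_upwards [hinv] with y hy
    rw [hy, RCLike.inner_apply, Complex.conj_conj, mul_comm]
  have e2 : ∫ ξ, inner ℂ (P ξ) ((𝓕 w : LTwo n) ξ)
      = 𝓕⁻ (fun ξ => gaussSymbol z ξ * (𝓕 w : LTwo n) ξ) x := by
    rw [Real.fourierInv_eq']
    refine integral_congr_ae ?_
    filter_upwards [hPq] with ξ hξ
    rw [hξ, RCLike.inner_apply, Complex.conj_conj, hq, smul_eq_mul, real_inner_comm]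
    push_cast
    ring_nf
  rw [← e1, ← hin, e2]

/-- On `L¹ ∩ L²` the free group is given by its kernel. -/
theorem freeGroup_ae_eq_integral {n : ℕ} {s : ℝ} (hs : s ≠ 0) (h : LTwo n) (hh : Integrable h) :
    freeGroup n s h =ᵐ[volume] fun x => ∫ y, gaussKernel (s * Complex.I) (x - y) * h y := by
  -- Regularisation by a small positive real part. As `δ → 0+` the multipliers converge in L², while
  -- the kernel integrals converge pointwise because `h` is integrable; the two limits must
  -- coincide.
  set ζ : ℝ → ℂ := fun δ => δ + s * Complex.I with hζ
  have hζc : Continuous ζ := by fun_prop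
  have hζ0 : ζ 0 = s * Complex.I := by simp [hζ]
  have hre : ∀ δ, (ζ δ).re = δ := fun δ => by simp [hζ]
  set Ψ : ℝ → LTwo n := fun δ => if hδ : 0 ≤ (ζ δ).re then
    (memLp_gaussSymbol_mul hδ (𝓕 h)).toLp _ else 0 with hΨ
  have hΨe : ∀ δ > 0, Ψ δ =ᵐ[volume] fun ξ => gaussSymbol (ζ δ) ξ * (𝓕 h : LTwo n) ξ := by
    intro δ hδ
    have : 0 ≤ (ζ δ).re := by rw [hre]; exact hδ.le
    simp only [hΨ, dif_pos this]
    exact MemLp.coeFn_toLp _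
  have hpos : ∀ᶠ δ : ℝ in 𝓝[>] 0, 0 < δ := eventually_mem_nhdsWithin
  have hlim1 : Tendsto Ψ (𝓝[>] 0) (𝓝 (freeMul n s (𝓕 h))) := by
    refine tendsto_lpTwo_of_dominated (b := fun ξ => ‖(𝓕 h : LTwo n) ξ‖)
      (Lp.memLp _).norm (hpos.mono hΨe) (freeMul_coe s (𝓕 h)) ?_ ?_
    · filter_upwards [hpos] with δ hδ
      refine Eventually.of_forall fun ξ => ?_
      rw [norm_mul]
      exact mul_le_of_le_one_left (norm_nonneg _) (norm_gaussSymbol_le (by rw [hre]; exact hδ.le) ξ)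
    · refine Eventually.of_forall fun ξ => Tendsto.mul_const _ ?_
      have : Continuous fun δ : ℝ => gaussSymbol (ζ δ) ξ :=
        continuous_gaussSymbol.comp (by fun_prop : Continuous fun δ : ℝ => (ζ δ, ξ))
      have := this.tendsto 0
      rw [hζ0] at this
      exact this.mono_left nhdsWithin_le_nhds
  have hlim2 : Tendsto (fun δ => (𝓕⁻ (Ψ δ) : LTwo n)) (𝓝[>] 0) (𝓝 (freeGroup n s h)) :=
    ((Lp.fourierTransformₗᵢ (Space n) ℂ).symm.continuous.tendsto _).comp hlim1
  refine lpTwo_ae_eq_of_tendsto (F := fun δ x => ∫ y, gaussKernel (ζ δ) (x - y) * h y) ?_ hlim2 ?_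
  · filter_upwards [hpos] with δ hδ
    have hδ' : 0 < (ζ δ).re := by rw [hre]; exact hδ
    have hi := integrable_gaussSymbol_mul hδ' (𝓕 h)
    filter_upwards [lpTwo_fourierInv_ae_eq (Ψ δ) (hi.congr (hΨe δ hδ).symm)] with x hx
    rw [hx, Real.fourierInv_congr_ae (hΨe δ hδ), integral_gaussKernel_mul hδ']
  · refine Eventually.of_forall fun x => ?_
    have hsl := imag_mem_slitPlane hs
    -- The prefactor is continuous at `i s`, so its limit plus one dominates it for small `δ`.
    have hpre : ∀ᶠ δ in 𝓝[>] (0 : ℝ), ‖(1 / (4 * Real.pi * ζ δ)) ^ ((n : ℂ) / 2)‖ ≤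
        ‖(1 / (4 * Real.pi * (s * Complex.I))) ^ ((n : ℂ) / 2)‖ + 1 := by
      have hc : ContinuousAt (fun δ : ℝ => ‖(1 / (4 * Real.pi * ζ δ)) ^ ((n : ℂ) / 2)‖) 0 := by
        refine ContinuousAt.norm ?_
        refine ContinuousAt.comp (f := ζ) (x := 0)
          (g := fun w : ℂ => (1 / (4 * Real.pi * w)) ^ ((n : ℂ) / 2)) ?_ hζc.continuousAt
        rw [hζ0]; exact continuousAt_gaussPrefactor n hsl
      have := hc.tendsto.eventually (gt_mem_nhds (lt_add_one _))
      rw [hζ0] at this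
      exact (this.filter_mono nhdsWithin_le_nhds).mono fun δ h => h.le
    refine tendsto_integral_filter_of_dominated_convergence
      (fun y => (‖(1 / (4 * Real.pi * (s * Complex.I))) ^ ((n : ℂ) / 2)‖ + 1) * ‖h y‖) ?_ ?_
      (hh.norm.const_mul _) ?_
    · refine Eventually.of_forall fun δ => ?_
      exact ((continuous_gaussKernel_right (ζ δ)).comp
        (continuous_const.sub continuous_id : Continuous fun y : Space n => x - y)).aestronglyMeasurable.mul
        (Lp.aestronglyMeasurable h)
    · filter_upwards [hpos, hpre] with δ hδ hp
      refine Eventually.of_forall fun y => ?_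
      rw [norm_mul]
      gcongr
      exact (norm_gaussKernel_le (by rw [hre]; exact hδ.le) _).trans hp
    · refine Eventually.of_forall fun y => Tendsto.mul_const _ ?_
      have hc : ContinuousAt (fun δ : ℝ => gaussKernel (ζ δ) (x - y)) 0 := by
        refine ContinuousAt.comp (g := fun p : ℂ × Space n => gaussKernel p.1 p.2)
          (f := fun δ => (ζ δ, x - y)) (x := 0) ?_ (by fun_prop)
        simp only [hζ0]
        exact continuousAt_gaussKernel hsl _
      have hc' : Tendsto (fun δ : ℝ => gaussKernel (ζ δ) (x - y)) (𝓝 0)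
          (𝓝 (gaussKernel (ζ 0) (x - y))) := hc
      rw [hζ0] at hc'
      exact hc'.mono_left nhdsWithin_le_nhds

/-! ### Abel summability identifies the kernel integral with the free group. -/

open Classical in
/-- Multiplication of an `L²` function by a Gaussian `exp (-4 π² z |y|²)`, `0 ≤ re z`. -/
noncomputable def gaussMul {n : ℕ} (z : ℂ) (g : LTwo n) : LTwo n :=
  if hz : 0 ≤ z.re then (memLp_gaussSymbol_mul hz g).toLp _ else 0

theorem gaussMul_coe {n : ℕ} {z : ℂ} (hz : 0 ≤ z.re) (g : LTwo n) :
    gaussMul z g =ᵐ[volume] fun ξ => gaussSymbol z ξ * g ξ := by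
  rw [gaussMul, dif_pos hz]; exact MemLp.coeFn_toLp _

theorem tendsto_gaussMul {n : ℕ} {ι : Type*} {l : Filter ι} [l.IsCountablyGenerated]
    {ζ : ι → ℂ} {ζ₀ : ℂ} (hζ : ∀ᶠ i in l, 0 ≤ (ζ i).re) (hζ₀ : 0 ≤ ζ₀.re)
    (hlim : Tendsto ζ l (𝓝 ζ₀)) (g : LTwo n) :
    Tendsto (fun i => gaussMul (ζ i) g) l (𝓝 (gaussMul ζ₀ g)) := by
  refine tendsto_lpTwo_of_dominated (b := fun ξ => ‖g ξ‖) (Lp.memLp _).norm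
    (hζ.mono fun i hi => gaussMul_coe hi g) (gaussMul_coe hζ₀ g) ?_ ?_
  · filter_upwards [hζ] with i hi
    refine Eventually.of_forall fun ξ => ?_
    rw [norm_mul]
    exact mul_le_of_le_one_left (norm_nonneg _) (norm_gaussSymbol_le hi ξ)
  · refine Eventually.of_forall fun ξ => Tendsto.mul_const _ ?_
    have hc : Continuous fun z : ℂ => gaussSymbol z ξ :=
      continuous_gaussSymbol.comp (by fun_prop : Continuous fun z : ℂ => (z, ξ))
    exact (hc.tendsto ζ₀).comp hlim

theorem gaussMul_zero {n : ℕ} (g : LTwo n) : gaussMul 0 g = g := by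
  ext1
  filter_upwards [gaussMul_coe (z := 0) (by simp) g] with x hx
  rw [hx, gaussSymbol_zero, one_mul]

/-- The Abel factor is the Gaussian symbol read in the position variable, so the lemmas on symbols
serve for both. -/
theorem exp_neg_mul_eq_gaussSymbol {n : ℕ} (ε : ℝ) (y : Space n) :
    (Real.exp (-ε * ‖y‖ ^ 2) : ℂ) = gaussSymbol ((ε / (4 * Real.pi ^ 2) : ℝ) : ℂ) y := by
  have h3 : (Real.pi : ℂ) ≠ 0 := by exact_mod_cast Real.pi_ne_zero
  unfold gaussSymbol
  rw [Complex.ofReal_exp]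
  congr 1
  push_cast
  field_simp

/-- The damped function is in L¹ ∩ L², where the group is its kernel integral. The damping tends to
the identity strongly and the group is continuous, so the Abel limit exists and uniqueness of limits
gives both directions. -/
theorem hasKernelIntegral_iff {n : ℕ} {ħ m t : ℝ} (hħ : 0 < ħ) (hm : 0 < m) (ht : t ≠ 0)
    (g h : LTwo n) : HasKernelIntegral ħ m t g h ↔ h = freeGroup n (ħ / (2 * m) * t) g := by
  have hs : ħ / (2 * m) * t ≠ 0 := mul_ne_zero (by positivity) ht
  set s := ħ / (2 * m) * t with hsdef
  set Ψ : ℝ → LTwo n := fun ε =>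
    freeGroup n s (gaussMul ((ε / (4 * Real.pi ^ 2) : ℝ) : ℂ) g) with hΨ
  have hlim : Tendsto Ψ (𝓝[>] 0) (𝓝 (freeGroup n s g)) := by
    refine ((freeGroup n s).continuous.tendsto g).comp ?_
    have h0 : Tendsto (fun ε : ℝ => ((ε / (4 * Real.pi ^ 2) : ℝ) : ℂ)) (𝓝[>] 0) (𝓝 0) := by
      have : Continuous fun ε : ℝ => ((ε / (4 * Real.pi ^ 2) : ℝ) : ℂ) := by fun_prop
      have h := this.tendsto 0
      simp only [zero_div, Complex.ofReal_zero] at h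
      exact h.mono_left nhdsWithin_le_nhds
    have := tendsto_gaussMul (ζ := fun ε : ℝ => ((ε / (4 * Real.pi ^ 2) : ℝ) : ℂ)) ?_ ?_ h0 g
    · rwa [gaussMul_zero] at this
    · filter_upwards [self_mem_nhdsWithin] with ε hε
      rw [Complex.ofReal_re]
      have : (0 : ℝ) < ε := hε
      positivity
    · simp
  have hrep : ∀ ε > 0, Ψ ε =ᵐ[volume] fun x =>
      ∫ y, (Real.exp (-ε * ‖y‖ ^ 2) : ℂ) * (freeKernel ħ m x y t * g y) := by
    intro ε hε
    have hre : 0 < (((ε / (4 * Real.pi ^ 2) : ℝ) : ℂ)).re := by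
      rw [Complex.ofReal_re]; positivity
    have hc := gaussMul_coe hre.le g
    have hi := (integrable_gaussSymbol_mul hre g).congr hc.symm
    filter_upwards [freeGroup_ae_eq_integral hs _ hi] with x hx
    rw [hΨ]
    simp only
    rw [hx]
    refine integral_congr_ae ?_
    filter_upwards [hc] with y hy
    rw [hy, freeKernel_eq_gaussKernel hħ hm, exp_neg_mul_eq_gaussSymbol]
    ring
  have hiff : HasKernelIntegral ħ m t g h ↔ Tendsto Ψ (𝓝[>] 0) (𝓝 h) := by
    rw [Lp.tendsto_Lp_iff_tendsto_eLpNorm']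
    refine tendsto_congr' ?_
    filter_upwards [self_mem_nhdsWithin] with ε hε
    refine eLpNorm_congr_ae ?_
    filter_upwards [hrep ε hε] with x hx
    rw [Pi.sub_apply, hx]
  rw [hiff]
  exact ⟨fun h => tendsto_nhds_unique h hlim, fun h => h ▸ hlim⟩

theorem isFreePropagator_freeGroup {n : ℕ} {ħ m : ℝ} (hħ : 0 < ħ) (hm : 0 < m) :
    IsFreePropagator ħ m (ContinuousLinearMap.id ℂ (LTwo n))
      (fun t => (freeGroup n (ħ / (2 * m) * t)).toContinuousLinearMap) where
  kernel t ht b := (hasKernelIntegral_iff hħ hm ht _ _).2 rfl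
  zero := by
    ext1 b
    simp [freeGroup_zero]
  continuous b := (freeGroup_continuous b).comp (by fun_prop)

/-! ### Boundedness and continuity of the propagators on `B`. -/

section Propagator

variable {n : ℕ} {ħ m : ℝ} {B : Type*} [NormedAddCommGroup B] [NormedSpace ℂ B]
  {j : B →L[ℂ] LTwo n} {U : ℝ → B →L[ℂ] B}

/-- The only link between `B` and the Fourier side. In particular the group law of `U` is never
assumed; it is read off in L². -/
theorem IsFreePropagator.apply_eq (hU : IsFreePropagator ħ m j U) (hħ : 0 < ħ) (hm : 0 < m)
    (t : ℝ) (b : B) : j (U t b) = freeGroup n (ħ / (2 * m) * t) (j b) := by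
  rcases eq_or_ne t 0 with rfl | ht
  · rw [hU.zero, mul_zero, freeGroup_zero]; rfl
  · exact (hasKernelIntegral_iff hħ hm ht _ _).1 (hU.kernel t ht b)

/-- Orbits are continuous, hence bounded on compact intervals; uniform boundedness does the rest. -/
theorem IsFreePropagator.exists_bound [CompleteSpace B] (hU : IsFreePropagator ħ m j U) (R : ℝ) :
    ∃ C : ℝ, ∀ s ∈ Icc (-R) R, ‖U s‖ ≤ C := by
  obtain ⟨C, hC⟩ := banach_steinhaus (g := fun s : Icc (-R) R => U s) fun b => by
    obtain ⟨C, hC⟩ := isCompact_Icc.exists_bound_of_continuousOn (s := Icc (-R) R)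
      (hU.continuous b).continuousOn
    exact ⟨C, fun s => hC s s.2⟩
  exact ⟨C, fun s hs => hC ⟨s, hs⟩⟩

/-- Strong continuity together with the local uniform bound. Joint continuity is what makes `τ ↦ U
(t - τ) (F τ)` strongly measurable. -/
theorem IsFreePropagator.continuous_uncurry [CompleteSpace B] (hU : IsFreePropagator ħ m j U) :
    Continuous fun p : ℝ × B => U p.1 p.2 := by
  rw [continuous_iff_continuousAt]
  rintro ⟨s, g⟩
  obtain ⟨C, hC⟩ := hU.exists_bound (|s| + 1)
  rw [ContinuousAt, tendsto_iff_norm_sub_tendsto_zero]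
  have hc : Continuous fun p : ℝ × B => C * ‖p.2 - g‖ + ‖U p.1 g - U s g‖ :=
    ((continuous_snd.sub continuous_const).norm.const_mul C).add
      (((hU.continuous g).comp continuous_fst).sub continuous_const).norm
  have h1 := hc.tendsto (s, g)
  simp only [sub_self, norm_zero, mul_zero, add_zero] at h1
  refine squeeze_zero' (Eventually.of_forall fun _ => norm_nonneg _) ?_ h1
  have hev : ∀ᶠ p : ℝ × B in 𝓝 (s, g), p.1 ∈ Icc (-(|s| + 1)) (|s| + 1) := by
    refine continuous_fst.continuousAt.eventually (Icc_mem_nhds ?_ ?_)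
    · have := neg_abs_le s; dsimp only; linarith
    · have := le_abs_self s; dsimp only; linarith
  filter_upwards [hev] with p hp
  calc ‖U p.1 p.2 - U s g‖ = ‖U p.1 (p.2 - g) + (U p.1 g - U s g)‖ := by
        rw [map_sub]; congr 1; abel
    _ ≤ _ := by
        refine (norm_add_le _ _).trans ?_
        gcongr
        exact (U p.1).le_of_opNorm_le (hC _ hp) _

end Propagator

theorem ae_norm_le_of_eLpNorm_top_le {B : Type*} [NormedAddCommGroup B] {μ : Measure ℝ}
    {F : ℝ → B} {ξ : ℝ → ℝ} {M : ℝ} (hM : 0 ≤ M) (hξ : ∀ᵐ t ∂μ, ‖F t‖ ≤ ξ t)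
    (hξM : eLpNorm ξ ⊤ μ ≤ ENNReal.ofReal M) : ∀ᵐ t ∂μ, ‖F t‖ ≤ M := by
  rw [eLpNorm_exponent_top] at hξM
  filter_upwards [hξ, ae_le_eLpNormEssSup (f := ξ) (μ := μ)] with t h1 h2
  have h3 : ‖ξ t‖ₑ ≤ ENNReal.ofReal M := h2.trans hξM
  rw [← ofReal_norm, ENNReal.ofReal_le_ofReal_iff hM] at h3
  exact h1.trans ((le_abs_self _).trans h3)

/-! ### The Duhamel integral in `B`: convergence, bound and continuity. -/

section Source

variable {n : ℕ} {ħ m T M : ℝ} {B : Type*} [NormedAddCommGroup B] [NormedSpace ℂ B]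
  {j : B →L[ℂ] LTwo n} {U : ℝ → B →L[ℂ] B} {F : ℝ → B}

theorem IsFreePropagator.aestronglyMeasurable_apply [CompleteSpace B]
    (hU : IsFreePropagator ħ m j U) {μ : Measure ℝ}
    (hF : AEStronglyMeasurable F μ) (t : ℝ) :
    AEStronglyMeasurable (fun τ => U (t - τ) (F τ)) μ := by
  have h1 : AEStronglyMeasurable (fun τ : ℝ => (t - τ, F τ)) μ :=
    (by fun_prop : Continuous fun τ : ℝ => t - τ).aestronglyMeasurable.prodMk hF
  exact hU.continuous_uncurry.comp_aestronglyMeasurable h1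

theorem ae_norm_apply_le {C : ℝ} (hC : ∀ s ∈ Icc 0 T, ‖U s‖ ≤ C)
    (hFM : ∀ᵐ t ∂(volume.restrict (Ioo 0 T)), ‖F t‖ ≤ M) {t : ℝ} (ht : t ∈ Icc 0 T) :
    ∀ᵐ τ ∂(volume.restrict (Ioo 0 T)), τ ≤ t → ‖U (t - τ) (F τ)‖ ≤ C * M := by
  filter_upwards [hFM, ae_restrict_mem measurableSet_Ioo] with τ hτ hτI hτt
  have hs : t - τ ∈ Icc 0 T := ⟨by linarith, by linarith [hτI.1, ht.2]⟩
  have hC0 : 0 ≤ C := (norm_nonneg _).trans (hC _ hs)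
  calc ‖U (t - τ) (F τ)‖ ≤ C * ‖F τ‖ := (U (t - τ)).le_of_opNorm_le (hC _ hs) _
    _ ≤ C * M := by gcongr

theorem IsFreePropagator.exists_bound_Icc [CompleteSpace B] (hU : IsFreePropagator ħ m j U) (T : ℝ) :
    ∃ C : ℝ, ∀ s ∈ Icc 0 T, ‖U s‖ ≤ C := by
  obtain ⟨C, hC⟩ := hU.exists_bound T
  exact ⟨C, fun s hs => hC s ⟨by linarith [hs.1, hs.2], hs.2⟩⟩

theorem ae_restrict_Ioo_of_le {p : ℝ → Prop} {t : ℝ} (ht : t ≤ T)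
    (h : ∀ᵐ τ ∂(volume.restrict (Ioo 0 T)), τ ≤ t → p τ) :
    ∀ᵐ τ ∂(volume.restrict (Ioo 0 t)), p τ := by
  filter_upwards [ae_mono (Measure.restrict_mono (Ioo_subset_Ioo_right ht) le_rfl) h,
    ae_restrict_mem measurableSet_Ioo] with τ h1 h2 using h1 h2.2.le

theorem IsFreePropagator.intervalIntegrable [CompleteSpace B] (hU : IsFreePropagator ħ m j U)
    (hF : AEStronglyMeasurable F (volume.restrict (Ioo 0 T)))
    (hFM : ∀ᵐ t ∂(volume.restrict (Ioo 0 T)), ‖F t‖ ≤ M) {t : ℝ} (ht : t ∈ Icc 0 T) :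
    IntervalIntegrable (fun τ => U (t - τ) (F τ)) volume 0 t := by
  obtain ⟨C, hC⟩ := hU.exists_bound_Icc T
  rw [intervalIntegrable_iff_integrableOn_Ioo_of_le ht.1]
  exact Integrable.of_bound
    (hU.aestronglyMeasurable_apply (hF.mono_set (Ioo_subset_Ioo_right ht.2)) t) (C * M)
    (ae_restrict_Ioo_of_le ht.2 (ae_norm_apply_le hC hFM ht))

theorem norm_sourceTerm_le (hħ : 0 < ħ) {C : ℝ} (hC : ∀ s ∈ Icc 0 T, ‖U s‖ ≤ C)
    (hFM : ∀ᵐ t ∂(volume.restrict (Ioo 0 T)), ‖F t‖ ≤ M) {t : ℝ} (ht : t ∈ Icc 0 T) :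
    ‖sourceTerm ħ U F t‖ ≤ C / ħ * M * t := by
  have h1 : ‖∫ τ in (0 : ℝ)..t, U (t - τ) (F τ)‖ ≤ C * M * |t - 0| := by
    refine intervalIntegral.norm_integral_le_of_norm_le_const_ae ?_
    have h2 := ae_restrict_Ioo_of_le ht.2 (ae_norm_apply_le hC hFM ht)
    rw [restrict_Ioo_eq_restrict_Ioc, ae_restrict_iff' measurableSet_Ioc] at h2
    rwa [uIoc_of_le ht.1]
  rw [sub_zero, abs_of_nonneg ht.1] at h1
  rw [sourceTerm, norm_smul, norm_neg, norm_div, Complex.norm_I, Complex.norm_real,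
    Real.norm_of_nonneg hħ.le]
  calc 1 / ħ * ‖∫ τ in (0 : ℝ)..t, U (t - τ) (F τ)‖ ≤ 1 / ħ * (C * M * t) := by gcongr
    _ = C / ħ * M * t := by ring

theorem IsFreePropagator.tendsto_sourceTerm [CompleteSpace B] (hU : IsFreePropagator ħ m j U) (hħ : 0 < ħ)
    (hT : 0 < T) (hFM : ∀ᵐ t ∂(volume.restrict (Ioo 0 T)), ‖F t‖ ≤ M) :
    Tendsto (sourceTerm ħ U F) (𝓝[≥] 0) (𝓝 0) := by
  obtain ⟨C, hC⟩ := hU.exists_bound_Icc T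
  refine squeeze_zero_norm' (a := fun t => C / ħ * M * t) ?_ ?_
  · filter_upwards [Icc_mem_nhdsGE hT] with t ht using norm_sourceTerm_le hħ hC hFM ht
  · have : Continuous fun t : ℝ => C / ħ * M * t := by fun_prop
    have h := this.tendsto 0
    rw [mul_zero] at h
    exact h.mono_left nhdsWithin_le_nhds

/-- With a fixed domain of integration, `t` enters only through the integrand and dominated
convergence applies. -/
theorem sourceTerm_eq_integral_indicator {t : ℝ} (ht : t ∈ Icc 0 T) :
    sourceTerm ħ U F t = (-(Complex.I / ħ)) •
      ∫ τ in Ioo 0 T, (Iio t).indicator (fun τ => U (t - τ) (F τ)) τ := by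
  rw [sourceTerm, setIntegral_indicator measurableSet_Iio, Ioo_inter_Iio,
    min_eq_right ht.2, intervalIntegral.integral_of_le ht.1, integral_Ioc_eq_integral_Ioo]

theorem IsFreePropagator.continuousOn_sourceTerm [CompleteSpace B] (hU : IsFreePropagator ħ m j U)
    (hM : 0 ≤ M) (hF : AEStronglyMeasurable F (volume.restrict (Ioo 0 T)))
    (hFM : ∀ᵐ t ∂(volume.restrict (Ioo 0 T)), ‖F t‖ ≤ M) :
    ContinuousOn (sourceTerm ħ U F) (Icc 0 T) := by
  obtain ⟨C, hC⟩ := hU.exists_bound_Icc T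
  refine ContinuousOn.congr (f := fun t => (-(Complex.I / ħ)) •
      ∫ τ in Ioo 0 T, (Iio t).indicator (fun τ => U (t - τ) (F τ)) τ) ?_
    fun t ht => sourceTerm_eq_integral_indicator ht
  refine ContinuousOn.const_smul ?_ _
  intro t₀ ht₀
  have hC0 : 0 ≤ C := (norm_nonneg _).trans (hC t₀ ht₀)
  refine continuousWithinAt_of_dominated (bound := fun _ => C * M) ?_ ?_ (integrable_const _) ?_
  · exact Eventually.of_forall fun t =>
      (hU.aestronglyMeasurable_apply hF t).indicator measurableSet_Iio
  · filter_upwards [self_mem_nhdsWithin] with t ht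
    filter_upwards [ae_norm_apply_le hC hFM ht] with τ hτ
    rw [indicator_apply]
    split_ifs with h
    · exact hτ (le_of_lt h)
    · rw [norm_zero]; positivity
  -- For `τ ≠ t₀` the indicator is constant near `t₀`; the jump at `τ = t₀` concerns a null set.
  · have hne : ∀ᵐ τ ∂(volume.restrict (Ioo 0 T)), τ ≠ t₀ :=
      ae_restrict_of_ae (Measure.ae_ne volume t₀)
    filter_upwards [hne] with τ hτ
    refine ContinuousAt.continuousWithinAt ?_
    have hcont : ContinuousAt (fun t => U (t - τ) (F τ)) t₀ :=
      ((hU.continuous (F τ)).comp (by fun_prop : Continuous fun t : ℝ => t - τ)).continuousAt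
    rcases lt_or_gt_of_ne hτ with h | h
    · refine hcont.congr ?_
      filter_upwards [lt_mem_nhds h] with t ht
      rw [indicator_of_mem (mem_Iio.2 ht)]
    · refine (continuousAt_const (y := (0 : B))).congr ?_
      filter_upwards [gt_mem_nhds h] with t ht
      rw [indicator_of_notMem (by simpa using ht.le)]

theorem IsFreePropagator.memLp_add_sourceTerm [CompleteSpace B] (hU : IsFreePropagator ħ m j U)
    (hM : 0 ≤ M)
    (hF : AEStronglyMeasurable F (volume.restrict (Ioo 0 T)))
    (hFM : ∀ᵐ t ∂(volume.restrict (Ioo 0 T)), ‖F t‖ ≤ M) (b : B) :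
    MemLp (fun t => U t b + sourceTerm ħ U F t) ⊤ (volume.restrict (Ioo 0 T)) := by
  have hc : ContinuousOn (fun t => U t b + sourceTerm ħ U F t) (Icc 0 T) :=
    (hU.continuous b).continuousOn.add (hU.continuousOn_sourceTerm hM hF hFM)
  obtain ⟨C, hC⟩ := isCompact_Icc.exists_bound_of_continuousOn hc
  refine memLp_top_of_bound
    ((hc.mono Ioo_subset_Icc_self).aestronglyMeasurable measurableSet_Ioo) C ?_
  filter_upwards [ae_restrict_mem measurableSet_Ioo] with t ht using hC t (Ioo_subset_Icc_self ht)

end Source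

/-! ### Derivatives of the heat kernel in space and complex time. -/

/-- The Laplacian computed from line derivatives along the standard basis. -/
theorem laplacian_eq_sum_of_hasLineDerivAt {n : ℕ} {f : Space n → ℂ} {x : Space n}
    (hf : ContDiffAt ℝ 2 f x) {D : Fin n → Space n → ℂ} {S : Fin n → ℂ}
    (hD : ∀ i, ∀ᶠ y in 𝓝 x, HasLineDerivAt ℝ f (D i y) y (EuclideanSpace.basisFun (Fin n) ℝ i))
    (hS : ∀ i, HasLineDerivAt ℝ (D i) (S i) x (EuclideanSpace.basisFun (Fin n) ℝ i)) :
    Laplacian.laplacian f x = ∑ i, S i := by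
  rw [InnerProductSpace.laplacian_eq_iteratedFDeriv_orthonormalBasis f
    (EuclideanSpace.basisFun (Fin n) ℝ)]
  refine Finset.sum_congr rfl fun i _ => ?_
  set e := EuclideanSpace.basisFun (Fin n) ℝ i
  rw [iteratedFDeriv_two_apply]
  have hd : ∀ᶠ y in 𝓝 x, DifferentiableAt ℝ f y := by
    filter_upwards [hf.eventually (by simp)] with y hy using hy.differentiableAt (by norm_num)
  have hfd : DifferentiableAt ℝ (fderiv ℝ f) x :=
    (hf.fderiv_right (m := 1) (by norm_num)).differentiableAt (by norm_num)
  have h1 : HasFDerivAt (fun y => fderiv ℝ f y e)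
      ((fderiv ℝ (fderiv ℝ f) x).flip e) x := by
    exact (hfd.hasFDerivAt.clm_apply (hasFDerivAt_const e x)).congr_fderiv (by ext v; simp)
  have h2 : (fun y => fderiv ℝ f y e) =ᶠ[𝓝 x] D i := by
    filter_upwards [hd, hD i] with y hy1 hy2
    exact (hy1.hasFDerivAt.hasLineDerivAt e).unique hy2
  have h3 := (h1.congr_of_eventuallyEq h2.symm).hasLineDerivAt e
  have := h3.unique (hS i)
  simpa using this

theorem hasDerivAt_norm_sq_line {n : ℕ} (x v : Space n) (t : ℝ) :
    HasDerivAt (fun t : ℝ => ((‖x + t • v‖ : ℝ) : ℂ) ^ 2) ((2 * inner ℝ (x + t • v) v : ℝ) : ℂ) t := by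
  have h1 : HasDerivAt (fun t : ℝ => x + t • v) v t := by
    simpa using ((hasDerivAt_id t).smul_const v).const_add x
  have h2 := h1.norm_sq.ofReal_comp
  simpa using h2

theorem hasDerivAt_inner_line {n : ℕ} (x v : Space n) (t : ℝ) :
    HasDerivAt (fun t : ℝ => ((inner ℝ (x + t • v) v : ℝ) : ℂ)) ((‖v‖ ^ 2 : ℝ) : ℂ) t := by
  have h1 : HasDerivAt (fun t : ℝ => x + t • v) v t := by
    simpa using ((hasDerivAt_id t).smul_const v).const_add x
  have h2 := (h1.inner ℝ (hasDerivAt_const t v)).ofReal_comp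
  simpa [real_inner_self_eq_norm_sq] using h2

theorem hasDerivAt_gaussKernel_line {n : ℕ} (z : ℂ) (x v : Space n) (t : ℝ) :
    HasDerivAt (fun t : ℝ => gaussKernel z (x + t • v))
      (-((inner ℝ (x + t • v) v : ℝ) : ℂ) / (2 * z) * gaussKernel z (x + t • v)) t := by
  unfold gaussKernel
  have h := (((hasDerivAt_norm_sq_line x v t).fun_neg.div_const (4 * z)).cexp).const_mul
    ((1 / (4 * Real.pi * z)) ^ ((n : ℂ) / 2))
  refine h.congr_deriv ?_
  push_cast
  rcases eq_or_ne z 0 with rfl | hz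
  · simp
  · field_simp; ring

theorem hasDerivAt_gaussKernel_line_two {n : ℕ} (z : ℂ) (x v : Space n) (t : ℝ) :
    HasDerivAt (fun t : ℝ =>
        -((inner ℝ (x + t • v) v : ℝ) : ℂ) / (2 * z) * gaussKernel z (x + t • v))
      ((((inner ℝ (x + t • v) v : ℝ) : ℂ) ^ 2 / (4 * z ^ 2) - ((‖v‖ ^ 2 : ℝ) : ℂ) / (2 * z)) *
        gaussKernel z (x + t • v)) t := by
  have h := ((hasDerivAt_inner_line x v t).fun_neg.div_const (2 * z)).mul
    (hasDerivAt_gaussKernel_line z x v t)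
  refine h.congr_deriv ?_
  rcases eq_or_ne z 0 with rfl | hz
  · simp
  · field_simp; ring

/-- The heat equation for the heat kernel, in the complex time variable. -/
theorem hasDerivAt_gaussKernel_time {n : ℕ} {z : ℂ} (hz : z ∈ Complex.slitPlane) (x : Space n) :
    HasDerivAt (fun z => gaussKernel z x)
      (((‖x‖ : ℂ) ^ 2 / (4 * z ^ 2) - n / (2 * z)) * gaussKernel z x) z := by
  have hz0 : z ≠ 0 := Complex.slitPlane_ne_zero hz
  have hpi : (Real.pi : ℂ) ≠ 0 := by exact_mod_cast Real.pi_ne_zero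
  unfold gaussKernel
  have hsl := inv_four_pi_mem_slitPlane hz
  have h1 : HasDerivAt (fun z : ℂ => 1 / (4 * Real.pi * z)) (-(1 / (4 * Real.pi * z)) / z) z := by
    have := (hasDerivAt_const z (1 : ℂ)).div ((hasDerivAt_id z).const_mul (4 * (Real.pi : ℂ)))
      (by simp [hz0, hpi])
    refine this.congr_deriv ?_
    simp only [id]; field_simp; ring
  have h2 := h1.cpow_const (c := (n : ℂ) / 2) hsl
  have h3 : HasDerivAt (fun z : ℂ => -(‖x‖ : ℂ) ^ 2 / (4 * z)) ((‖x‖ : ℂ) ^ 2 / (4 * z ^ 2)) z := by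
    have := (hasDerivAt_const z (-(‖x‖ : ℂ) ^ 2)).div ((hasDerivAt_id z).const_mul (4 : ℂ))
      (by simp [hz0])
    refine this.congr_deriv ?_
    simp only [id]; field_simp; ring
  refine (h2.mul h3.cexp).congr_deriv ?_
  rw [Complex.cpow_sub _ _ (Complex.slitPlane_ne_zero hsl), Complex.cpow_one]
  have hne := Complex.slitPlane_ne_zero hsl
  generalize (1 / (4 * (Real.pi : ℂ) * z)) = q at hne
  field_simp
  ring

theorem sum_inner_basisFun_sq {n : ℕ} (x : Space n) :
    ∑ i, ((inner ℝ x (EuclideanSpace.basisFun (Fin n) ℝ i) : ℝ) : ℂ) ^ 2 = (‖x‖ : ℂ) ^ 2 := by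
  have := (EuclideanSpace.basisFun (Fin n) ℝ).sum_sq_inner_left x
  exact_mod_cast this

/-! ### Differentiation under the integral with the weight 1 + |y|². -/

section Weighted

variable {n : ℕ} {f : Space n → ℂ}

theorem integrable_mul_of_le_weight (hfm : AEStronglyMeasurable f volume)
    (hf : Integrable fun y => ((1 + ‖y‖ ^ 2 : ℝ) : ℂ) * f y) {k : Space n → ℂ} (hk : Continuous k)
    {C : ℝ} (hC : ∀ y, ‖k y‖ ≤ C * (1 + ‖y‖ ^ 2)) : Integrable fun y => k y * f y := by
  refine (hf.norm.const_mul C).mono' (hk.aestronglyMeasurable.mul hfm)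
    (Eventually.of_forall fun y => ?_)
  rw [norm_mul, norm_mul, Complex.norm_real, Real.norm_of_nonneg (by positivity), ← mul_assoc]
  gcongr
  exact hC y

theorem hasDerivAt_integral_of_le_weight (hfm : AEStronglyMeasurable f volume)
    (hf : Integrable fun y => ((1 + ‖y‖ ^ 2 : ℝ) : ℂ) * f y) {k k' : ℝ → Space n → ℂ} {t₀ r C : ℝ}
    (hr : 0 < r) (hk : ∀ t, Continuous (k t)) (hk' : Continuous (k' t₀))
    (hC : ∀ y, ‖k t₀ y‖ ≤ C * (1 + ‖y‖ ^ 2))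
    (hC' : ∀ t ∈ Metric.ball t₀ r, ∀ y, ‖k' t y‖ ≤ C * (1 + ‖y‖ ^ 2))
    (hd : ∀ t ∈ Metric.ball t₀ r, ∀ y, HasDerivAt (fun t => k t y) (k' t y) t) :
    HasDerivAt (fun t => ∫ y, k t y * f y) (∫ y, k' t₀ y * f y) t₀ := by
  refine (hasDerivAt_integral_of_dominated_loc_of_deriv_le
    (F := fun t y => k t y * f y) (F' := fun t y => k' t y * f y)
    (bound := fun y => C * ‖((1 + ‖y‖ ^ 2 : ℝ) : ℂ) * f y‖) (Metric.ball_mem_nhds t₀ hr) ?_ ?_ ?_ ?_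
    (hf.norm.const_mul C) ?_).2
  · exact Eventually.of_forall fun t => (hk t).aestronglyMeasurable.mul hfm
  · exact integrable_mul_of_le_weight hfm hf (hk t₀) hC
  · exact hk'.aestronglyMeasurable.mul hfm
  · refine Eventually.of_forall fun y t ht => ?_
    rw [norm_mul, norm_mul, Complex.norm_real, Real.norm_of_nonneg (by positivity), ← mul_assoc]
    gcongr
    exact hC' t ht y
  · exact Eventually.of_forall fun y t ht => (hd t ht y).mul_const _

end Weighted

/-! ### Space regularity of the Poisson integral. -/

section Poisson

variable {n : ℕ} {f : Space n → ℂ}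

theorem norm_sub_add_smul_le {x y e : Space n} (he : ‖e‖ = 1) {t : ℝ}
    (ht : t ∈ Metric.ball (0 : ℝ) 1) : ‖x - y + t • e‖ ≤ ‖x‖ + 1 + ‖y‖ := by
  have ht' : |t| ≤ 1 := by simpa using (Metric.mem_ball.1 ht).le
  calc ‖x - y + t • e‖ ≤ ‖x - y‖ + ‖t • e‖ := norm_add_le _ _
    _ ≤ (‖x‖ + ‖y‖) + 1 := by
        gcongr
        · exact norm_sub_le _ _
        · rw [norm_smul, he, mul_one]; exact ht'
    _ = _ := by ring

theorem abs_inner_le_weight {x y e : Space n} (he : ‖e‖ = 1) {t : ℝ}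
    (ht : t ∈ Metric.ball (0 : ℝ) 1) :
    |inner ℝ (x - y + t • e) e| ≤ (‖x‖ + 2) * (1 + ‖y‖ ^ 2) := by
  have h1 := abs_real_inner_le_norm (x - y + t • e) e
  have h2 := norm_sub_add_smul_le (x := x) (y := y) he ht
  rw [he, mul_one] at h1
  nlinarith [norm_nonneg x, norm_nonneg y, sq_nonneg (‖y‖ - 1), mul_nonneg (norm_nonneg x) (sq_nonneg ‖y‖)]

/-- From (a + b)² ≤ 2a² + 2b² with a = |x| + 1 and b = |y|; the extra 1 covers the increment `t •
e`. -/
theorem sq_inner_le_weight {x y e : Space n} (he : ‖e‖ = 1) {t : ℝ}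
    (ht : t ∈ Metric.ball (0 : ℝ) 1) :
    |inner ℝ (x - y + t • e) e| ^ 2 ≤ (2 * (‖x‖ + 1) ^ 2 + 2) * (1 + ‖y‖ ^ 2) := by
  have h1 := abs_real_inner_le_norm (x - y + t • e) e
  have h2 := norm_sub_add_smul_le (x := x) (y := y) he ht
  rw [he, mul_one] at h1
  have h3 : |inner ℝ (x - y + t • e) e| ^ 2 ≤ (‖x‖ + 1 + ‖y‖) ^ 2 := by gcongr; exact h1.trans h2
  nlinarith [sq_nonneg (‖x‖ + 1 - ‖y‖), mul_nonneg (sq_nonneg (‖x‖ + 1)) (sq_nonneg ‖y‖)]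

theorem norm_sub_sq_le_weight (x y : Space n) :
    ‖x - y‖ ^ 2 ≤ (2 * (‖x‖ + 1) ^ 2 + 2) * (1 + ‖y‖ ^ 2) := by
  have h1 := norm_sub_le x y
  have h3 : ‖x - y‖ ^ 2 ≤ (‖x‖ + ‖y‖) ^ 2 := by gcongr
  nlinarith [sq_nonneg (‖x‖ - ‖y‖), mul_nonneg (sq_nonneg (‖x‖ + 1)) (sq_nonneg ‖y‖), norm_nonneg x]

theorem norm_basisFun (i : Fin n) : ‖EuclideanSpace.basisFun (Fin n) ℝ i‖ = 1 :=
  (EuclideanSpace.basisFun (Fin n) ℝ).norm_eq_one i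

theorem integrable_gaussKernel_mul (hfm : AEStronglyMeasurable f volume)
    (hf : Integrable fun y => ((1 + ‖y‖ ^ 2 : ℝ) : ℂ) * f y)
    {s : ℝ} (x : Space n) :
    Integrable fun y => gaussKernel (s * Complex.I) (x - y) * f y := by
  refine integrable_mul_of_le_weight hfm hf
    (k := fun y => gaussKernel (s * Complex.I) (x - y))
    (C := ‖(1 / (4 * Real.pi * (s * Complex.I))) ^ ((n : ℂ) / 2)‖)
    ((continuous_gaussKernel_right _).comp (by fun_prop)) fun y => ?_
  refine (norm_gaussKernel_le (by simp) _).trans (le_mul_of_one_le_right (norm_nonneg _) ?_)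
  nlinarith [sq_nonneg ‖y‖]

/-- Expanding |x - y|² factors the kernel: up to a smooth factor in `x`, the integral is the Fourier
transform of the chirped function `e^{i|y|²/(4s)} f(y)` at `x/(4πs)`. The chirp is unimodular, so
the moments of `f` up to order two give C². -/
theorem contDiff_integral_gaussKernel (hfm : AEStronglyMeasurable f volume)
    (hf : Integrable fun y => ((1 + ‖y‖ ^ 2 : ℝ) : ℂ) * f y)
    {s : ℝ} (hs : s ≠ 0) :
    ContDiff ℝ 2 fun x : Space n => ∫ y, gaussKernel (s * Complex.I) (x - y) * f y := by
  set g : Space n → ℂ := fun y => Complex.exp (-(‖y‖ : ℂ) ^ 2 / (4 * (s * Complex.I))) * f y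
    with hg
  have hsC : (s : ℂ) ≠ 0 := by exact_mod_cast hs
  have hpi : (Real.pi : ℂ) ≠ 0 := by exact_mod_cast Real.pi_ne_zero
  have hgn : ∀ y, ‖g y‖ = ‖f y‖ := fun y => by
    have : -(‖y‖ : ℂ) ^ 2 / (4 * (s * Complex.I)) = ((‖y‖ ^ 2 / (4 * s) : ℝ) : ℂ) * Complex.I := by
      push_cast
      field_simp
      rw [Complex.I_sq]; ring
    rw [hg]; simp only
    rw [norm_mul, this, Complex.norm_exp_ofReal_mul_I, one_mul]
  have hgm : AEStronglyMeasurable g volume :=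
    (by fun_prop : Continuous fun y : Space n =>
      Complex.exp (-(‖y‖ : ℂ) ^ 2 / (4 * (s * Complex.I)))).aestronglyMeasurable.mul hfm
  have hF : ContDiff ℝ 2 (𝓕 g) := by
    refine Real.contDiff_fourier (N := 2) fun k hk => ?_
    have hk' : k ≤ 2 := by exact_mod_cast hk
    refine hf.norm.mono' ((by fun_prop : Continuous fun y : Space n =>
      ‖y‖ ^ k).aestronglyMeasurable.mul hgm.norm) (Eventually.of_forall fun y => ?_)
    rw [hgn, norm_mul, norm_mul, Complex.norm_real, norm_norm,
      Real.norm_of_nonneg (by positivity), Real.norm_of_nonneg (by positivity)]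
    gcongr
    interval_cases k <;> nlinarith [norm_nonneg y, sq_nonneg (‖y‖ - 1), sq_nonneg ‖y‖]
  have heq : (fun x : Space n => ∫ y, gaussKernel (s * Complex.I) (x - y) * f y) = fun x =>
      ((1 / (4 * Real.pi * (s * Complex.I))) ^ ((n : ℂ) / 2) *
        Complex.exp ((-(‖x‖ ^ 2 : ℝ) : ℂ) / (4 * (s * Complex.I)))) *
        𝓕 g ((4 * Real.pi * s)⁻¹ • x) := by
    ext x
    rw [Real.fourier_eq', ← integral_const_mul]
    congr 1; ext y
    have h1 : ((‖x - y‖ : ℝ) : ℂ) ^ 2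
        = (‖x‖ : ℂ) ^ 2 - 2 * (inner ℝ x y : ℝ) + (‖y‖ : ℂ) ^ 2 := by
      exact_mod_cast norm_sub_sq_real x y
    have h2 : Complex.exp (-(‖x - y‖ : ℂ) ^ 2 / (4 * (s * Complex.I))) =
        Complex.exp ((-(‖x‖ ^ 2 : ℝ) : ℂ) / (4 * (s * Complex.I))) *
        (Complex.exp (((-2 * Real.pi * inner ℝ y ((4 * Real.pi * s)⁻¹ • x) : ℝ) : ℂ) * Complex.I) *
          Complex.exp (-(‖y‖ : ℂ) ^ 2 / (4 * (s * Complex.I)))) := by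
      rw [← Complex.exp_add, ← Complex.exp_add, h1, inner_smul_right, real_inner_comm]
      congr 1
      push_cast
      field_simp
      ring_nf
      rw [Complex.I_sq]; ring
    unfold gaussKernel
    rw [hg, smul_eq_mul, h2]; ring
  rw [heq]
  refine ContDiff.mul (contDiff_const.mul (ContDiff.cexp (ContDiff.div_const ?_ _)))
    (hF.comp (contDiff_const_smul _))
  have : ContDiff ℝ 2 fun x : Space n => ‖x‖ ^ 2 := contDiff_norm_sq ℝ
  exact (Complex.ofRealCLM.contDiff.comp this).neg

theorem hasLineDerivAt_integral_gaussKernel (hfm : AEStronglyMeasurable f volume)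
    (hf : Integrable fun y => ((1 + ‖y‖ ^ 2 : ℝ) : ℂ) * f y)
    {s : ℝ} (x e : Space n) (he : ‖e‖ = 1) :
    HasLineDerivAt ℝ (fun x : Space n => ∫ y, gaussKernel (s * Complex.I) (x - y) * f y)
      (∫ y, (-((inner ℝ (x - y) e : ℝ) : ℂ) / (2 * (s * Complex.I)) *
        gaussKernel (s * Complex.I) (x - y)) * f y) x e := by
  set z : ℂ := s * Complex.I with hz
  set P := ‖(1 / (4 * Real.pi * z)) ^ ((n : ℂ) / 2)‖ with hP
  have hre : 0 ≤ z.re := by simp [hz]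
  have hP0 : 0 ≤ P := norm_nonneg _
  have key := hasDerivAt_integral_of_le_weight hfm hf (t₀ := 0) (r := 1)
    (k := fun t y => gaussKernel z (x - y + t • e))
    (k' := fun t y => -((inner ℝ (x - y + t • e) e : ℝ) : ℂ) / (2 * z) *
      gaussKernel z (x - y + t • e))
    -- Sum of a bound for the kernel and one for its derivative, so that one constant serves both.
    (C := P + (‖x‖ + 2) / ‖2 * z‖ * P) one_pos
    (fun t => (continuous_gaussKernel_right z).comp (by fun_prop))
    (Continuous.mul (by fun_prop) ((continuous_gaussKernel_right z).comp (by fun_prop)))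
    (fun y => ?_) (fun t ht y => ?_) (fun t _ y => hasDerivAt_gaussKernel_line z (x - y) e t)
  · simp only [zero_smul, add_zero] at key
    simp only [HasLineDerivAt, add_sub_right_comm]
    exact key
  · have h1 : 0 ≤ (‖x‖ + 2) / ‖2 * z‖ * P := by positivity
    refine (norm_gaussKernel_le hre _).trans ?_
    nlinarith [sq_nonneg ‖y‖, mul_nonneg hP0 (sq_nonneg ‖y‖), mul_nonneg h1 (sq_nonneg ‖y‖)]
  · rw [norm_mul, norm_div, norm_neg, Complex.norm_real, Real.norm_eq_abs]
    have h1 := abs_inner_le_weight (x := x) (y := y) he ht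
    calc |inner ℝ (x - y + t • e) e| / ‖2 * z‖ * ‖gaussKernel z (x - y + t • e)‖
        ≤ ((‖x‖ + 2) * (1 + ‖y‖ ^ 2)) / ‖2 * z‖ * P := by
          gcongr
          exact norm_gaussKernel_le hre _
      _ = (‖x‖ + 2) / ‖2 * z‖ * P * (1 + ‖y‖ ^ 2) := by ring
      _ ≤ _ := by gcongr; linarith

theorem hasLineDerivAt_integral_gaussKernel_two (hfm : AEStronglyMeasurable f volume)
    (hf : Integrable fun y => ((1 + ‖y‖ ^ 2 : ℝ) : ℂ) * f y)
    {s : ℝ} (x e : Space n) (he : ‖e‖ = 1) :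
    HasLineDerivAt ℝ (fun x : Space n => ∫ y, (-((inner ℝ (x - y) e : ℝ) : ℂ) /
        (2 * (s * Complex.I)) * gaussKernel (s * Complex.I) (x - y)) * f y)
      (∫ y, ((((inner ℝ (x - y) e : ℝ) : ℂ) ^ 2 / (4 * (s * Complex.I) ^ 2) -
        1 / (2 * (s * Complex.I))) * gaussKernel (s * Complex.I) (x - y)) * f y) x e := by
  set z : ℂ := s * Complex.I with hz
  set P := ‖(1 / (4 * Real.pi * z)) ^ ((n : ℂ) / 2)‖ with hP
  have hre : 0 ≤ z.re := by simp [hz]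
  have hP0 : 0 ≤ P := norm_nonneg _
  have key := hasDerivAt_integral_of_le_weight hfm hf (t₀ := 0) (r := 1)
    (k := fun t y => -((inner ℝ (x - y + t • e) e : ℝ) : ℂ) / (2 * z) *
      gaussKernel z (x - y + t • e))
    (k' := fun t y => (((inner ℝ (x - y + t • e) e : ℝ) : ℂ) ^ 2 / (4 * z ^ 2) -
      ((‖e‖ ^ 2 : ℝ) : ℂ) / (2 * z)) * gaussKernel z (x - y + t • e))
    (C := (‖x‖ + 2) / ‖2 * z‖ * P + ((2 * (‖x‖ + 1) ^ 2 + 2) / ‖4 * z ^ 2‖ + 1 / ‖2 * z‖) * P)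
    one_pos
    (fun t => Continuous.mul (by fun_prop) ((continuous_gaussKernel_right z).comp (by fun_prop)))
    (Continuous.mul (by fun_prop) ((continuous_gaussKernel_right z).comp (by fun_prop)))
    (fun y => ?_) (fun t ht y => ?_) (fun t _ y => hasDerivAt_gaussKernel_line_two z (x - y) e t)
  · simp only [zero_smul, add_zero, he, one_pow, Complex.ofReal_one] at key
    simp only [HasLineDerivAt, add_sub_right_comm]
    exact key
  · rw [norm_mul, norm_div, norm_neg, Complex.norm_real, Real.norm_eq_abs]
    have h1 := abs_inner_le_weight (x := x) (y := y) he (t := 0) (by simp)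
    calc |inner ℝ (x - y + (0 : ℝ) • e) e| / ‖2 * z‖ * ‖gaussKernel z (x - y + (0 : ℝ) • e)‖
        ≤ ((‖x‖ + 2) * (1 + ‖y‖ ^ 2)) / ‖2 * z‖ * P := by
          gcongr
          exact norm_gaussKernel_le hre _
      _ = (‖x‖ + 2) / ‖2 * z‖ * P * (1 + ‖y‖ ^ 2) := by ring
      _ ≤ _ := by
          gcongr
          have : 0 ≤ ((2 * (‖x‖ + 1) ^ 2 + 2) / ‖4 * z ^ 2‖ + 1 / ‖2 * z‖) * P := by positivity
          linarith
  · rw [norm_mul]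
    have h1 := sq_inner_le_weight (x := x) (y := y) he ht
    have h2 : ‖((inner ℝ (x - y + t • e) e : ℝ) : ℂ) ^ 2 / (4 * z ^ 2) -
        ((‖e‖ ^ 2 : ℝ) : ℂ) / (2 * z)‖ ≤ (2 * (‖x‖ + 1) ^ 2 + 2) * (1 + ‖y‖ ^ 2) / ‖4 * z ^ 2‖ +
          1 * (1 + ‖y‖ ^ 2) / ‖2 * z‖ := by
      refine (norm_sub_le _ _).trans ?_
      rw [norm_div, norm_div, norm_pow, Complex.norm_real, Real.norm_eq_abs, he]
      gcongr
      simp only [one_pow, Complex.ofReal_one, norm_one]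
      nlinarith [sq_nonneg ‖y‖]
    calc _ ≤ ((2 * (‖x‖ + 1) ^ 2 + 2) * (1 + ‖y‖ ^ 2) / ‖4 * z ^ 2‖ +
          1 * (1 + ‖y‖ ^ 2) / ‖2 * z‖) * P := by
          gcongr
          exact norm_gaussKernel_le hre _
      _ = ((2 * (‖x‖ + 1) ^ 2 + 2) / ‖4 * z ^ 2‖ + 1 / ‖2 * z‖) * P * (1 + ‖y‖ ^ 2) := by ring
      _ ≤ _ := by
          gcongr
          have : 0 ≤ (‖x‖ + 2) / ‖2 * z‖ * P := by positivity
          linarith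

end Poisson

/-! ### Time derivative of the Poisson integral and the homogeneous equation. -/

section PoissonTime

variable {n : ℕ} {f : Space n → ℂ}

theorem hasDerivAt_gaussKernel_imag {c t : ℝ} (hc : c ≠ 0) (ht : t ≠ 0) (x : Space n) :
    HasDerivAt (fun t : ℝ => gaussKernel ((c * t : ℝ) * Complex.I) x)
      ((c * Complex.I) * ((‖x‖ : ℂ) ^ 2 / (4 * ((c * t : ℝ) * Complex.I) ^ 2) -
        n / (2 * ((c * t : ℝ) * Complex.I))) * gaussKernel ((c * t : ℝ) * Complex.I) x) t := by
  have h1 : HasDerivAt (fun t : ℝ => ((c * t : ℝ) : ℂ) * Complex.I) (c * Complex.I) t := by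
    have := (((hasDerivAt_id t).const_mul c).ofReal_comp).mul_const Complex.I
    simpa using this
  have h2 := hasDerivAt_gaussKernel_time (imag_mem_slitPlane (mul_ne_zero hc ht)) x
  refine (h2.scomp t h1).congr_deriv ?_
  rw [smul_eq_mul]; ring

theorem norm_gaussPrefactor {c t : ℝ} :
    ‖(1 / (4 * Real.pi * ((c * t : ℝ) * Complex.I))) ^ ((n : ℂ) / 2)‖
      = (1 / (4 * Real.pi * (|c| * |t|))) ^ ((n : ℝ) / 2) := by
  have : ((n : ℂ) / 2) = (((n : ℝ) / 2 : ℝ) : ℂ) := by push_cast; rfl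
  rw [this, Complex.norm_cpow_real]
  congr 1
  simp [abs_of_pos Real.pi_pos]

theorem hasDerivAt_integral_gaussKernel_time (hfm : AEStronglyMeasurable f volume)
    (hf : Integrable fun y => ((1 + ‖y‖ ^ 2 : ℝ) : ℂ) * f y) {c t : ℝ} (hc : c ≠ 0) (ht : t ≠ 0)
    (x : Space n) :
    HasDerivAt (fun t : ℝ => ∫ y, gaussKernel ((c * t : ℝ) * Complex.I) (x - y) * f y)
      (∫ y, ((c * Complex.I) * ((‖x - y‖ : ℂ) ^ 2 / (4 * ((c * t : ℝ) * Complex.I) ^ 2) -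
        n / (2 * ((c * t : ℝ) * Complex.I))) * gaussKernel ((c * t : ℝ) * Complex.I) (x - y)) *
        f y) t := by
  have hct : 0 < |c| * |t| := by positivity
  -- The prefactor decreases in the absolute value of time, which is at least `|t| / 2` on the ball
  -- of radius `|t| / 2` about `t`.
  set P : ℝ := (1 / (4 * Real.pi * (|c| * (|t| / 2)))) ^ ((n : ℝ) / 2) with hP
  have hP0 : 0 ≤ P := by positivity
  have hball : ∀ r ∈ Metric.ball t (|t| / 2), |t| / 2 ≤ |r| := by
    intro r hr
    have h1 := Metric.mem_ball'.1 hr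
    rw [Real.dist_eq] at h1
    have h2 := abs_sub_abs_le_abs_sub t r
    linarith
  have hK : ∀ r ∈ Metric.ball t (|t| / 2), ∀ y : Space n,
      ‖gaussKernel ((c * r : ℝ) * Complex.I) y‖ ≤ P := by
    intro r hr y
    refine (norm_gaussKernel_le (by simp) _).trans ?_
    rw [norm_gaussPrefactor]
    have := hball r hr
    refine Real.rpow_le_rpow (by positivity) ?_ (by positivity)
    have hpi := Real.pi_pos
    gcongr
  set A : ℝ := |c| * ((2 * (‖x‖ + 1) ^ 2 + 2) / (4 * (|c| * (|t| / 2)) ^ 2) +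
    n / (2 * (|c| * (|t| / 2)))) * P with hA
  have hA0 : 0 ≤ A := by positivity
  refine hasDerivAt_integral_of_le_weight hfm hf (r := |t| / 2) (C := P + A)
    (k := fun t y => gaussKernel ((c * t : ℝ) * Complex.I) (x - y))
    (k' := fun t y => (c * Complex.I) * ((‖x - y‖ : ℂ) ^ 2 / (4 * ((c * t : ℝ) * Complex.I) ^ 2) -
        n / (2 * ((c * t : ℝ) * Complex.I))) * gaussKernel ((c * t : ℝ) * Complex.I) (x - y))
    (by positivity)
    (fun t => (continuous_gaussKernel_right _).comp (by fun_prop))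
    (Continuous.mul (by fun_prop) ((continuous_gaussKernel_right _).comp (by fun_prop)))
    (fun y => ?_) (fun r hr y => ?_) (fun r hr y => ?_)
  · refine (hK t (Metric.mem_ball_self (by positivity)) _).trans ?_
    nlinarith [mul_nonneg (add_nonneg hP0 hA0) (sq_nonneg ‖y‖)]
  · have hr' := hball r hr
    have hzn : ‖((c * r : ℝ) : ℂ) * Complex.I‖ = |c| * |r| := by
      rw [norm_mul, Complex.norm_I, mul_one, Complex.norm_real, Real.norm_eq_abs, abs_mul]
    have h1 := norm_sub_sq_le_weight x y
    have h2 : ‖(‖x - y‖ : ℂ) ^ 2 / (4 * ((c * r : ℝ) * Complex.I) ^ 2) -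
        n / (2 * ((c * r : ℝ) * Complex.I))‖ ≤
        (2 * (‖x‖ + 1) ^ 2 + 2) * (1 + ‖y‖ ^ 2) / (4 * (|c| * (|t| / 2)) ^ 2) +
          n * (1 + ‖y‖ ^ 2) / (2 * (|c| * (|t| / 2))) := by
      refine (norm_sub_le _ _).trans ?_
      rw [norm_div, norm_div, norm_mul, norm_mul 2, norm_pow, norm_pow, hzn, Complex.norm_real,
        Complex.norm_natCast, norm_norm, Complex.norm_ofNat, Complex.norm_ofNat]
      have hn : (n : ℝ) ≤ n * (1 + ‖y‖ ^ 2) :=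
        le_mul_of_one_le_right (Nat.cast_nonneg n) (by nlinarith [sq_nonneg ‖y‖])
      gcongr
    rw [norm_mul, norm_mul, norm_mul, Complex.norm_I, mul_one, Complex.norm_real,
      Real.norm_eq_abs]
    calc _ ≤ |c| * ((2 * (‖x‖ + 1) ^ 2 + 2) * (1 + ‖y‖ ^ 2) / (4 * (|c| * (|t| / 2)) ^ 2) +
          n * (1 + ‖y‖ ^ 2) / (2 * (|c| * (|t| / 2)))) * P := by
          gcongr
          exact hK r hr _
      _ = A * (1 + ‖y‖ ^ 2) := by rw [hA]; ring
      _ ≤ _ := by gcongr; linarith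
  · have hr0 : r ≠ 0 := by
      have := hball r hr
      intro h
      rw [h, abs_zero] at this
      have : 0 < |t| := by positivity
      linarith
    exact hasDerivAt_gaussKernel_imag hc hr0 _

/-- The second derivatives along an orthonormal basis add up by Parseval to the complex time
derivative of the kernel. -/
theorem laplacian_integral_gaussKernel (hfm : AEStronglyMeasurable f volume)
    (hf : Integrable fun y => ((1 + ‖y‖ ^ 2 : ℝ) : ℂ) * f y) {s : ℝ} (hs : s ≠ 0) (x : Space n) :
    Laplacian.laplacian (fun x : Space n => ∫ y, gaussKernel (s * Complex.I) (x - y) * f y) x =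
      ∫ y, (((‖x - y‖ : ℂ) ^ 2 / (4 * (s * Complex.I) ^ 2) - n / (2 * (s * Complex.I))) *
        gaussKernel (s * Complex.I) (x - y)) * f y := by
  rw [laplacian_eq_sum_of_hasLineDerivAt (contDiff_integral_gaussKernel hfm hf hs).contDiffAt
    (fun i => Eventually.of_forall fun y =>
      hasLineDerivAt_integral_gaussKernel hfm hf y _ (norm_basisFun i))
    (fun i => hasLineDerivAt_integral_gaussKernel_two hfm hf x _ (norm_basisFun i)),
    ← integral_finsetSum]
  · refine integral_congr_ae (Eventually.of_forall fun y => ?_)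
    simp only
    rw [← Finset.sum_mul, ← Finset.sum_mul, Finset.sum_sub_distrib, ← Finset.sum_div,
      sum_inner_basisFun_sq]
    simp only [Finset.sum_const, Finset.card_univ, Fintype.card_fin, nsmul_eq_mul]
    ring
  · intro i _
    set z : ℂ := s * Complex.I with hz
    set P := ‖(1 / (4 * Real.pi * z)) ^ ((n : ℂ) / 2)‖ with hP
    have hre : 0 ≤ z.re := by simp [hz]
    have hP0 : 0 ≤ P := norm_nonneg _
    refine integrable_mul_of_le_weight hfm hf
      (C := ((2 * (‖x‖ + 1) ^ 2 + 2) / ‖4 * z ^ 2‖ + 1 / ‖2 * z‖) * P)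
      (Continuous.mul (by fun_prop) ((continuous_gaussKernel_right z).comp (by fun_prop)))
      fun y => ?_
    set e := EuclideanSpace.basisFun (Fin n) ℝ i with hei
    have h1 := sq_inner_le_weight (x := x) (y := y) (e := e) (norm_basisFun i) (t := 0) (by simp)
    rw [zero_smul, add_zero] at h1
    have h2 : ‖((inner ℝ (x - y) e : ℝ) : ℂ) ^ 2 / (4 * z ^ 2) -
        1 / (2 * z)‖ ≤ (2 * (‖x‖ + 1) ^ 2 + 2) * (1 + ‖y‖ ^ 2) / ‖4 * z ^ 2‖ +
          1 * (1 + ‖y‖ ^ 2) / ‖2 * z‖ := by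
      refine (norm_sub_le _ _).trans ?_
      rw [norm_div, norm_div, norm_pow, Complex.norm_real, Real.norm_eq_abs, norm_one]
      gcongr
      nlinarith [sq_nonneg ‖y‖]
    rw [norm_mul]
    calc _ ≤ ((2 * (‖x‖ + 1) ^ 2 + 2) * (1 + ‖y‖ ^ 2) / ‖4 * z ^ 2‖ +
          1 * (1 + ‖y‖ ^ 2) / ‖2 * z‖) * P := by
          gcongr
          exact norm_gaussKernel_le hre _
      _ = _ := by ring

/-- The Poisson integral converges absolutely and is a classical solution of the free
Schrödinger equation. -/
theorem poissonIntegral_classical {ħ m : ℝ} (hħ : 0 < ħ) (hm : 0 < m)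
    (hfm : AEStronglyMeasurable f volume)
    (hf : Integrable fun y => ((1 + ‖y‖ ^ 2 : ℝ) : ℂ) * f y) {t : ℝ} (ht : t ≠ 0) (x : Space n) :
    Integrable (fun y => freeKernel ħ m x y t * f y) ∧
      ContDiffAt ℝ 2 (fun z => poissonIntegral ħ m f z t) x ∧
      DifferentiableAt ℝ (fun s => poissonIntegral ħ m f x s) t ∧
      ((ħ ^ 2 / (2 * m) : ℝ) : ℂ) * Laplacian.laplacian (fun z => poissonIntegral ħ m f z t) x
        + Complex.I * ħ * deriv (fun s => poissonIntegral ħ m f x s) t = 0 := by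
  have hc : ħ / (2 * m) ≠ 0 := by positivity
  have hs : ħ / (2 * m) * t ≠ 0 := mul_ne_zero hc ht
  simp only [poissonIntegral, freeKernel_eq_gaussKernel hħ hm]
  have hd := hasDerivAt_integral_gaussKernel_time hfm hf hc ht x
  refine ⟨integrable_gaussKernel_mul hfm hf x, (contDiff_integral_gaussKernel hfm hf hs).contDiffAt,
    hd.differentiableAt, ?_⟩
  rw [laplacian_integral_gaussKernel hfm hf hs, hd.deriv]
  simp_rw [mul_assoc ((ħ / (2 * m) : ℝ) * Complex.I : ℂ), integral_const_mul]
  have hm' : (m : ℂ) ≠ 0 := by exact_mod_cast hm.ne'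
  -- The Laplacian is `J` and the time derivative is `(iħ/(2m)) J`; the claim is ħ²/(2m) + iħ ·
  -- iħ/(2m) = 0.
  generalize ∫ y, (((‖x - y‖ : ℂ) ^ 2 / (4 * (((ħ / (2 * m) * t : ℝ) : ℂ) * Complex.I) ^ 2) -
    n / (2 * (((ħ / (2 * m) * t : ℝ) : ℂ) * Complex.I))) *
    (gaussKernel (((ħ / (2 * m) * t : ℝ) : ℂ) * Complex.I) (x - y) * f y)) = J
  push_cast
  field_simp
  rw [Complex.I_sq]; ring

end PoissonTime

/-! ### The Duhamel term as an iterated Lebesgue integral. -/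

section Iterated

variable {n : ℕ}

theorem integrableOn_lpTwo {S : Set (Space n)} (hS : volume S < ⊤) (g : LTwo n) :
    IntegrableOn g S := by
  have : IsFiniteMeasure (volume.restrict S) := ⟨by simpa using hS⟩
  exact ((Lp.memLp g).restrict S).integrable (by norm_num)

/-- From |g| ≤ 1 + |g|². Only a bound in terms of the L² norm matters, to get uniformity in the time
variable. -/
theorem setIntegral_norm_lpTwo_le {S : Set (Space n)} (hS : volume S < ⊤) (g : LTwo n) :
    ∫ x in S, ‖g x‖ ≤ volume.real S + ‖g‖ ^ 2 := by
  have hsq := integrable_norm_sq_of_memLp (Lp.memLp g)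
  calc ∫ x in S, ‖g x‖ ≤ ∫ x in S, (1 + ‖g x‖ ^ 2) := by
        refine integral_mono (integrableOn_lpTwo hS g).norm
          ((integrableOn_const hS.ne).add hsq.integrableOn) fun x => ?_
        nlinarith [sq_nonneg (‖g x‖ - 1)]
    _ = volume.real S + ∫ x in S, ‖g x‖ ^ 2 := by
        rw [integral_add (μ := volume.restrict S) (f := fun _ => (1 : ℝ))
          (integrableOn_const hS.ne) hsq.integrableOn]
        simp
    _ ≤ volume.real S + ‖g‖ ^ 2 := by
        rw [lpTwo_norm_sq]
        have h0 : (0 : Space n → ℝ) ≤ᵐ[volume] fun x => ‖g x‖ ^ 2 :=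
          Eventually.of_forall fun x => by positivity
        linarith [setIntegral_le_integral (s := S) hsq h0]

/-- A Bochner integral in `L²` is almost everywhere the pointwise integral. -/
theorem ae_integral_eq_of_lpTwo {μ : Measure ℝ} [IsFiniteMeasure μ] {X : ℝ → LTwo n}
    (hX : AEStronglyMeasurable X μ) {C : ℝ} (hC : ∀ᵐ τ ∂μ, ‖X τ‖ ≤ C) {G : Space n × ℝ → ℂ}
    (hG : AEStronglyMeasurable G ((volume : Measure (Space n)).prod μ))
    (hGX : ∀ᵐ τ ∂μ, (fun x => G (x, τ)) =ᵐ[volume] X τ) :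
    ∀ᵐ x, Integrable (fun τ => G (x, τ)) μ ∧ ∫ τ, G (x, τ) ∂μ = (∫ τ, X τ ∂μ) x := by
  have hXi : Integrable X μ := Integrable.of_bound hX C hC
  -- The values of `X` need not be integrable over the whole space, so Fubini is used over sets of
  -- finite measure.
  have hint : ∀ S : Set (Space n), volume S < ⊤ →
      Integrable G ((volume.restrict S).prod μ) := by
    intro S hS
    have hGS : AEStronglyMeasurable G ((volume.restrict S).prod μ) :=
      hG.mono_ac (Measure.restrict_le_self.absolutelyContinuous.prod
        Measure.AbsolutelyContinuous.rfl)
    rw [integrable_prod_iff' hGS]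
    constructor
    · filter_upwards [hGX] with τ hτ
      exact (integrableOn_lpTwo hS (X τ)).congr (ae_restrict_of_ae hτ.symm)
    · refine Integrable.of_bound hGS.norm.prod_swap.integral_prod_right' (volume.real S + C ^ 2) ?_
      filter_upwards [hGX, hC] with τ hτ hCτ
      rw [Real.norm_of_nonneg (integral_nonneg fun _ => norm_nonneg _)]
      have h1 : ∫ x in S, ‖G (x, τ)‖ = ∫ x in S, ‖X τ x‖ :=
        integral_congr_ae (ae_restrict_of_ae (hτ.mono fun x hx => by simp only [hx]))
      refine h1.le.trans ?_
      refine (setIntegral_norm_lpTwo_le hS (X τ)).trans ?_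
      gcongr
  have hae : ∀ᵐ x, Integrable (fun τ => G (x, τ)) μ := by
    have h : ∀ k : ℕ, ∀ᵐ x, x ∈ Metric.ball (0 : Space n) k → Integrable (fun τ => G (x, τ)) μ :=
      fun k => (ae_restrict_iff' measurableSet_ball).1
        (hint _ measure_ball_lt_top).prod_right_ae
    filter_upwards [ae_all_iff.2 h] with x hx
    obtain ⟨k, hk⟩ := exists_nat_gt ‖x‖
    exact hx k (by simpa using hk)
  have heq : (fun x => ∫ τ, G (x, τ) ∂μ) =ᵐ[volume] (∫ τ, X τ ∂μ : LTwo n) := by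
    refine ae_eq_of_forall_setIntegral_eq_of_sigmaFinite
      (fun S _ hS => (hint S hS).integral_prod_left) (fun S _ hS => integrableOn_lpTwo hS _)
      fun S hSm hS => ?_
    calc ∫ x in S, ∫ τ, G (x, τ) ∂μ = ∫ τ, (∫ x in S, G (x, τ)) ∂μ :=
          integral_integral_swap (μ := volume.restrict S) (ν := μ) (f := fun x τ => G (x, τ))
            (hint S hS)
      -- Integration over `S` is a bounded functional on L² and so commutes with the Bochner
      -- integral.
      _ = ∫ τ, inner ℂ (indicatorConstLp 2 hSm hS.ne (1 : ℂ)) (X τ) ∂μ := by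
          refine integral_congr_ae (hGX.mono fun τ hτ => ?_)
          simp only
          rw [L2.inner_indicatorConstLp_one]
          exact integral_congr_ae (ae_restrict_of_ae hτ)
      _ = ∫ x in S, (∫ τ, X τ ∂μ : LTwo n) x := by
          rw [integral_inner hXi, L2.inner_indicatorConstLp_one]
  filter_upwards [hae, heq] with x h1 h2 using ⟨h1, h2⟩

theorem memLp_indicator_ball_gaussKernel (R s : ℝ) (x : Space n) :
    MemLp ((Metric.ball (0 : Space n) R).indicator
      fun y => conj (gaussKernel (s * Complex.I) (x - y))) 2 := by
  refine (memLp_indicator_const 2 measurableSet_ball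
    ‖(1 / (4 * Real.pi * ((s : ℂ) * Complex.I))) ^ ((n : ℂ) / 2)‖
    (Or.inr (measure_ball_lt_top (x := (0 : Space n)) (r := R)).ne)).of_le ?_ ?_
  · refine AEStronglyMeasurable.indicator ?_ measurableSet_ball
    exact (Complex.continuous_conj.comp
      ((continuous_gaussKernel_right _).comp (by fun_prop))).aestronglyMeasurable
  · refine Eventually.of_forall fun y => ?_
    classical
    simp only [indicator_apply]
    split_ifs
    · rw [RCLike.norm_conj, norm_norm]
      exact norm_gaussKernel_le (by simp) _
    · simp

/-- The conjugated kernel, cut off to a ball, as an `L²` function of the source point. -/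
noncomputable def cutKernel (R s : ℝ) (x : Space n) : LTwo n :=
  (memLp_indicator_ball_gaussKernel R s x).toLp _

theorem cutKernel_coe (R s : ℝ) (x : Space n) : cutKernel R s x =ᵐ[volume]
    (Metric.ball (0 : Space n) R).indicator fun y => conj (gaussKernel (s * Complex.I) (x - y)) :=
  MemLp.coeFn_toLp _

/-- The time 0 is excluded because the prefactor is singular there. Cutting off to a ball makes the
bounded kernel an L² function of `y`. -/
theorem continuousOn_cutKernel (R : ℝ) :
    ContinuousOn (fun p : Space n × ℝ => cutKernel R p.2 p.1) (univ ×ˢ {s | s ≠ 0}) := by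
  rintro ⟨x, s⟩ ⟨-, hs⟩
  refine ContinuousAt.continuousWithinAt ?_
  have hsl := imag_mem_slitPlane hs
  set P := ‖(1 / (4 * Real.pi * ((s : ℂ) * Complex.I))) ^ ((n : ℂ) / 2)‖ with hP
  refine tendsto_lpTwo_of_dominated
    (F := fun p => (Metric.ball (0 : Space n) R).indicator
      fun y => conj (gaussKernel (p.2 * Complex.I) (p.1 - y)))
    (b := (Metric.ball (0 : Space n) R).indicator fun _ => P + 1)
    (memLp_indicator_const 2 measurableSet_ball _ (Or.inr measure_ball_lt_top.ne))
    (Eventually.of_forall fun p => cutKernel_coe R p.2 p.1) (cutKernel_coe R s x) ?_ ?_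
  · have hc : ContinuousAt (fun p : Space n × ℝ =>
        ‖(1 / (4 * Real.pi * ((p.2 : ℂ) * Complex.I))) ^ ((n : ℂ) / 2)‖) (x, s) :=
      (ContinuousAt.comp (f := fun p : Space n × ℝ => (p.2 : ℂ) * Complex.I) (x := (x, s))
        (g := fun w : ℂ => (1 / (4 * Real.pi * w)) ^ ((n : ℂ) / 2))
        (continuousAt_gaussPrefactor n hsl) (by fun_prop)).norm
    filter_upwards [hc.tendsto.eventually (gt_mem_nhds (lt_add_one P))] with p hp
    refine Eventually.of_forall fun y => ?_
    classical
    simp only [indicator_apply]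
    split_ifs
    · rw [RCLike.norm_conj]
      exact (norm_gaussKernel_le (by simp) _).trans hp.le
    · simp
  · refine Eventually.of_forall fun y => ?_
    classical
    simp only [indicator_apply]
    split_ifs
    · have hc : ContinuousAt (fun p : Space n × ℝ => gaussKernel (p.2 * Complex.I) (p.1 - y))
          (x, s) :=
        ContinuousAt.comp (g := fun q : ℂ × Space n => gaussKernel q.1 q.2)
          (f := fun p : Space n × ℝ => ((p.2 : ℂ) * Complex.I, p.1 - y)) (x := (x, s))
          (continuousAt_gaussKernel hsl _) (by fun_prop)
      exact (Complex.continuous_conj.continuousAt.comp hc).tendsto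
    · exact tendsto_const_nhds

/-- Each `X τ` is only a class of functions, with no jointly measurable representative given in
advance. The integral over a ball is the inner product of `cutKernel`, continuous in (x, τ), with
the measurable `X`; the balls then exhaust the space. -/
theorem aestronglyMeasurable_integral_gaussKernel {c t : ℝ} (hc : c ≠ 0) {X : ℝ → LTwo n}
    (hX : AEStronglyMeasurable X (volume.restrict (Ioo 0 t)))
    (hi : ∀ᵐ τ ∂(volume.restrict (Ioo 0 t)), Integrable (X τ)) :
    AEStronglyMeasurable
      (fun p : Space n × ℝ => ∫ y, gaussKernel ((c * (t - p.2) : ℝ) * Complex.I) (p.1 - y) * X p.2 y)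
      ((volume : Measure (Space n)).prod (volume.restrict (Ioo 0 t))) := by
  refine aestronglyMeasurable_of_tendsto_ae atTop
    (f := fun k : ℕ => fun p : Space n × ℝ => inner ℂ (cutKernel k (c * (t - p.2)) p.1) (X p.2))
    (fun k => ?_) ?_
  · refine AEStronglyMeasurable.inner ?_ hX.comp_snd
    have hco : ContinuousOn (fun p : Space n × ℝ => cutKernel (n := n) k (c * (t - p.2)) p.1)
        (univ ×ˢ Ioo 0 t) := by
      refine (continuousOn_cutKernel (n := n) k).comp
        (f := fun p : Space n × ℝ => (p.1, c * (t - p.2))) (by fun_prop) ?_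
      rintro ⟨x, τ⟩ ⟨-, hτ⟩
      exact ⟨mem_univ _, mul_ne_zero hc (sub_ne_zero.2 hτ.2.ne')⟩
    have := hco.aestronglyMeasurable (μ := (volume : Measure (Space n)).prod volume)
      (MeasurableSet.univ.prod measurableSet_Ioo)
    rwa [← Measure.prod_restrict, Measure.restrict_univ] at this
  · filter_upwards [Measure.quasiMeasurePreserving_snd.ae hi] with p hp
    have hrep : ∀ k : ℕ, inner ℂ (cutKernel k (c * (t - p.2)) p.1) (X p.2) =
        ∫ y, (Metric.ball (0 : Space n) k).indicator
          (fun y => gaussKernel ((c * (t - p.2) : ℝ) * Complex.I) (p.1 - y) * X p.2 y) y := by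
      intro k
      rw [L2.inner_def]
      refine integral_congr_ae ?_
      filter_upwards [cutKernel_coe k (c * (t - p.2)) p.1] with y hy
      rw [hy, RCLike.inner_apply]
      classical
      simp only [indicator_apply]
      split_ifs
      · rw [Complex.conj_conj, mul_comm]
      · simp
    simp_rw [hrep]
    have hcont : Continuous fun y : Space n =>
        gaussKernel ((c * (t - p.2) : ℝ) * Complex.I) (p.1 - y) :=
      (continuous_gaussKernel_right _).comp (by fun_prop)
    refine tendsto_integral_of_dominated_convergence
      (fun y => ‖(1 / (4 * Real.pi * (((c * (t - p.2) : ℝ) : ℂ) * Complex.I))) ^ ((n : ℂ) / 2)‖ *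
        ‖X p.2 y‖) (fun k => ?_) (hp.norm.const_mul _) (fun k => ?_) ?_
    · exact (hcont.aestronglyMeasurable.mul (Lp.aestronglyMeasurable (X p.2))).indicator
        measurableSet_ball
    · refine Eventually.of_forall fun y => ?_
      refine (norm_indicator_le_norm_self _ _).trans ?_
      rw [norm_mul]
      gcongr
      exact norm_gaussKernel_le (by simp) _
    · refine Eventually.of_forall fun y => tendsto_const_nhds.congr' ?_
      obtain ⟨k, hk⟩ := exists_nat_gt ‖y‖
      filter_upwards [eventually_ge_atTop k] with l hl
      rw [indicator_of_mem]
      rw [mem_ball_zero_iff]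
      exact hk.trans_le (by exact_mod_cast hl)

variable {ħ m T M : ℝ} {B : Type*} [NormedAddCommGroup B] [NormedSpace ℂ B]
  {j : B →L[ℂ] LTwo n} {U : ℝ → B →L[ℂ] B} {F : ℝ → B}

/-- The source term as an iterated Lebesgue integral. -/
theorem IsFreePropagator.sourceTerm_ae_eq [CompleteSpace B] (hU : IsFreePropagator ħ m j U)
    (hħ : 0 < ħ) (hm : 0 < m) (hF : AEStronglyMeasurable F (volume.restrict (Ioo 0 T)))
    (hFM : ∀ᵐ t ∂(volume.restrict (Ioo 0 T)), ‖F t‖ ≤ M)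
    (hi : ∀ᵐ τ ∂(volume.restrict (Ioo 0 T)), Integrable (j (F τ)) volume)
    {t : ℝ} (ht : t ∈ Ioo 0 T) :
    ∀ᵐ x, IntervalIntegrable (fun τ => ∫ y, freeKernel ħ m x y (t - τ) * j (F τ) y) volume 0 t ∧
      j (sourceTerm ħ U F t) x =
        -(Complex.I / ħ) * ∫ τ in (0 : ℝ)..t, ∫ y, freeKernel ħ m x y (t - τ) * j (F τ) y := by
  have htI : t ∈ Icc 0 T := ⟨ht.1.le, ht.2.le⟩
  have hc : ħ / (2 * m) ≠ 0 := by positivity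
  obtain ⟨C, hC⟩ := hU.exists_bound_Icc T
  have hle : volume.restrict (Ioo 0 t) ≤ volume.restrict (Ioo 0 T) :=
    Measure.restrict_mono (Ioo_subset_Ioo_right ht.2.le) le_rfl
  have hFt := hF.mono_measure hle
  have hit := ae_mono hle hi
  have hUm := hU.aestronglyMeasurable_apply hFt t
  have hUb := ae_restrict_Ioo_of_le ht.2.le (ae_norm_apply_le hC hFM htI)
  have hXm : AEStronglyMeasurable (fun τ => j (U (t - τ) (F τ))) (volume.restrict (Ioo 0 t)) :=
    j.continuous.comp_aestronglyMeasurable hUm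
  have hXb : ∀ᵐ τ ∂(volume.restrict (Ioo 0 t)), ‖j (U (t - τ) (F τ))‖ ≤ ‖j‖ * (C * M) := by
    filter_upwards [hUb] with τ hτ using j.le_opNorm_of_le hτ
  have hGm := aestronglyMeasurable_integral_gaussKernel hc
    (j.continuous.comp_aestronglyMeasurable hFt) hit
  have hGX : ∀ᵐ τ ∂(volume.restrict (Ioo 0 t)),
      (fun x => ∫ y, gaussKernel ((ħ / (2 * m) * (t - τ) : ℝ) * Complex.I) (x - y) *
        (j (F τ)) y) =ᵐ[volume] j (U (t - τ) (F τ)) := by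
    filter_upwards [hit, ae_restrict_mem measurableSet_Ioo] with τ h1 h2
    rw [hU.apply_eq hħ hm]
    exact (freeGroup_ae_eq_integral (mul_ne_zero hc (sub_ne_zero.2 h2.2.ne')) _ h1).symm
  have key := ae_integral_eq_of_lpTwo hXm hXb hGm hGX
  have hj : j (sourceTerm ħ U F t) = (-(Complex.I / ħ)) •
      ∫ τ in Ioo 0 t, j (U (t - τ) (F τ)) := by
    rw [sourceTerm, map_smul, intervalIntegral.integral_of_le ht.1.le, integral_Ioc_eq_integral_Ioo,
      ContinuousLinearMap.integral_comp_comm j (Integrable.of_bound hUm _ hUb)]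
  filter_upwards [key, Lp.coeFn_smul (-(Complex.I / (ħ : ℂ)))
    (∫ τ in Ioo 0 t, j (U (t - τ) (F τ)))] with x h1 h2
  rw [intervalIntegrable_iff_integrableOn_Ioo_of_le ht.1.le, hj, h2,
    intervalIntegral.integral_of_le ht.1.le, integral_Ioc_eq_integral_Ioo]
  simp only [freeKernel_eq_gaussKernel hħ hm]
  refine ⟨h1.1, ?_⟩
  rw [Pi.smul_apply, smul_eq_mul, ← h1.2]

end Iterated

/-! ### Test functions as curves in L². -/

section Slices

variable {n : ℕ}

open Classical in
/-- The slice `Ψ(·, t)`, as an element of `L²`. -/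
noncomputable def slice (Ψ : Space n × ℝ → ℂ) (t : ℝ) : LTwo n :=
  if h : MemLp (fun x => Ψ (x, t)) 2 (volume : Measure (Space n)) then h.toLp _ else 0

/-- The projection of the support to space is compact, so one L² function dominates the slices at
all times. -/
theorem exists_slice_bound {Ψ : Space n × ℝ → ℂ} (hΨ : Continuous Ψ) (hc : HasCompactSupport Ψ) :
    ∃ C : ℝ, 0 ≤ C ∧ (∀ x t, ‖Ψ (x, t)‖ ≤ (Prod.fst '' tsupport Ψ).indicator (fun _ => C) x) ∧
      MemLp ((Prod.fst '' tsupport Ψ).indicator fun _ => C) 2 (volume : Measure (Space n)) := by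
  obtain ⟨C, hC⟩ := hΨ.bounded_above_of_compact_support hc
  have hK : IsCompact (Prod.fst '' tsupport Ψ) := hc.isCompact.image continuous_fst
  refine ⟨C, (norm_nonneg _).trans (hC (0, 0)), fun x t => ?_,
    memLp_indicator_const 2 hK.measurableSet _ (Or.inr hK.measure_lt_top.ne)⟩
  by_cases hx : x ∈ Prod.fst '' tsupport Ψ
  · rw [indicator_of_mem hx]; exact hC _
  · rw [indicator_of_notMem hx, image_eq_zero_of_notMem_tsupport (f := Ψ) fun h => hx ⟨_, h, rfl⟩,
      norm_zero]

theorem memLp_slice {Ψ : Space n × ℝ → ℂ} (hΨ : Continuous Ψ) (hc : HasCompactSupport Ψ) (t : ℝ) :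
    MemLp (fun x => Ψ (x, t)) 2 (volume : Measure (Space n)) := by
  obtain ⟨C, hC0, hC, hm⟩ := exists_slice_bound hΨ hc
  refine hm.of_le (by fun_prop : Continuous fun x => Ψ (x, t)).aestronglyMeasurable
    (Eventually.of_forall fun x => (hC x t).trans (le_abs_self _))

theorem slice_coe {Ψ : Space n × ℝ → ℂ} (hΨ : Continuous Ψ) (hc : HasCompactSupport Ψ) (t : ℝ) :
    slice Ψ t =ᵐ[volume] fun x => Ψ (x, t) := by
  rw [slice, dif_pos (memLp_slice hΨ hc t)]
  exact MemLp.coeFn_toLp _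

theorem continuous_slice {Ψ : Space n × ℝ → ℂ} (hΨ : Continuous Ψ) (hc : HasCompactSupport Ψ) :
    Continuous (slice Ψ) := by
  obtain ⟨C, hC0, hC, hm⟩ := exists_slice_bound hΨ hc
  rw [continuous_iff_continuousAt]
  intro t
  refine tendsto_lpTwo_of_dominated (F := fun s x => Ψ (x, s)) hm
    (Eventually.of_forall fun s => slice_coe hΨ hc s) (slice_coe hΨ hc t)
    (Eventually.of_forall fun s => Eventually.of_forall fun x => hC x s)
    (Eventually.of_forall fun x => ?_)
  exact (by fun_prop : Continuous fun s => Ψ (x, s)).tendsto t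

theorem slice_eq_zero {Ψ : Space n × ℝ → ℂ} {t : ℝ} (h : ∀ x, Ψ (x, t) = 0) : slice Ψ t = 0 := by
  have h0 : (fun x => Ψ (x, t)) = 0 := funext h
  rw [slice, dif_pos (by rw [h0]; exact MemLp.zero')]
  ext1
  refine (MemLp.coeFn_toLp _).trans ?_
  rw [h0]
  exact (Lp.coeFn_zero _ _ _).symm

/-- Differentiability in time of a smooth function of compact support, as a curve in `L²`. -/
theorem hasDerivAt_slice {Ψ Ψ' : Space n × ℝ → ℂ} (hΨ : Continuous Ψ) (hc : HasCompactSupport Ψ)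
    (hΨ' : Continuous Ψ') (hc' : HasCompactSupport Ψ')
    (hd : ∀ x t, HasDerivAt (fun s => Ψ (x, s)) (Ψ' (x, t)) t) (t : ℝ) :
    HasDerivAt (slice Ψ) (slice Ψ' t) t := by
  obtain ⟨C, hC0, hC, hm⟩ := exists_slice_bound hΨ' hc'
  rw [hasDerivAt_iff_tendsto_slope]
  refine tendsto_lpTwo_of_dominated (F := fun s x => slope (fun r => Ψ (x, r)) t s) hm
    (Eventually.of_forall fun s => ?_) (slice_coe hΨ' hc' t)
    (eventually_mem_nhdsWithin.mono fun s hs => Eventually.of_forall fun x => ?_)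
    (Eventually.of_forall fun x => ?_)
  · rw [slope_def_module]
    filter_upwards [Lp.coeFn_smul (s - t)⁻¹ (slice Ψ s - slice Ψ t),
      Lp.coeFn_sub (slice Ψ s) (slice Ψ t), slice_coe hΨ hc s, slice_coe hΨ hc t]
      with x h1 h2 h3 h4
    rw [h1, Pi.smul_apply, h2, Pi.sub_apply, h3, h4, slope_def_module]
  · have hst : s - t ≠ 0 := sub_ne_zero.2 hs
    -- By the mean value inequality the difference quotients obey the same bound as the derivative.
    have := Convex.norm_image_sub_le_of_norm_hasDerivWithin_le (s := univ)
      (f := fun r => Ψ (x, r)) (fun r _ => (hd x r).hasDerivWithinAt) (fun r _ => hC x r)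
      convex_univ (mem_univ t) (mem_univ s)
    rw [slope_def_module, norm_smul, norm_inv, inv_mul_le_iff₀ (norm_pos_iff.2 hst), mul_comm]
    exact this
  · exact hasDerivAt_iff_tendsto_slope.1 (hd x t)

end Slices

/-! ### The generator of the free group and the product rule. -/

section Generator

variable {n : ℕ}

theorem hasDerivAt_gaussSymbol_imag (s : ℝ) (ξ : Space n) :
    HasDerivAt (fun r : ℝ => gaussSymbol (r * Complex.I) ξ)
      (gaussSymbol (s * Complex.I) ξ * (-(4 * Real.pi ^ 2 * Complex.I) * (‖ξ‖ : ℂ) ^ 2)) s := by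
  unfold gaussSymbol
  have h0 : HasDerivAt (fun r : ℝ => (r : ℂ)) 1 s := Complex.ofRealCLM.hasDerivAt
  have h1 : HasDerivAt (fun r : ℝ => -(4 * (Real.pi : ℂ) ^ 2 * (r * Complex.I)) * (‖ξ‖ : ℂ) ^ 2)
      (-(4 * Real.pi ^ 2 * Complex.I) * (‖ξ‖ : ℂ) ^ 2) s := by
    refine ((((h0.mul_const Complex.I).const_mul (4 * (Real.pi : ℂ) ^ 2)).fun_neg).mul_const
      ((‖ξ‖ : ℂ) ^ 2)).congr_deriv ?_
    ring
  exact h1.cexp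

/-- The generator of the free group is `i Δ`. -/
theorem hasDerivAt_freeGroup {g k : LTwo n}
    (h : (𝓕 k : LTwo n) =ᵐ[volume] fun ξ => -(4 * Real.pi ^ 2) * (‖ξ‖ : ℂ) ^ 2 * (𝓕 g : LTwo n) ξ)
    (s : ℝ) :
    HasDerivAt (fun r => freeGroup n r g) (freeGroup n s (Complex.I • k)) s := by
  have key : HasDerivAt (fun r => freeMul n r (𝓕 g)) (freeMul n s (𝓕 (Complex.I • k))) s := by
    rw [hasDerivAt_iff_tendsto_slope]
    refine tendsto_lpTwo_of_dominated
      (F := fun r ξ => slope (fun r : ℝ => gaussSymbol (r * Complex.I) ξ) s r * (𝓕 g : LTwo n) ξ)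
      (f := fun ξ => gaussSymbol (s * Complex.I) ξ * (-(4 * Real.pi ^ 2 * Complex.I) *
        (‖ξ‖ : ℂ) ^ 2) * (𝓕 g : LTwo n) ξ)
      (b := fun ξ => ‖(𝓕 k : LTwo n) ξ‖) (Lp.memLp _).norm
      (Eventually.of_forall fun r => ?_) ?_
      (eventually_mem_nhdsWithin.mono fun r hr => ?_)
      (Eventually.of_forall fun ξ => ?_)
    · rw [slope_def_module]
      filter_upwards [Lp.coeFn_smul (r - s)⁻¹ (freeMul n r (𝓕 g) - freeMul n s (𝓕 g)),
        Lp.coeFn_sub (freeMul n r (𝓕 g)) (freeMul n s (𝓕 g)), freeMul_coe r (𝓕 g),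
        freeMul_coe s (𝓕 g)] with x h1 h2 h3 h4
      rw [h1, Pi.smul_apply, h2, Pi.sub_apply, h3, h4, slope_def_module, ← sub_mul, smul_mul_assoc]
    · have e : (𝓕 (Complex.I • k) : LTwo n) = Complex.I • (𝓕 k : LTwo n) :=
        FourierTransform.fourier_smul _ _
      rw [e]
      filter_upwards [freeMul_coe s (Complex.I • (𝓕 k : LTwo n)),
        Lp.coeFn_smul Complex.I (𝓕 k : LTwo n), h] with ξ h1 h2 h3
      rw [h1, h2, Pi.smul_apply, h3, smul_eq_mul]
      ring
    · filter_upwards [h] with ξ hξ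
      have hst : r - s ≠ 0 := sub_ne_zero.2 hr
      -- The symbol has time derivative of modulus 4π²|ξ|², so the difference quotients applied to
      -- `𝓕 g` are dominated by `‖𝓕 k‖`, which is in L².
      have h1 := Convex.norm_image_sub_le_of_norm_hasDerivWithin_le (s := univ)
        (f := fun r : ℝ => gaussSymbol (r * Complex.I) ξ) (C := 4 * Real.pi ^ 2 * ‖ξ‖ ^ 2)
        (fun r _ => (hasDerivAt_gaussSymbol_imag r ξ).hasDerivWithinAt) (fun r _ => by
          rw [norm_mul, norm_gaussSymbol_imag]
          simp [abs_of_nonneg Real.pi_nonneg])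
        convex_univ (mem_univ s) (mem_univ r)
      rw [norm_mul, hξ, norm_mul]
      gcongr
      rw [slope_def_module, norm_smul, norm_inv, inv_mul_le_iff₀ (norm_pos_iff.2 hst), mul_comm ‖r - s‖]
      refine h1.trans (le_of_eq ?_)
      simp [abs_of_nonneg Real.pi_nonneg]
    · exact (hasDerivAt_iff_tendsto_slope.1 (hasDerivAt_gaussSymbol_imag s ξ)).mul_const _
  exact ((Lp.fourierTransformₗᵢ (Space n) ℂ).symm.toLinearIsometry.toContinuousLinearMap.restrictScalars
    ℝ).hasFDerivAt.comp_hasDerivAt s key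

theorem fourier_laplacian_schwartz_ae_eq (ψ : 𝓢(Space n, ℂ)) :
    (𝓕 ((Laplacian.laplacian ψ : 𝓢(Space n, ℂ)).toLp 2 volume) : LTwo n) =ᵐ[volume]
      fun ξ => -(4 * Real.pi ^ 2) * (‖ξ‖ : ℂ) ^ 2 * (𝓕 ψ : 𝓢(Space n, ℂ)) ξ := by
  rw [SchwartzMap.toLp_fourier_eq]
  filter_upwards [SchwartzMap.coeFn_toLp (𝓕 (Laplacian.laplacian ψ : 𝓢(Space n, ℂ))) 2 volume]
    with ξ h2
  rw [h2, SchwartzMap.laplacian_eq_fourierMultiplierCLM, FourierTransform.fourier_smul,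
    SchwartzMap.fourierMultiplierCLM_apply, FourierTransform.fourier_fourierInv_eq,
    smul_apply, SchwartzMap.smulLeftCLM_apply_apply (by fun_prop)]
  simp
  ring

theorem hasDerivAt_freeGroup_schwartz (ψ : 𝓢(Space n, ℂ)) (s : ℝ) :
    HasDerivAt (fun r => freeGroup n r (ψ.toLp 2 volume))
      (freeGroup n s (Complex.I • (Laplacian.laplacian ψ : 𝓢(Space n, ℂ)).toLp 2 volume)) s := by
  refine hasDerivAt_freeGroup ?_ s
  rw [SchwartzMap.toLp_fourier_eq ψ]
  filter_upwards [SchwartzMap.coeFn_toLp (𝓕 ψ) 2 volume, fourier_laplacian_schwartz_ae_eq ψ]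
    with ξ h1 h2
  rw [h1, h2]

theorem freeGroup_smul_real (s c : ℝ) (g : LTwo n) :
    freeGroup n s (c • g) = c • freeGroup n s g :=
  (freeGroup n s).toLinearMap.map_smul_of_tower c g

/-- The product rule for the free group along a differentiable curve in `L²`. -/
theorem hasDerivAt_freeGroup_curve {g : ℝ → LTwo n} {g' k : LTwo n} {t : ℝ}
    (hg : HasDerivAt g g' t) (c : ℝ)
    (hk : ∀ s, HasDerivAt (fun r => freeGroup n r (g t)) (freeGroup n s k) s) :
    HasDerivAt (fun s => freeGroup n (c * s) (g s)) (freeGroup n (c * t) (g' + c • k)) t := by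
  have h1 : HasDerivAt (fun s => freeGroup n (c * s) (g t)) (c • freeGroup n (c * t) k) t := by
    have hm : HasDerivAt (fun s : ℝ => c * s) c t := by
      simpa using (hasDerivAt_id t).const_mul c
    exact (hk (c * t)).scomp t hm
  -- The slope here is the group applied to the slope of `g`, and converges by joint continuity.
  have h2 : HasDerivAt (fun s => freeGroup n (c * s) (g s - g t)) (freeGroup n (c * t) g') t := by
    rw [hasDerivAt_iff_tendsto_slope] at hg ⊢
    have hm : Tendsto (fun s => c * s) (𝓝[≠] t) (𝓝 (c * t)) :=
      ((continuous_const_mul c).tendsto t).mono_left nhdsWithin_le_nhds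
    have h3 : Tendsto (fun s => freeGroup n (c * s) (slope g t s)) (𝓝[≠] t)
        (𝓝 (freeGroup n (c * t) g')) :=
      Tendsto.comp (g := fun p : ℝ × LTwo n => freeGroup n p.1 p.2)
        (f := fun s => (c * s, slope g t s))
        (freeGroup_continuous_uncurry.tendsto (c * t, g')) (hm.prodMk_nhds hg)
    refine h3.congr fun s => ?_
    rw [slope_def_module, slope_def_module, sub_self, map_zero, sub_zero, freeGroup_smul_real]
  have h4 := h2.add h1
  rw [← freeGroup_smul_real, ← map_add] at h4
  refine h4.congr_of_eventuallyEq (Eventually.of_forall fun s => ?_)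
  rw [Pi.add_apply, ← map_add, sub_add_cancel]

end Generator

/-! ### Integration by parts against Bochner primitives. -/

section Primitive

variable {H : Type*} [NormedAddCommGroup H] [InnerProductSpace ℂ H]
  [NormedSpace ℝ H]

theorem integral_inner_deriv {Q Q' : ℝ → H} (hQ : ∀ t, HasDerivAt Q (Q' t) t)
    (hQ' : Continuous Q') (v : H) (a b : ℝ) :
    ∫ t in a..b, inner ℂ (Q' t) v = inner ℂ (Q b - Q a) v := by
  rw [inner_sub_left]
  have hc : Continuous fun t => inner ℂ (Q' t) v := hQ'.inner continuous_const
  refine intervalIntegral.integral_eq_sub_of_hasDerivAt (f := fun t => inner ℂ (Q t) v)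
    (fun t _ => ?_)
    (hc.intervalIntegrable _ _)
  simpa using (hQ t).inner ℂ (hasDerivAt_const t v)

/-- Integration by parts against an indefinite Bochner integral. -/
theorem integral_inner_primitive [CompleteSpace H] {Q Q' : ℝ → H}
    (hQ : ∀ t, HasDerivAt Q (Q' t) t)
    (hQ' : Continuous Q') {T : ℝ} (hQT : Q T = 0) {P : ℝ → H} (hP : IntegrableOn P (Ioo 0 T)) :
    ∫ t in Ioo 0 T, inner ℂ (Q' t) (∫ τ in (0 : ℝ)..t, P τ) =
      -∫ τ in Ioo 0 T, inner ℂ (Q τ) (P τ) := by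
  obtain ⟨C, hC⟩ := (isCompact_Icc (a := (0 : ℝ)) (b := T)).exists_bound_of_continuousOn
    hQ'.continuousOn
  set μ := (volume : Measure ℝ).restrict (Ioo 0 T) with hμ
  -- Fubini on the triangle `τ < t`; the inner integral of `Q'` from `τ` to `T` is `-Q τ` because `Q
  -- T = 0`.
  set E : Set (ℝ × ℝ) := {p | p.2 < p.1} with hE
  have hEm : MeasurableSet E := measurableSet_lt measurable_snd measurable_fst
  set G : ℝ → ℝ → ℂ := fun t τ => E.indicator (fun p => inner ℂ (Q' p.1) (P p.2)) (t, τ) with hG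
  have hGi : Integrable (Function.uncurry G) (μ.prod μ) := by
    refine Integrable.indicator (s := E) (f := fun p => inner ℂ (Q' p.1) (P p.2)) ?_ hEm
    refine (((Integrable.comp_snd hP μ).norm).const_mul C).mono' ?_ ?_
    · exact (hQ'.comp continuous_fst).aestronglyMeasurable.inner hP.aestronglyMeasurable.comp_snd
    · filter_upwards [Measure.quasiMeasurePreserving_fst.ae (ae_restrict_mem measurableSet_Ioo)]
        with p hp
      refine (norm_inner_le_norm _ _).trans ?_
      gcongr
      exact hC _ (Ioo_subset_Icc_self hp)
  calc ∫ t in Ioo 0 T, inner ℂ (Q' t) (∫ τ in (0 : ℝ)..t, P τ)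
      = ∫ t, ∫ τ, G t τ ∂μ ∂μ := by
        refine setIntegral_congr_fun measurableSet_Ioo fun t ht => ?_
        have h1 : ∀ τ, G t τ = (Iio t).indicator (fun τ => inner ℂ (Q' t) (P τ)) τ := fun τ => by
          classical
          simp only [hG, indicator_apply, hE, mem_ofPred_eq, mem_Iio]
        simp only [h1]
        rw [hμ, setIntegral_indicator measurableSet_Iio, Ioo_inter_Iio, min_eq_right ht.2.le,
          intervalIntegral.integral_of_le ht.1.le, integral_Ioc_eq_integral_Ioo,
          integral_inner (hP.mono_set (Ioo_subset_Ioo_right ht.2.le))]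
    _ = ∫ τ, ∫ t, G t τ ∂μ ∂μ := integral_integral_swap hGi
    _ = ∫ τ in Ioo 0 T, -inner ℂ (Q τ) (P τ) := by
        refine setIntegral_congr_fun measurableSet_Ioo fun τ hτ => ?_
        have h1 : ∀ t, G t τ = (Ioi τ).indicator (fun t => inner ℂ (Q' t) (P τ)) t := fun t => by
          classical
          simp only [hG, indicator_apply, hE, mem_ofPred_eq, mem_Ioi]
        simp only [h1]
        rw [hμ, setIntegral_indicator measurableSet_Ioi, Ioo_inter_Ioi, max_eq_right hτ.1.le,
          ← integral_Ioc_eq_integral_Ioo, ← intervalIntegral.integral_of_le hτ.2.le,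
          integral_inner_deriv hQ hQ', hQT, zero_sub, inner_neg_left]
    _ = _ := integral_neg _

end Primitive

/-! ### Space and time derivatives of test functions. -/

section TestFunctions

variable {n : ℕ} {Ψ : Space n × ℝ → ℂ}

theorem hasLineDerivAt_slice {f : Space n × ℝ → ℂ} {x : Space n} {t : ℝ}
    (hf : DifferentiableAt ℝ f (x, t)) (v : Space n) :
    HasLineDerivAt ℝ (fun z => f (z, t)) (fderiv ℝ f (x, t) (v, 0)) x v := by
  have h1 : HasFDerivAt (fun z : Space n => (z, t)) (ContinuousLinearMap.inl ℝ (Space n) ℝ) x :=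
    hasFDerivAt_prodMk_left x t
  exact (hf.hasFDerivAt.comp x h1).hasLineDerivAt v

/-- The Laplacian in the space variables. -/
noncomputable def spaceLaplacian (Ψ : Space n × ℝ → ℂ) (p : Space n × ℝ) : ℂ :=
  Laplacian.laplacian (fun z => Ψ (z, p.2)) p.1

/-- The derivative in the time variable. -/
noncomputable def timeDeriv (Ψ : Space n × ℝ → ℂ) (p : Space n × ℝ) : ℂ :=
  fderiv ℝ Ψ p (0, 1)

theorem contDiff_fderiv_apply (h : ContDiff ℝ (⊤ : ℕ∞) Ψ) (v : Space n × ℝ) :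
    ContDiff ℝ (⊤ : ℕ∞) fun q => fderiv ℝ Ψ q v :=
  (h.fderiv_right (m := (⊤ : ℕ∞)) (by norm_num)).clm_apply contDiff_const

/-- Expressed through derivatives on the product space, the slicewise Laplacian is visibly
continuous in (x, t) jointly and supported in the support of Ψ. -/
theorem spaceLaplacian_eq (h : ContDiff ℝ (⊤ : ℕ∞) Ψ) :
    spaceLaplacian Ψ = fun p => ∑ i, fderiv ℝ
      (fun q => fderiv ℝ Ψ q (EuclideanSpace.basisFun (Fin n) ℝ i, 0)) p
        (EuclideanSpace.basisFun (Fin n) ℝ i, 0) := by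
  funext ⟨x, t⟩
  have hs : ContDiff ℝ (⊤ : ℕ∞) fun z : Space n => Ψ (z, t) :=
    h.comp (contDiff_id.prodMk contDiff_const)
  refine laplacian_eq_sum_of_hasLineDerivAt
    (contDiff_infty.1 hs 2).contDiffAt
    (D := fun i y => fderiv ℝ Ψ (y, t) (EuclideanSpace.basisFun (Fin n) ℝ i, 0))
    (fun i => Eventually.of_forall fun y => ?_) fun i => ?_
  · exact hasLineDerivAt_slice (h.differentiable (by simp) _) _
  · exact hasLineDerivAt_slice ((contDiff_fderiv_apply h _).differentiable (by simp) _) _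

theorem continuous_spaceLaplacian (h : ContDiff ℝ (⊤ : ℕ∞) Ψ) : Continuous (spaceLaplacian Ψ) := by
  rw [spaceLaplacian_eq h]
  exact continuous_finsetSum _ fun i _ =>
    (contDiff_fderiv_apply (contDiff_fderiv_apply h _) _).continuous

theorem continuous_timeDeriv (h : ContDiff ℝ (⊤ : ℕ∞) Ψ) : Continuous (timeDeriv Ψ) :=
  (contDiff_fderiv_apply h _).continuous

theorem hasCompactSupport_timeDeriv (hc : HasCompactSupport Ψ) :
    HasCompactSupport (timeDeriv Ψ) :=
  hc.fderiv_apply ℝ _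

theorem hasCompactSupport_spaceLaplacian (h : ContDiff ℝ (⊤ : ℕ∞) Ψ) (hc : HasCompactSupport Ψ) :
    HasCompactSupport (spaceLaplacian Ψ) := by
  rw [spaceLaplacian_eq h]
  refine hc.mono' fun p hp => ?_
  by_contra hcon
  refine hp (Finset.sum_eq_zero fun i _ => ?_)
  have h1 : Ψ =ᶠ[𝓝 p] 0 := notMem_tsupport_iff_eventuallyEq.1 hcon
  have h2 : (fun q => fderiv ℝ Ψ q (EuclideanSpace.basisFun (Fin n) ℝ i, 0)) =ᶠ[𝓝 p] fun _ => 0 := by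
    filter_upwards [h1.eventuallyEq_nhds] with q hq
    rw [hq.fderiv_eq]
    simp
  rw [h2.fderiv_eq]
  simp

theorem hasDerivAt_time (h : ContDiff ℝ (⊤ : ℕ∞) Ψ) (x : Space n) (t : ℝ) :
    HasDerivAt (fun s => Ψ (x, s)) (timeDeriv Ψ (x, t)) t := by
  have h1 : HasDerivAt (fun s : ℝ => (x, s)) ((0 : Space n), (1 : ℝ)) t :=
    (hasDerivAt_const t x).prodMk (hasDerivAt_id t)
  exact ((h.differentiable (by simp) (x, t)).hasFDerivAt).comp_hasDerivAt t h1

theorem hasCompactSupport_slice (hc : HasCompactSupport Ψ) (t : ℝ) :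
    HasCompactSupport fun x => Ψ (x, t) := by
  refine HasCompactSupport.of_support_subset_isCompact (hc.isCompact.image continuous_fst)
    fun x hx => ⟨(x, t), subset_tsupport _ hx, rfl⟩

/-- Each slice is smooth with compact support, hence Schwartz and in the domain of the generator;
the product rule applies. -/
theorem hasDerivAt_freeGroup_slice (h : ContDiff ℝ (⊤ : ℕ∞) Ψ) (hc : HasCompactSupport Ψ)
    (c t : ℝ) :
    HasDerivAt (fun s => freeGroup n (c * s) (slice Ψ s))
      (freeGroup n (c * t) (slice (timeDeriv Ψ) t +
        c • (Complex.I • slice (spaceLaplacian Ψ) t))) t := by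
  have h1 := hasDerivAt_slice h.continuous hc (continuous_timeDeriv h)
    (hasCompactSupport_timeDeriv hc) (hasDerivAt_time h) t
  refine hasDerivAt_freeGroup_curve h1 c fun s => ?_
  set ψ := (hasCompactSupport_slice hc t).toSchwartzMap
    (h.comp (contDiff_id.prodMk contDiff_const)) with hψ
  have e1 : slice Ψ t = ψ.toLp 2 volume := by
    ext1
    exact (slice_coe h.continuous hc t).trans (ψ.coeFn_toLp 2 volume).symm
  have e2 : slice (spaceLaplacian Ψ) t =
      (Laplacian.laplacian ψ : SchwartzMap (Space n) ℂ).toLp 2 volume := by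
    ext1
    refine (slice_coe (continuous_spaceLaplacian h) (hasCompactSupport_spaceLaplacian h hc) t).trans
      (EventuallyEq.trans (Eventually.of_forall fun x => ?_)
        ((Laplacian.laplacian ψ : SchwartzMap (Space n) ℂ).coeFn_toLp 2 volume).symm)
    rw [SchwartzMap.laplacian_apply]
    rfl
  rw [e1, e2]
  exact hasDerivAt_freeGroup_schwartz ψ s

end TestFunctions

/-! ### The weak equation for mild solutions in L². -/

section WeakForm

variable {n : ℕ} {φ : Space n → ℝ → ℂ}

/-- The conjugate of a test function, as a function of space-time. -/
noncomputable def conjTest (φ : Space n → ℝ → ℂ) (p : Space n × ℝ) : ℂ := conj (φ p.1 p.2)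

theorem contDiff_conjTest (h : ContDiff ℝ (⊤ : ℕ∞) (Function.uncurry φ)) :
    ContDiff ℝ (⊤ : ℕ∞) (conjTest φ) :=
  Complex.conjCLE.contDiff.comp h

theorem hasCompactSupport_conjTest (hc : HasCompactSupport (Function.uncurry φ)) :
    HasCompactSupport (conjTest φ) :=
  hc.comp_left (g := conj) (map_zero _)

theorem spaceLaplacian_conjTest (h : ContDiff ℝ (⊤ : ℕ∞) (Function.uncurry φ)) (x : Space n)
    (t : ℝ) :
    spaceLaplacian (conjTest φ) (x, t) = conj (Laplacian.laplacian (fun z => φ z t) x) := by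
  have hs : ContDiff ℝ (⊤ : ℕ∞) fun z : Space n => φ z t :=
    h.comp (contDiff_id.prodMk contDiff_const)
  exact ((contDiff_infty.1 hs 2).contDiffAt).laplacian_CLM_comp_left
    (l := (Complex.conjCLE : ℂ →L[ℝ] ℂ))

theorem timeDeriv_conjTest (h : ContDiff ℝ (⊤ : ℕ∞) (Function.uncurry φ)) (x : Space n)
    (t : ℝ) : timeDeriv (conjTest φ) (x, t) = conj (deriv (fun s => φ x s) t) := by
  have h1 := hasDerivAt_time h x t
  have h2 := hasDerivAt_time (contDiff_conjTest h) x t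
  have h3 : HasDerivAt (fun s => conj (φ x s)) (conj (deriv (fun s => φ x s) t)) t :=
    h1.differentiableAt.hasDerivAt.star
  exact h2.unique h3

theorem continuous_freeGroup_apply {X : Type*} [TopologicalSpace X] {a : X → ℝ} {g : X → LTwo n}
    (ha : Continuous a) (hg : Continuous g) : Continuous fun x => freeGroup n (a x) (g x) := by
  have h := freeGroup_continuous_uncurry (n := n)
  fun_prop

/-- The pulled back derivative `e^{-i c s Δ} (∂ₜ - i c Δ) Ψ`. -/
noncomputable def pullbackDeriv (Ψ : Space n × ℝ → ℂ) (c t : ℝ) : LTwo n :=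
  freeGroup n (-c * t) (slice (timeDeriv Ψ) t + (-c) • (Complex.I • slice (spaceLaplacian Ψ) t))

theorem continuous_pullbackDeriv {Ψ : Space n × ℝ → ℂ} (h : ContDiff ℝ (⊤ : ℕ∞) Ψ)
    (hc : HasCompactSupport Ψ) (c : ℝ) : Continuous (pullbackDeriv Ψ c) := by
  have h1 := continuous_slice (continuous_timeDeriv h) (hasCompactSupport_timeDeriv hc)
  have h2 := continuous_slice (continuous_spaceLaplacian h) (hasCompactSupport_spaceLaplacian h hc)
  have h5 : Continuous fun t => Complex.I • slice (spaceLaplacian Ψ) t := h2.const_smul Complex.I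
  have h6 : Continuous fun t => (-c) • (Complex.I • slice (spaceLaplacian Ψ) t) :=
    h5.const_smul (-c)
  have h3 : Continuous fun t => slice (timeDeriv Ψ) t +
      (-c) • (Complex.I • slice (spaceLaplacian Ψ) t) := h1.add h6
  unfold pullbackDeriv
  exact continuous_freeGroup_apply (continuous_const_mul (-c)) h3

/-- The space integral of the weak equation as an inner product. -/
theorem integral_mul_adjoint_eq_inner {ħ m : ℝ} (hm : 0 < m)
    (h : ContDiff ℝ (⊤ : ℕ∞) (Function.uncurry φ))
    (hc : HasCompactSupport (Function.uncurry φ)) (t : ℝ) (g : LTwo n) :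
    ∫ x, (freeGroup n (ħ / (2 * m) * t) g) x *
        (((ħ ^ 2 / (2 * m) : ℝ) : ℂ) * Laplacian.laplacian (fun z => φ z t) x
          - Complex.I * ħ * deriv (fun s => φ x s) t) =
      inner ℂ ((Complex.I * ħ) • pullbackDeriv (conjTest φ) (ħ / (2 * m)) t) g := by
  have h' := contDiff_conjTest h
  have hc' := hasCompactSupport_conjTest hc
  rw [pullbackDeriv, ← map_smul, neg_mul, ← inner_freeGroup, L2.inner_def]
  refine integral_congr_ae ?_
  set a := slice (timeDeriv (conjTest φ)) t
  set b := slice (spaceLaplacian (conjTest φ)) t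
  filter_upwards [Lp.coeFn_smul (Complex.I * ħ) (a + (-(ħ / (2 * m))) • (Complex.I • b)),
    Lp.coeFn_add a ((-(ħ / (2 * m))) • (Complex.I • b)),
    Lp.coeFn_smul (-(ħ / (2 * m))) (Complex.I • b), Lp.coeFn_smul Complex.I b,
    slice_coe (continuous_timeDeriv h') (hasCompactSupport_timeDeriv hc') t,
    slice_coe (continuous_spaceLaplacian h') (hasCompactSupport_spaceLaplacian h' hc') t]
    with x h1 h2 h3 h4 h5 h6
  rw [RCLike.inner_apply, h1, Pi.smul_apply, h2, Pi.add_apply, h3, Pi.smul_apply, h4, Pi.smul_apply,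
    h5, h6, spaceLaplacian_conjTest h, timeDeriv_conjTest h]
  congr 1
  simp only [smul_eq_mul, Complex.real_smul, map_mul, map_add, Complex.conj_I, Complex.conj_ofReal,
    Complex.conj_conj]
  have hm0 : (m : ℂ) ≠ 0 := by exact_mod_cast hm.ne'
  push_cast
  field_simp
  linear_combination ((ħ : ℂ) ^ 2 * Laplacian.laplacian (fun z => φ z t) x) * Complex.I_sq

/-- Mild solutions of the Schrödinger equation in `L²` are weak solutions. -/
theorem integral_integral_freeGroup_mul {ħ m T : ℝ} (hħ : 0 < ħ) (hm : 0 < m) (hT : 0 < T)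
    (h : ContDiff ℝ (⊤ : ℕ∞) (Function.uncurry φ))
    (hc : HasCompactSupport (Function.uncurry φ))
    (hφ : tsupport (Function.uncurry φ) ⊆ univ ×ˢ Ioo 0 T) (g : LTwo n) {P : ℝ → LTwo n}
    (hP : IntegrableOn P (Ioo 0 T)) :
    ∫ t in Ioo 0 T, ∫ x,
        (freeGroup n (ħ / (2 * m) * t) (g + (-(Complex.I / ħ)) • ∫ τ in (0 : ℝ)..t, P τ)) x *
        (((ħ ^ 2 / (2 * m) : ℝ) : ℂ) * Laplacian.laplacian (fun z => φ z t) x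
          - Complex.I * ħ * deriv (fun s => φ x s) t) =
      ∫ t in Ioo 0 T, ∫ x, (freeGroup n (ħ / (2 * m) * t) (P t)) x * φ x t := by
  set c := ħ / (2 * m) with hcdef
  have h' := contDiff_conjTest h
  have hc' := hasCompactSupport_conjTest hc
  have hħ0 : (ħ : ℂ) ≠ 0 := by exact_mod_cast hħ.ne'
  -- The test function pulled back by the flow, conjugated because the inner product is conjugate
  -- linear in its first slot. Its derivative carries the whole differential operator.
  set Q : ℝ → LTwo n := fun t => freeGroup n (-c * t) (slice (conjTest φ) t) with hQ
  have hQd : ∀ t, HasDerivAt Q (pullbackDeriv (conjTest φ) c t) t :=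
    hasDerivAt_freeGroup_slice h' hc' (-c)
  have hQc := continuous_pullbackDeriv h' hc' c
  have hzero : ∀ t ∉ Ioo 0 T, Q t = 0 := by
    intro t ht
    rw [hQ]
    simp only
    rw [slice_eq_zero, map_zero]
    intro x
    have : (x, t) ∉ tsupport (Function.uncurry φ) := fun hx => ht (hφ hx).2
    rw [conjTest, show φ x t = Function.uncurry φ (x, t) from rfl,
      image_eq_zero_of_notMem_tsupport this, map_zero]
  have hprim : ContinuousOn (fun t => ∫ τ in (0 : ℝ)..t, P τ) (Icc 0 T) := by
    have := intervalIntegral.continuousOn_primitive_interval (μ := volume) (f := P) (a := 0)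
      (b := T) (by rwa [uIcc_of_le hT.le, integrableOn_Icc_iff_integrableOn_Ioo])
    rwa [uIcc_of_le hT.le] at this
  have hi1 : IntegrableOn (fun t => inner ℂ (pullbackDeriv (conjTest φ) c t) g) (Ioo 0 T) :=
    ((hQc.inner continuous_const).continuousOn.integrableOn_Icc).mono_set Ioo_subset_Icc_self
  have hi2 : IntegrableOn (fun t => inner ℂ (pullbackDeriv (conjTest φ) c t)
      (∫ τ in (0 : ℝ)..t, P τ)) (Ioo 0 T) :=
    ((hQc.continuousOn.inner hprim).integrableOn_Icc).mono_set Ioo_subset_Icc_self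
  -- The initial value contributes the integral of a total derivative, and `Q` vanishes at both
  -- ends.
  have hg : ∫ t in Ioo 0 T, inner ℂ (pullbackDeriv (conjTest φ) c t) g = 0 := by
    rw [← integral_Ioc_eq_integral_Ioo, ← intervalIntegral.integral_of_le hT.le,
      integral_inner_deriv hQd hQc, hzero T (by simp), hzero 0 (by simp), sub_zero,
      inner_zero_left]
  calc _ = ∫ t in Ioo 0 T, ((-(Complex.I * ħ)) * inner ℂ (pullbackDeriv (conjTest φ) c t) g +
          (-1) * inner ℂ (pullbackDeriv (conjTest φ) c t) (∫ τ in (0 : ℝ)..t, P τ)) := by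
        refine setIntegral_congr_fun measurableSet_Ioo fun t _ => ?_
        rw [integral_mul_adjoint_eq_inner hm h hc, inner_add_right, inner_smul_right,
          inner_smul_left, inner_smul_left, map_mul, Complex.conj_I, Complex.conj_ofReal]
        rw [← hcdef]
        field_simp
        linear_combination
          inner ℂ (pullbackDeriv (conjTest φ) c t) (∫ τ in (0 : ℝ)..t, P τ) * Complex.I_sq
    _ = ∫ t in Ioo 0 T, inner ℂ (Q t) (P t) := by
        rw [integral_add (hi1.const_mul _) (hi2.const_mul _), integral_const_mul, hg, mul_zero,
          zero_add, integral_const_mul, integral_inner_primitive hQd hQc (hzero T (by simp)) hP]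
        ring
    _ = _ := by
        refine setIntegral_congr_fun measurableSet_Ioo fun t _ => ?_
        simp only [hQ]
        rw [neg_mul, ← inner_freeGroup, L2.inner_def]
        refine integral_congr_ae ?_
        filter_upwards [slice_coe h'.continuous hc' t] with x hx
        rw [RCLike.inner_apply, hx, conjTest, Complex.conj_conj]

end WeakForm

/-! ### The mild solution is a weak solution. -/

section Existence

variable {n : ℕ} {ħ m T M : ℝ} {B : Type*} [NormedAddCommGroup B] [NormedSpace ℂ B]
  {j : B →L[ℂ] LTwo n} {U : ℝ → B →L[ℂ] B} {F : ℝ → B}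

theorem integrableOn_freeGroup_source (c : ℝ)
    (hF : AEStronglyMeasurable F (volume.restrict (Ioo 0 T)))
    (hFM : ∀ᵐ t ∂(volume.restrict (Ioo 0 T)), ‖F t‖ ≤ M) :
    IntegrableOn (fun τ => freeGroup n (-c * τ) (j (F τ))) (Ioo 0 T) := by
  refine Integrable.of_bound (C := ‖j‖ * M) ?_ ?_
  · have h1 : AEStronglyMeasurable (fun τ : ℝ => (-c * τ, j (F τ))) (volume.restrict (Ioo 0 T)) :=
      (continuous_const_mul (-c)).aestronglyMeasurable.prodMk
        (j.continuous.comp_aestronglyMeasurable hF)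
    exact Continuous.comp_aestronglyMeasurable (g := fun p : ℝ × LTwo n => freeGroup n p.1 p.2)
      (f := fun τ => (-c * τ, j (F τ))) freeGroup_continuous_uncurry h1
  · filter_upwards [hFM] with τ hτ
    rw [LinearIsometry.norm_map]
    exact j.le_opNorm_of_le hτ

/-- The group law in L² splits the evolution over `t - τ`, so that the factor depending on `t`
leaves the integral and a primitive remains. -/
theorem IsFreePropagator.map_mild_eq [CompleteSpace B] (hU : IsFreePropagator ħ m j U)
    (hħ : 0 < ħ) (hm : 0 < m)
    (hF : AEStronglyMeasurable F (volume.restrict (Ioo 0 T)))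
    (hFM : ∀ᵐ t ∂(volume.restrict (Ioo 0 T)), ‖F t‖ ≤ M) (b : B) {t : ℝ} (ht : t ∈ Icc 0 T) :
    j (U t b + sourceTerm ħ U F t) = freeGroup n (ħ / (2 * m) * t)
      (j b + (-(Complex.I / ħ)) •
        ∫ τ in (0 : ℝ)..t, freeGroup n (-(ħ / (2 * m)) * τ) (j (F τ))) := by
  rw [map_add, hU.apply_eq hħ hm, map_add, map_smul, sourceTerm, map_smul]
  congr 2
  have h1 := ((hU.intervalIntegrable hF hFM ht).1)
  have h2 : IntegrableOn (fun τ => freeGroup n (-(ħ / (2 * m)) * τ) (j (F τ))) (Ioc 0 t) := by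
    rw [integrableOn_Ioc_iff_integrableOn_Ioo]
    exact (integrableOn_freeGroup_source _ hF hFM).mono_set (Ioo_subset_Ioo_right ht.2)
  rw [intervalIntegral.integral_of_le ht.1, intervalIntegral.integral_of_le ht.1,
    ← ContinuousLinearMap.integral_comp_comm j h1,
    ← LinearIsometry.coe_toContinuousLinearMap,
    ← ContinuousLinearMap.integral_comp_comm (freeGroup n _).toContinuousLinearMap h2]
  refine integral_congr_ae (Eventually.of_forall fun τ => ?_)
  simp only [LinearIsometry.coe_toContinuousLinearMap]
  rw [hU.apply_eq hħ hm, ← freeGroup_add]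
  ring_nf

theorem IsFreePropagator.isSolution [CompleteSpace B] (hU : IsFreePropagator ħ m j U)
    (hħ : 0 < ħ) (hm : 0 < m) (hT : 0 < T) (hM : 0 ≤ M)
    (hF : AEStronglyMeasurable F (volume.restrict (Ioo 0 T)))
    (hFM : ∀ᵐ t ∂(volume.restrict (Ioo 0 T)), ‖F t‖ ≤ M) (b : B) :
    IsSolution ħ m T j b F (fun t => U t b + sourceTerm ħ U F t) where
  memLp := hU.memLp_add_sourceTerm hM hF hFM b
  equation φ h hc hφ := by
    have key := integral_integral_freeGroup_mul hħ hm hT h hc hφ (j b)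
      (integrableOn_freeGroup_source (n := n) (j := j) (ħ / (2 * m)) hF hFM)
    refine Eq.trans (setIntegral_congr_fun measurableSet_Ioo fun t ht => ?_)
      (key.trans (setIntegral_congr_fun measurableSet_Ioo fun t _ => ?_))
    · rw [hU.map_mild_eq hħ hm hF hFM b (Ioo_subset_Icc_self ht)]
    · rw [neg_mul, ← freeGroup_add, add_neg_cancel, freeGroup_zero]
  initial := by simp [hU.zero, sourceTerm]
  continuous_initial := by
    refine (hU.continuous b).continuousWithinAt.add ?_
    have h0 : sourceTerm ħ U F 0 = 0 := by simp [sourceTerm]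
    rw [ContinuousWithinAt, h0]
    exact hU.tendsto_sourceTerm hħ hT hFM

end Existence

/-! ### Weak derivatives on an interval with vanishing initial value. -/

section WeakDerivative

theorem exists_Icc_of_isCompact_subset_Ioo {T : ℝ} (hT : 0 < T) {K : Set ℝ} (hK : IsCompact K)
    (hKT : K ⊆ Ioo 0 T) : ∃ a b, 0 < a ∧ a < b ∧ b < T ∧ K ⊆ Icc a b := by
  rcases K.eq_empty_or_nonempty with rfl | hne
  · exact ⟨T / 3, T / 2, by linarith, by linarith, by linarith, empty_subset _⟩
  · have h1 := hKT (hK.sInf_mem hne)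
    have h2 := hKT (hK.sSup_mem hne)
    -- Halving the infimum keeps the interval nondegenerate when `K` is a point.
    refine ⟨sInf K / 2, sSup K, half_pos h1.1, ?_, h2.2, fun x hx => ⟨?_, le_csSup hK.bddAbove hx⟩⟩
    · linarith [h1.1, csInf_le_csSup (s := K) hne hK.bddBelow hK.bddAbove]
    · linarith [h1.1, csInf_le hK.bddBelow hx]

/-- A smooth function of zero mean, compactly supported in an interval, is the derivative of such a
function. -/
theorem exists_primitive_of_integral_eq_zero {T : ℝ} (hT : 0 < T) {g : ℝ → ℝ}
    (hg : ContDiff ℝ (⊤ : ℕ∞) g) (hgc : HasCompactSupport g) (hgs : tsupport g ⊆ Ioo 0 T)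
    (h0 : ∫ t, g t = 0) :
    ∃ θ : ℝ → ℝ, ContDiff ℝ (⊤ : ℕ∞) θ ∧ HasCompactSupport θ ∧ tsupport θ ⊆ Ioo 0 T ∧
      deriv θ = g := by
  obtain ⟨a, b, ha, hab, hb, hK⟩ := exists_Icc_of_isCompact_subset_Ioo hT hgc.isCompact hgs
  have hz : ∀ t ∉ Icc a b, g t = 0 := fun t ht =>
    image_eq_zero_of_notMem_tsupport fun h => ht (hK h)
  have hd : ∀ t, HasDerivAt (fun t => ∫ s in a..t, g s) (g t) t := fun t =>
    intervalIntegral.integral_hasDerivAt_right (hg.continuous.intervalIntegrable _ _)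
      hg.continuous.stronglyMeasurable.stronglyMeasurableAtFilter hg.continuous.continuousAt
  have hderiv : deriv (fun t => ∫ s in a..t, g s) = g := funext fun t => (hd t).deriv
  have hab0 : ∫ s in a..b, g s = 0 := by
    rw [intervalIntegral.integral_of_le hab.le, ← integral_Icc_eq_integral_Ioc,
      setIntegral_eq_integral_of_forall_compl_eq_zero hz, h0]
  have hsupp : Function.support (fun t => ∫ s in a..t, g s) ⊆ Icc a b := by
    intro t ht
    by_contra hcon
    refine ht ?_
    change ∫ s in a..t, g s = 0
    rw [mem_Icc, not_and_or, not_le, not_le] at hcon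
    rcases hcon with h | h
    · refine intervalIntegral.integral_zero_ae ?_
      filter_upwards [compl_mem_ae_iff.2 (measure_singleton (μ := volume) a)] with s hsa hs
      rw [uIoc_of_ge h.le] at hs
      exact hz s fun hs' => hsa (le_antisymm hs.2 hs'.1)
    · rw [← intervalIntegral.integral_add_adjacent_intervals
        (hg.continuous.intervalIntegrable a b) (hg.continuous.intervalIntegrable b t), hab0, zero_add]
      refine intervalIntegral.integral_zero_ae (Eventually.of_forall fun s hs => ?_)
      rw [uIoc_of_le h.le] at hs
      exact hz s fun hs' => absurd hs.1 (not_lt.2 hs'.2)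
  have hts : tsupport (fun t => ∫ s in a..t, g s) ⊆ Icc a b := closure_minimal hsupp isClosed_Icc
  refine ⟨fun t => ∫ s in a..t, g s, ?_, ?_, ?_, hderiv⟩
  · rw [contDiff_infty_iff_deriv, hderiv]
    exact ⟨fun t => (hd t).differentiableAt, hg⟩
  · exact HasCompactSupport.of_support_subset_isCompact isCompact_Icc hsupp
  · exact hts.trans fun t ht => ⟨ha.trans_le ht.1, ht.2.trans_lt hb⟩

/-- A smooth nonnegative function of mean one, compactly supported in `(0, δ)`. -/
theorem exists_bump_Ioo {δ : ℝ} (hδ : 0 < δ) :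
    ∃ ρ : ℝ → ℝ, ContDiff ℝ (⊤ : ℕ∞) ρ ∧ HasCompactSupport ρ ∧ tsupport ρ ⊆ Ioo 0 δ ∧
      (∀ t, 0 ≤ ρ t) ∧ ∫ t, ρ t = 1 := by
  let β : ContDiffBump (δ / 2) := ⟨δ / 8, δ / 4, by linarith, by linarith⟩
  refine ⟨β.normed volume, β.contDiff_normed, β.hasCompactSupport_normed, ?_, β.nonneg_normed,
    β.integral_normed⟩
  rw [β.tsupport_normed_eq, Real.closedBall_eq_Icc]
  exact fun t ht => ⟨by linarith [ht.1, show β.rOut = δ / 4 from rfl],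
    by linarith [ht.2, show β.rOut = δ / 4 from rfl]⟩

/-- A function with vanishing weak derivative and vanishing initial value is zero. -/
theorem ae_eq_zero_of_weakDeriv_eq_zero {T : ℝ} (hT : 0 < T) {r : ℝ → ℂ}
    (hr : IntegrableOn r (Ioo 0 T)) (hr0 : Tendsto r (𝓝[>] 0) (𝓝 0))
    (h : ∀ θ : ℝ → ℝ, ContDiff ℝ (⊤ : ℕ∞) θ → HasCompactSupport θ → tsupport θ ⊆ Ioo 0 T →
      ∫ t in Ioo 0 T, deriv θ t • r t = 0) :
    ∀ᵐ t ∂(volume.restrict (Ioo 0 T)), r t = 0 := by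
  rw [ae_restrict_iff' measurableSet_Ioo]
  refine isOpen_Ioo.ae_eq_zero_of_integral_contDiff_smul_eq_zero hr.locallyIntegrableOn ?_
  intro η hη hηc hηs
  have hint : ∀ g : ℝ → ℝ, Continuous g → HasCompactSupport g →
      IntegrableOn (fun t => g t • r t) (Ioo 0 T) := by
    intro g hg hgc
    obtain ⟨C, hC⟩ := hg.bounded_above_of_compact_support hgc
    exact hr.bdd_smul C hg.aestronglyMeasurable (Eventually.of_forall hC)
  set A := ∫ t, η t with hA
  -- Subtracting `A` times a bump of mass one in `(0, δ)` gives mean zero, hence a derivative of a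
  -- test function. So `η` and the bump, scaled by `A`, have the same pairing with `r`, which is
  -- small near 0; this is where the initial value removes the constant of integration.
  have key : ∀ δ ∈ Ioo 0 T, ∀ ε, (∀ t ∈ Ioo 0 δ, ‖r t‖ ≤ ε) →
      ‖∫ t in Ioo 0 T, η t • r t‖ ≤ |A| * ε := by
    intro δ hδ ε hε
    obtain ⟨ρ, hρ, hρc, hρs, hρ0, hρ1⟩ := exists_bump_Ioo hδ.1
    have hρi : Integrable ρ := hρ.continuous.integrable_of_hasCompactSupport hρc
    have hgc : HasCompactSupport fun t => η t - A * ρ t := hηc.sub hρc.mul_left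
    have hgs : tsupport (fun t => η t - A * ρ t) ⊆ Ioo 0 T := by
      refine (tsupport_sub _ _).trans (union_subset hηs ?_)
      exact (closure_mono (Function.support_mul_subset_right _ _)).trans
        (hρs.trans (Ioo_subset_Ioo_right hδ.2.le))
    have hg0 : ∫ t, (η t - A * ρ t) = 0 := by
      rw [integral_sub (hη.continuous.integrable_of_hasCompactSupport hηc) (hρi.const_mul A),
        integral_const_mul, hρ1, mul_one, sub_self]
    obtain ⟨θ, hθ, hθc, hθs, hθd⟩ := exists_primitive_of_integral_eq_zero hT
      (hη.sub (contDiff_const.mul hρ)) hgc hgs hg0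
    have h1 := h θ hθ hθc hθs
    simp only [hθd, sub_smul, mul_smul] at h1
    rw [integral_sub (g := fun t => A • ρ t • r t) (hint η hη.continuous hηc)
      ((hint ρ hρ.continuous hρc).smul A), integral_smul, sub_eq_zero] at h1
    rw [h1, norm_smul, Real.norm_eq_abs]
    gcongr
    calc ‖∫ t in Ioo 0 T, ρ t • r t‖ ≤ ∫ t in Ioo 0 T, ρ t * ε := by
          refine norm_integral_le_of_norm_le (hρi.integrableOn.mul_const ε)
            (Eventually.of_forall fun t => ?_)
          rw [norm_smul, Real.norm_of_nonneg (hρ0 t)]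
          by_cases ht : t ∈ Ioo 0 δ
          · exact mul_le_mul_of_nonneg_left (hε t ht) (hρ0 t)
          · rw [image_eq_zero_of_notMem_tsupport fun hh => ht (hρs hh)]
            simp
      _ = ε := by
          rw [integral_mul_const, setIntegral_eq_integral_of_forall_compl_eq_zero, hρ1, one_mul]
          exact fun t ht => image_eq_zero_of_notMem_tsupport fun hh =>
            ht (Ioo_subset_Ioo_right hδ.2.le (hρs hh))
  have hzero : ∫ t in Ioo 0 T, η t • r t = 0 := by
    rw [← norm_le_zero_iff]
    have hlim : Tendsto (fun ε : ℝ => |A| * ε) (𝓝[>] 0) (𝓝 0) := by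
      have := ((continuous_const_mul |A|).tendsto 0).mono_left
        (nhdsWithin_le_nhds (s := Ioi (0 : ℝ)))
      simpa using this
    refine ge_of_tendsto hlim (eventually_mem_nhdsWithin.mono fun ε hε => ?_)
    have h1 : ∀ᶠ t in 𝓝[>] (0 : ℝ), ‖r t‖ ≤ ε := by
      have := hr0.norm
      rw [norm_zero] at this
      exact (this.eventually (gt_mem_nhds (mem_Ioi.1 hε))).mono fun t ht => ht.le
    obtain ⟨δ, hδ, hsub⟩ := (mem_nhdsGT_iff_exists_Ioo_subset' hT).1
      (inter_mem h1 (Ioo_mem_nhdsGT hT))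
    have hδ' : min δ (T / 2) ∈ Ioo 0 T :=
      ⟨lt_min hδ (by linarith), (min_le_right _ _).trans_lt (by linarith)⟩
    exact key _ hδ' ε fun t ht => (hsub ⟨ht.1, ht.2.trans_le (min_le_left _ _)⟩).1
  rw [← hzero, setIntegral_eq_integral_of_forall_compl_eq_zero]
  intro t ht
  rw [image_eq_zero_of_notMem_tsupport fun hh => ht (hηs hh), zero_smul]

/-- The du Bois-Reymond lemma. -/
theorem ae_eq_integral_of_weakDeriv {T : ℝ} (hT : 0 < T) {p q : ℝ → ℂ}
    (hp : IntegrableOn p (Ioo 0 T)) (hq : IntegrableOn q (Ioo 0 T))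
    (hp0 : Tendsto p (𝓝[>] 0) (𝓝 0))
    (h : ∀ θ : ℝ → ℝ, ContDiff ℝ (⊤ : ℕ∞) θ → HasCompactSupport θ → tsupport θ ⊆ Ioo 0 T →
      ∫ t in Ioo 0 T, deriv θ t • p t = ∫ t in Ioo 0 T, θ t • q t) :
    ∀ᵐ t ∂(volume.restrict (Ioo 0 T)), p t = -∫ s in (0 : ℝ)..t, q s := by
  have hprim : ContinuousOn (fun t => ∫ s in (0 : ℝ)..t, q s) (Icc 0 T) := by
    have := intervalIntegral.continuousOn_primitive_interval (μ := volume) (f := q) (a := 0)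
      (b := T) (by rwa [uIcc_of_le hT.le, integrableOn_Icc_iff_integrableOn_Ioo])
    rwa [uIcc_of_le hT.le] at this
  have hpi : IntegrableOn (fun t => ∫ s in (0 : ℝ)..t, q s) (Ioo 0 T) :=
    hprim.integrableOn_Icc.mono_set Ioo_subset_Icc_self
  have hr0 : Tendsto (fun t => p t + ∫ s in (0 : ℝ)..t, q s) (𝓝[>] 0) (𝓝 0) := by
    have h1 : Tendsto (fun t => ∫ s in (0 : ℝ)..t, q s) (𝓝[>] 0) (𝓝 0) := by
      have h2 := (hprim 0 (left_mem_Icc.2 hT.le)).tendsto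
      rw [intervalIntegral.integral_same] at h2
      exact h2.mono_left (nhdsWithin_le_iff.2
        (mem_of_superset (Ioo_mem_nhdsGT hT) Ioo_subset_Icc_self))
    simpa using hp0.add h1
  have hz : ∀ θ : ℝ → ℝ, ContDiff ℝ (⊤ : ℕ∞) θ → HasCompactSupport θ → tsupport θ ⊆ Ioo 0 T →
      ∫ t in Ioo 0 T, deriv θ t • (p t + ∫ s in (0 : ℝ)..t, q s) = 0 := by
    intro θ hθ hθc hθs
    have hθ' : Continuous (deriv θ) := hθ.continuous_deriv (by simp)
    obtain ⟨C, hC⟩ := hθ'.bounded_above_of_compact_support hθc.deriv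
    have hTz : θ T = 0 := image_eq_zero_of_notMem_tsupport fun hh => (hθs hh).2.ne rfl
    have key := integral_inner_primitive (H := ℂ) (Q := fun t => (θ t : ℂ))
      (Q' := fun t => ((deriv θ t : ℝ) : ℂ)) (T := T)
      (fun t => ((hθ.differentiable (by simp) t).hasDerivAt).ofReal_comp)
      (Complex.continuous_ofReal.comp hθ') (by simp [hTz]) hq
    simp only [RCLike.inner_apply, Complex.conj_ofReal] at key
    have e1 : ∀ (a : ℝ) (z : ℂ), a • z = z * (a : ℂ) := fun a z => by
      rw [Complex.real_smul, mul_comm]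
    simp only [smul_add]
    rw [integral_add (f := fun t => deriv θ t • p t)
      (g := fun t => deriv θ t • ∫ s in (0 : ℝ)..t, q s) (hp.bdd_smul C hθ'.aestronglyMeasurable (Eventually.of_forall hC))
      (hpi.bdd_smul C hθ'.aestronglyMeasurable (Eventually.of_forall hC)), h θ hθ hθc hθs]
    simp only [e1]
    rw [key, add_neg_cancel]
  filter_upwards [ae_eq_zero_of_weakDeriv_eq_zero hT (hp.add hpi) hr0 hz]
    with t ht using eq_neg_of_add_eq_zero_left ht

/-- A hierarchy of functions, each the weak derivative of the preceding one up to a constant, with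
geometrically growing bounds and vanishing initial values, is zero. -/
theorem ae_eq_zero_of_weakDeriv_hierarchy {T C Λ : ℝ} (hT : 0 < T) (κ : ℂ)
    {p : ℕ → ℝ → ℂ} (hp : ∀ k, IntegrableOn (p k) (Ioo 0 T))
    (hpC : ∀ k, ∀ᵐ t ∂(volume.restrict (Ioo 0 T)), ‖p k t‖ ≤ C * Λ ^ k)
    (hp0 : ∀ k, Tendsto (p k) (𝓝[>] 0) (𝓝 0))
    (h : ∀ k, ∀ θ : ℝ → ℝ, ContDiff ℝ (⊤ : ℕ∞) θ → HasCompactSupport θ → tsupport θ ⊆ Ioo 0 T →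
      ∫ t in Ioo 0 T, deriv θ t • p k t = κ * ∫ t in Ioo 0 T, θ t • p (k + 1) t) :
    ∀ᵐ t ∂(volume.restrict (Ioo 0 T)), p 0 t = 0 := by
  have hrep : ∀ k, ∀ᵐ t ∂(volume.restrict (Ioo 0 T)),
      p k t = -∫ s in (0 : ℝ)..t, κ * p (k + 1) s := fun k =>
    ae_eq_integral_of_weakDeriv hT (hp k) ((hp (k + 1)).const_mul κ) (hp0 k)
      fun θ hθ hθc hθs => by
        rw [h k θ hθ hθc hθs, ← integral_const_mul]
        simp only [mul_smul_comm]
  -- Integrating `m` times gains `t ^ m / m!`. The bound for `k` at stage `m + 1` uses the one for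
  -- `k + 1` at stage `m`, so the induction is over all `k` at once.
  have hbound : ∀ m k, ∀ᵐ t ∂(volume.restrict (Ioo 0 T)),
      ‖p k t‖ ≤ C * Λ ^ k * ((‖κ‖ * Λ) ^ m * (t ^ m / m.factorial)) := by
    intro m
    induction m with
    | zero => simpa using hpC
    | succ m ih =>
      intro k
      filter_upwards [hrep k, ae_restrict_mem measurableSet_Ioo] with t ht htT
      rw [ht, norm_neg]
      have hb : ∀ᵐ s, s ∈ Ioc 0 t → ‖κ * p (k + 1) s‖ ≤
          ‖κ‖ * (C * Λ ^ (k + 1) * ((‖κ‖ * Λ) ^ m * (s ^ m / m.factorial))) := by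
        have h1 := (ae_restrict_iff' measurableSet_Ioo).1 (ih (k + 1))
        filter_upwards [h1] with s hs hst
        rw [norm_mul]
        gcongr
        exact hs ⟨hst.1, hst.2.trans_lt htT.2⟩
      refine (intervalIntegral.norm_integral_le_of_norm_le htT.1.le hb
        (Continuous.intervalIntegrable (by fun_prop) _ _)).trans (le_of_eq ?_)
      rw [intervalIntegral.integral_const_mul, intervalIntegral.integral_const_mul,
        intervalIntegral.integral_const_mul, intervalIntegral.integral_div, integral_pow,
        Nat.factorial_succ]
      have : (m.factorial : ℝ) ≠ 0 := by positivity
      push_cast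
      field_simp
      ring
  filter_upwards [ae_all_iff.2 fun m => hbound m 0] with t ht
  rw [← norm_le_zero_iff]
  have hlim : Tendsto (fun m : ℕ => C * Λ ^ 0 * ((‖κ‖ * Λ) ^ m * (t ^ m / m.factorial)))
      atTop (𝓝 0) := by
    have := (FloorSemiring.tendsto_pow_div_factorial_atTop (‖κ‖ * Λ * t)).const_mul (C * Λ ^ 0)
    rw [mul_zero] at this
    refine this.congr fun m => ?_
    rw [mul_pow]
    ring
  exact ge_of_tendsto' hlim ht

end WeakDerivative

/-! ### Approximation of Schwartz functions by test functions. -/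

section Cutoff

variable {n : ℕ}

theorem norm_laplacian_le (f : Space n → ℂ) (x : Space n) :
    ‖Laplacian.laplacian f x‖ ≤ n * ‖iteratedFDeriv ℝ 2 f x‖ := by
  rw [InnerProductSpace.laplacian_eq_iteratedFDeriv_orthonormalBasis f
    (EuclideanSpace.basisFun (Fin n) ℝ)]
  refine (norm_sum_le_of_le _ (n := fun _ => ‖iteratedFDeriv ℝ 2 f x‖) fun i _ => ?_).trans
    (by simp)
  refine (ContinuousMultilinearMap.le_opNorm _ _).trans ?_
  simp

theorem memLp_iteratedFDeriv_schwartz (ψ : 𝓢(Space n, ℂ)) {i : ℕ} (hi : i ≤ 2) :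
    MemLp (fun x => ‖iteratedFDeriv ℝ i ψ x‖) 2 (volume : Measure (Space n)) := by
  interval_cases i
  · simpa only [norm_iteratedFDeriv_zero] using (ψ.memLp 2 volume).norm
  · have h := ((SchwartzMap.fderivCLM ℝ (Space n) ℂ ψ).memLp 2 volume).norm
    simp only [norm_iteratedFDeriv_one]
    exact h
  · have h := ((SchwartzMap.fderivCLM ℝ (Space n) _
      (SchwartzMap.fderivCLM ℝ (Space n) ℂ ψ)).memLp 2 volume).norm
    refine h.congr_norm ?_ (Eventually.of_forall fun x => ?_)
    · exact ((ψ.smooth 2).continuous_iteratedFDeriv le_rfl).norm.aestronglyMeasurable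
    · rw [norm_norm, norm_norm, ← norm_iteratedFDeriv_fderiv, norm_iteratedFDeriv_one]
      rfl

/-- Cutting off a Schwartz function, with bounds and pointwise convergence up to the second
derivatives. -/
theorem exists_cutoff_schwartz (ψ : 𝓢(Space n, ℂ)) :
    ∃ χ : ℕ → Space n → ℂ, (∀ k, ContDiff ℝ (⊤ : ℕ∞) (χ k)) ∧ (∀ k, HasCompactSupport (χ k)) ∧
      (∀ x, ∀ᶠ k in atTop, χ k =ᶠ[𝓝 x] ψ) ∧
      ∃ b : Space n → ℝ, MemLp b 2 volume ∧ (∀ k x, ‖χ k x‖ ≤ b x) ∧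
        ∀ k x, ‖Laplacian.laplacian (χ k) x‖ ≤ b x := by
  let β : ContDiffBump (0 : Space n) := ⟨1, 2, one_pos, one_lt_two⟩
  let βc : Space n → ℂ := fun x => (β x : ℂ)
  have hβ : ContDiff ℝ (⊤ : ℕ∞) βc := Complex.ofRealCLM.contDiff.comp β.contDiff
  have hβs : HasCompactSupport βc := β.hasCompactSupport.comp_left (g := Complex.ofReal) rfl
  have hbd : ∀ i : ℕ, ∃ C, ∀ x, ‖iteratedFDeriv ℝ i βc x‖ ≤ C := fun i =>
    (hβ.continuous_iteratedFDeriv (by exact_mod_cast le_top)).bounded_above_of_compact_support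
      (hβs.iteratedFDeriv i)
  choose C hC using hbd
  have hC0 : ∀ i, 0 ≤ C i := fun i => (norm_nonneg _).trans (hC i 0)
  -- Scales at most one do not enlarge the derivatives of the cut-off, which equals 1 on the ball of
  -- radius `k + 1`.
  let r : ℕ → ℝ := fun k => ((k : ℝ) + 1)⁻¹
  have hr0 : ∀ k, 0 < r k := fun k => by positivity
  have hr1 : ∀ k, r k ≤ 1 := fun k => inv_le_one_of_one_le₀ (by simp)
  have hβr : ∀ k, ContDiff ℝ (⊤ : ℕ∞) fun x => βc (r k • x) := fun k =>
    hβ.comp (contDiff_const_smul (r k))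
  have hbr : ∀ k i x, ‖iteratedFDeriv ℝ i (fun x => βc (r k • x)) x‖ ≤ C i := by
    intro k i x
    rw [iteratedFDeriv_comp_const_smul (r k) (contDiff_infty.1 hβ i), norm_smul, norm_pow,
      Real.norm_of_nonneg (hr0 k).le]
    calc r k ^ i * ‖iteratedFDeriv ℝ i βc (r k • x)‖ ≤ 1 * C i := by
          gcongr
          · exact pow_le_one₀ (hr0 k).le (hr1 k)
          · exact hC i _
      _ = C i := one_mul _
  let s : ℕ → Space n → ℝ := fun i x => ‖iteratedFDeriv ℝ i ψ x‖
  refine ⟨fun k x => βc (r k • x) * ψ x, fun k => (hβr k).mul (ψ.smooth _), fun k => ?_,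
    -- One dominating function for both bounds: the first summand for the function, the second from
    -- the Leibniz formula for its second derivative.
    fun x => ?_, fun x => C 0 * s 0 x +
      n * ∑ i ∈ Finset.range 3, ((Nat.choose 2 i : ℝ) * C i) * s (2 - i) x, ?_,
    fun k x => ?_, fun k x => ?_⟩
  · exact (hβs.comp_smul (hr0 k).ne').mul_right
  · obtain ⟨N, hN⟩ := exists_nat_gt ‖x‖
    filter_upwards [eventually_ge_atTop N] with k hk
    have hlt : ‖x‖ < (k : ℝ) + 1 := hN.trans_le (by
      have : (N : ℝ) ≤ k := by exact_mod_cast hk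
      linarith)
    have hev : ∀ᶠ y in 𝓝 x, ‖y‖ < (k : ℝ) + 1 :=
      (continuous_norm.tendsto x).eventually (gt_mem_nhds hlt)
    filter_upwards [hev] with y hy
    have h1 : β (r k • y) = 1 := by
      refine β.one_of_mem_closedBall ?_
      rw [mem_closedBall_zero_iff, norm_smul, Real.norm_of_nonneg (hr0 k).le]
      change ((k : ℝ) + 1)⁻¹ * ‖y‖ ≤ 1
      rw [inv_mul_le_iff₀ (by positivity), mul_one]
      exact hy.le
    simp [βc, h1]
  · have hs : ∀ i ≤ 2, MemLp (s i) 2 volume := fun i hi => memLp_iteratedFDeriv_schwartz ψ hi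
    have h1 : MemLp (fun x => C 0 * s 0 x) 2 volume := (hs 0 (Nat.zero_le 2)).const_mul (C 0)
    have h2 : MemLp (fun x => ∑ i ∈ Finset.range 3, ((Nat.choose 2 i : ℝ) * C i) * s (2 - i) x) 2
        volume :=
      memLp_finsetSum (Finset.range 3) fun i _ => (hs _ (Nat.sub_le 2 i)).const_mul _
    exact h1.add (h2.const_mul (n : ℝ))
  · have h0 : ‖βc (r k • x)‖ ≤ C 0 := by
      simpa only [norm_iteratedFDeriv_zero] using hC 0 (r k • x)
    have h2 : 0 ≤ (n : ℝ) *
        ∑ i ∈ Finset.range 3, ((Nat.choose 2 i : ℝ) * C i) * s (2 - i) x := by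
      have h3 : ∀ i, 0 ≤ s i x := fun i => norm_nonneg _
      exact mul_nonneg (Nat.cast_nonneg n) (Finset.sum_nonneg fun i _ =>
        mul_nonneg (mul_nonneg (Nat.cast_nonneg _) (hC0 i)) (h3 _))
    have h3 : s 0 x = ‖ψ x‖ := norm_iteratedFDeriv_zero
    rw [norm_mul]
    beta_reduce
    rw [h3]
    have := mul_le_mul_of_nonneg_right h0 (norm_nonneg (ψ x))
    linarith
  · have h2 : 0 ≤ C 0 * s 0 x := mul_nonneg (hC0 0) (norm_nonneg _)
    have h3 := norm_iteratedFDeriv_mul_le (𝕜 := ℝ) (contDiff_infty.1 (hβr k) 2) (ψ.smooth 2) x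
      (n := 2) le_rfl
    refine (norm_laplacian_le _ x).trans ?_
    refine le_add_of_nonneg_of_le h2 ?_
    gcongr
    refine h3.trans (Finset.sum_le_sum fun i _ => ?_)
    gcongr
    exact hbr k i x

/-- `C_c^∞` is dense in the Schwartz space, for the `L²` graph norm of the Laplacian. -/
theorem exists_tendsto_cutoff_schwartz (ψ : 𝓢(Space n, ℂ)) :
    ∃ (χ : ℕ → Space n → ℂ) (X Y : ℕ → LTwo n), (∀ k, ContDiff ℝ (⊤ : ℕ∞) (χ k)) ∧
      (∀ k, HasCompactSupport (χ k)) ∧ (∀ k, X k =ᵐ[volume] χ k) ∧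
      (∀ k, Y k =ᵐ[volume] Laplacian.laplacian (χ k)) ∧
      Tendsto X atTop (𝓝 (ψ.toLp 2 volume)) ∧
      Tendsto Y atTop (𝓝 ((Laplacian.laplacian ψ : 𝓢(Space n, ℂ)).toLp 2 volume)) := by
  obtain ⟨χ, hχ, hχc, hlim, b, hb, hb1, hb2⟩ := exists_cutoff_schwartz ψ
  have hm1 : ∀ k, MemLp (χ k) 2 volume := fun k =>
    hb.of_le (hχ k).continuous.aestronglyMeasurable
      (Eventually.of_forall fun x => (hb1 k x).trans (le_abs_self _))
  have hcont : ∀ k, Continuous (Laplacian.laplacian (χ k)) := fun k =>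
    (continuous_spaceLaplacian (Ψ := fun p => χ k p.1) ((hχ k).comp contDiff_fst)).comp
      (f := fun x => (x, (0 : ℝ))) (by fun_prop)
  have hm2 : ∀ k, MemLp (Laplacian.laplacian (χ k)) 2 volume := fun k =>
    hb.of_le (hcont k).aestronglyMeasurable
      (Eventually.of_forall fun x => (hb2 k x).trans (le_abs_self _))
  refine ⟨χ, fun k => (hm1 k).toLp _, fun k => (hm2 k).toLp _, hχ, hχc,
    fun k => (hm1 k).coeFn_toLp, fun k => (hm2 k).coeFn_toLp, ?_, ?_⟩
  · refine tendsto_lpTwo_of_dominated (F := χ) hb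
      (Eventually.of_forall fun k => (hm1 k).coeFn_toLp) (ψ.coeFn_toLp 2 volume)
      (Eventually.of_forall fun k => Eventually.of_forall fun x => hb1 k x)
      (Eventually.of_forall fun x => tendsto_const_nhds.congr' ?_)
    filter_upwards [hlim x] with k hk using hk.eq_of_nhds.symm
  · refine tendsto_lpTwo_of_dominated (F := fun k => Laplacian.laplacian (χ k)) hb
      (Eventually.of_forall fun k => (hm2 k).coeFn_toLp)
      ((Laplacian.laplacian ψ : 𝓢(Space n, ℂ)).coeFn_toLp 2 volume)
      (Eventually.of_forall fun k => Eventually.of_forall fun x => hb2 k x)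
      (Eventually.of_forall fun x => tendsto_const_nhds.congr' ?_)
    filter_upwards [hlim x] with k hk
    rw [SchwartzMap.laplacian_apply]
    exact (InnerProductSpace.laplacian_congr_nhds hk).eq_of_nhds.symm

end Cutoff

/-! ### Test functions that are products in time and space. -/

section Separated

variable {n : ℕ} {χ : Space n → ℂ} {θ : ℝ → ℝ}

theorem contDiff_separated (hχ : ContDiff ℝ (⊤ : ℕ∞) χ) (hθ : ContDiff ℝ (⊤ : ℕ∞) θ) :
    ContDiff ℝ (⊤ : ℕ∞) (Function.uncurry fun x t => (θ t : ℂ) * conj (χ x)) :=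
  (Complex.ofRealCLM.contDiff.comp (hθ.comp contDiff_snd)).mul
    (Complex.conjCLE.contDiff.comp (hχ.comp contDiff_fst))

theorem support_separated_subset : Function.support
    (Function.uncurry fun (x : Space n) (t : ℝ) => (θ t : ℂ) * conj (χ x)) ⊆
      tsupport χ ×ˢ tsupport θ := by
  rintro ⟨x, t⟩ h
  have h' : (θ t : ℂ) * conj (χ x) ≠ 0 := h
  refine ⟨subset_tsupport _ fun h0 => h' ?_, subset_tsupport _ fun h0 => h' ?_⟩
  · rw [h0, map_zero, mul_zero]
  · rw [h0, Complex.ofReal_zero, zero_mul]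

theorem hasCompactSupport_separated (hχ : HasCompactSupport χ) (hθ : HasCompactSupport θ) :
    HasCompactSupport (Function.uncurry fun x t => (θ t : ℂ) * conj (χ x)) :=
  HasCompactSupport.of_support_subset_isCompact (hχ.isCompact.prod hθ.isCompact)
    support_separated_subset

theorem tsupport_separated_subset {S : Set ℝ} (hθ : tsupport θ ⊆ S) :
    tsupport (Function.uncurry fun x t => (θ t : ℂ) * conj (χ x)) ⊆ univ ×ˢ S :=
  (closure_minimal support_separated_subset
    ((isClosed_tsupport χ).prod (isClosed_tsupport θ))).trans (prod_mono (subset_univ _) hθ)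

theorem integral_mul_separated (hχ : ContDiff ℝ (⊤ : ℕ∞) χ)
    (hθ : Differentiable ℝ θ) {X Y : LTwo n} (hX : X =ᵐ[volume] χ)
    (hY : Y =ᵐ[volume] Laplacian.laplacian χ) (a b : ℝ) (t : ℝ) (w : LTwo n) :
    ∫ x, w x * ((a : ℂ) * Laplacian.laplacian (fun z => (θ t : ℂ) * conj (χ z)) x -
        Complex.I * b * deriv (fun s => (θ s : ℂ) * conj (χ x)) t) =
      a * (θ t • inner ℂ Y w) - Complex.I * b * (deriv θ t • inner ℂ X w) := by
  have h1 : (a : ℂ) * (θ t • inner ℂ Y w) - Complex.I * b * (deriv θ t • inner ℂ X w) =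
      inner ℂ (((a * θ t : ℝ) : ℂ) • Y + (Complex.I * ((b * deriv θ t : ℝ) : ℂ)) • X) w := by
    rw [inner_add_left, inner_smul_left, inner_smul_left, map_mul, Complex.conj_I,
      Complex.conj_ofReal, Complex.conj_ofReal, Complex.real_smul, Complex.real_smul]
    push_cast
    ring
  rw [h1, L2.inner_def]
  refine integral_congr_ae ?_
  filter_upwards [Lp.coeFn_add (((a * θ t : ℝ) : ℂ) • Y)
      ((Complex.I * ((b * deriv θ t : ℝ) : ℂ)) • X),
    Lp.coeFn_smul ((a * θ t : ℝ) : ℂ) Y,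
    Lp.coeFn_smul (Complex.I * ((b * deriv θ t : ℝ) : ℂ)) X, hX, hY] with x e1 e2 e3 e4 e5
  rw [RCLike.inner_apply, e1, Pi.add_apply, e2, e3, Pi.smul_apply, Pi.smul_apply, e4, e5]
  have hlap : Laplacian.laplacian (fun z => (θ t : ℂ) * conj (χ z)) x =
      θ t * conj (Laplacian.laplacian χ x) := by
    have hc : ContDiffAt ℝ 2 (fun z => conj (χ z)) x :=
      (Complex.conjCLE.contDiff.comp (contDiff_infty.1 hχ 2)).contDiffAt
    have h2 := InnerProductSpace.laplacian_smul (θ t) hc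
    have h3 : Laplacian.laplacian (fun z => conj (χ z)) x = conj (Laplacian.laplacian χ x) :=
      ((contDiff_infty.1 hχ 2).contDiffAt).laplacian_CLM_comp_left
        (l := (Complex.conjCLE : ℂ →L[ℝ] ℂ))
    rw [h3, Complex.real_smul] at h2
    rw [← h2]
    congr 1
  have hder : deriv (fun s => (θ s : ℂ) * conj (χ x)) t = deriv θ t * conj (χ x) :=
    ((hθ t).hasDerivAt.ofReal_comp.mul_const _).deriv
  rw [hlap, hder]
  simp only [smul_eq_mul, map_add, map_mul, Complex.conj_I, Complex.conj_ofReal]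
  push_cast
  ring

end Separated

/-! ### The homogeneous weak equation for the difference of two solutions. -/

section Difference

variable {n : ℕ} {ħ m T : ℝ} {B : Type*} [NormedAddCommGroup B] [NormedSpace ℂ B]
  {j : B →L[ℂ] LTwo n} {f : B} {F u v : ℝ → B}

theorem inner_smul_real_lpTwo (X Y : LTwo n) (r : ℝ) : inner ℂ X (r • Y) = r • inner ℂ X Y :=
  ((innerSL ℂ X).toLinearMap.map_smul_of_tower r Y)

theorem integrableOn_smul_lpTwo {θ : ℝ → ℝ} (hθ : Continuous θ) (hθc : HasCompactSupport θ)
    {y : ℝ → LTwo n} (hy : IntegrableOn y (Ioo 0 T)) :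
    IntegrableOn (fun t => θ t • y t) (Ioo 0 T) := by
  obtain ⟨C, hC⟩ := hθ.bounded_above_of_compact_support hθc
  exact hy.bdd_smul C hθ.aestronglyMeasurable (Eventually.of_forall hC)

theorem IsSolution.integrableOn (hu : IsSolution ħ m T j f F u) :
    IntegrableOn (fun t => j (u t)) (Ioo 0 T) := by
  have h1 : Integrable u (volume.restrict (Ioo 0 T)) := hu.memLp.integrable le_top
  exact j.integrable_comp h1

/-- Product test functions reduce the weak equation to time averages of `u` paired with `χ` and its
Laplacian. The right side does not involve `u`, so it cancels in the difference of two solutions. -/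
theorem IsSolution.inner_eq (hu : IsSolution ħ m T j f F u) {χ : Space n → ℂ}
    (hχ : ContDiff ℝ (⊤ : ℕ∞) χ) (hχc : HasCompactSupport χ) {X Y : LTwo n}
    (hX : X =ᵐ[volume] χ) (hY : Y =ᵐ[volume] Laplacian.laplacian χ)
    {θ : ℝ → ℝ} (hθ : ContDiff ℝ (⊤ : ℕ∞) θ) (hθc : HasCompactSupport θ)
    (hθs : tsupport θ ⊆ Ioo 0 T) :
    ((ħ ^ 2 / (2 * m) : ℝ) : ℂ) * inner ℂ Y (∫ t in Ioo 0 T, θ t • j (u t)) -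
        Complex.I * ħ * inner ℂ X (∫ t in Ioo 0 T, deriv θ t • j (u t)) =
      ∫ t in Ioo 0 T, ∫ x, j (F t) x * ((θ t : ℂ) * conj (χ x)) := by
  have h1 := integrableOn_smul_lpTwo hθ.continuous hθc hu.integrableOn
  have h2 := integrableOn_smul_lpTwo (hθ.continuous_deriv (by simp)) hθc.deriv hu.integrableOn
  rw [← hu.equation _ (contDiff_separated hχ hθ) (hasCompactSupport_separated hχc hθc)
    (tsupport_separated_subset hθs), ← integral_inner h1, ← integral_inner h2,
    ← integral_const_mul, ← integral_const_mul,
    ← integral_sub ((h1.const_inner Y).const_mul _) ((h2.const_inner X).const_mul _)]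
  refine integral_congr_ae (Eventually.of_forall fun t => ?_)
  beta_reduce
  rw [integral_mul_separated hχ (hθ.differentiable (by simp)) hX hY]
  rw [inner_smul_real_lpTwo, inner_smul_real_lpTwo]

/-- The weak equation for the difference of two solutions, tested with Schwartz functions. -/
theorem IsSolution.inner_sub_eq (hu : IsSolution ħ m T j f F u) (hv : IsSolution ħ m T j f F v)
    (ψ : 𝓢(Space n, ℂ))
    {θ : ℝ → ℝ} (hθ : ContDiff ℝ (⊤ : ℕ∞) θ) (hθc : HasCompactSupport θ)
    (hθs : tsupport θ ⊆ Ioo 0 T) :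
    ((ħ ^ 2 / (2 * m) : ℝ) : ℂ) * inner ℂ ((Laplacian.laplacian ψ : 𝓢(Space n, ℂ)).toLp 2 volume)
        (∫ t in Ioo 0 T, θ t • (j (v t) - j (u t))) =
      Complex.I * ħ * inner ℂ (ψ.toLp 2 volume)
        (∫ t in Ioo 0 T, deriv θ t • (j (v t) - j (u t))) := by
  obtain ⟨χ, X, Y, hχ, hχc, hX, hY, hXl, hYl⟩ := exists_tendsto_cutoff_schwartz ψ
  refine tendsto_nhds_unique ((hYl.inner tendsto_const_nhds).const_mul _)
    (((hXl.inner tendsto_const_nhds).const_mul _).congr fun k => ?_)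
  have e1 := hu.inner_eq (hχ k) (hχc k) (hX k) (hY k) hθ hθc hθs
  have e2 := hv.inner_eq (hχ k) (hχc k) (hX k) (hY k) hθ hθc hθs
  have hθ' := hθ.continuous_deriv (by simp)
  simp only [smul_sub]
  rw [integral_sub (integrableOn_smul_lpTwo hθ' hθc.deriv hv.integrableOn)
      (integrableOn_smul_lpTwo hθ' hθc.deriv hu.integrableOn),
    integral_sub (integrableOn_smul_lpTwo hθ.continuous hθc hv.integrableOn)
      (integrableOn_smul_lpTwo hθ.continuous hθc hu.integrableOn), inner_sub_right,
    inner_sub_right]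
  linear_combination e1 - e2

end Difference

/-! ### The weak equation on the Fourier side and band-limited functions. -/

section FrequencySide

variable {n : ℕ}

/-- A weak identity between `Δ A` and `B`, on the Fourier side. -/
theorem fourier_ae_eq_of_inner_laplacian_eq {A B : LTwo n} {a b : ℂ}
    (h : ∀ ψ : 𝓢(Space n, ℂ),
      a * inner ℂ ((Laplacian.laplacian ψ : 𝓢(Space n, ℂ)).toLp 2 volume) A =
        b * inner ℂ (ψ.toLp 2 volume) B) :
    ∀ᵐ ξ, a * (-(4 * Real.pi ^ 2) * (‖ξ‖ : ℂ) ^ 2) * (𝓕 A : LTwo n) ξ = b * (𝓕 B : LTwo n) ξ := by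
  have hA : LocallyIntegrable (𝓕 A : LTwo n) volume :=
    (Lp.memLp (𝓕 A : LTwo n)).locallyIntegrable (by norm_num)
  have hB : LocallyIntegrable (𝓕 B : LTwo n) volume :=
    (Lp.memLp (𝓕 B : LTwo n)).locallyIntegrable (by norm_num)
  have hmulA : LocallyIntegrable
      (fun ξ => a * (-(4 * Real.pi ^ 2) * (‖ξ‖ : ℂ) ^ 2) * (𝓕 A : LTwo n) ξ) volume := by
    rw [locallyIntegrable_iff]
    intro K hK
    exact (hA.integrableOn_isCompact hK).continuousOn_mul
      (by fun_prop : Continuous fun ξ : Space n =>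
        a * (-(4 * Real.pi ^ 2) * (‖ξ‖ : ℂ) ^ 2)).continuousOn hK
  have hmulB : LocallyIntegrable (fun ξ => b * (𝓕 B : LTwo n) ξ) volume := by
    rw [locallyIntegrable_iff]
    intro K hK
    exact (hB.integrableOn_isCompact hK).const_mul b
  refine ae_eq_of_integral_contDiff_smul_eq hmulA hmulB fun g hg hgc => ?_
  have hgs : HasCompactSupport fun x => (g x : ℂ) := hgc.comp_left (g := Complex.ofReal) rfl
  set γ : 𝓢(Space n, ℂ) := hgs.toSchwartzMap (Complex.ofRealCLM.contDiff.comp hg) with hγ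
  have hγv : ∀ x, γ x = (g x : ℂ) := fun x => rfl
  -- Testing at the frequencies where `γ` lives requires `𝓕⁻ γ`, which is Schwartz but in general
  -- not compactly supported.
  have key := h (𝓕⁻ γ)
  rw [← Lp.inner_fourier_eq _ A, ← Lp.inner_fourier_eq _ B, SchwartzMap.toLp_fourier_eq (𝓕⁻ γ),
    FourierTransform.fourier_fourierInv_eq, L2.inner_def, L2.inner_def, ← integral_const_mul,
    ← integral_const_mul] at key
  refine Eq.trans (integral_congr_ae ?_) (key.trans (integral_congr_ae ?_))
  · filter_upwards [fourier_laplacian_schwartz_ae_eq (𝓕⁻ γ)] with ξ h1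
    rw [h1, FourierTransform.fourier_fourierInv_eq, hγv, RCLike.inner_apply, Complex.real_smul]
    simp only [map_mul, map_neg, map_pow, Complex.conj_ofReal, map_ofNat]
    ring
  · filter_upwards [γ.coeFn_toLp 2 volume] with ξ h1
    rw [h1, hγv, RCLike.inner_apply, Complex.real_smul, Complex.conj_ofReal]
    ring

theorem norm_indicator_pow_mul_le (R : ℝ) (k : ℕ) (g : Space n → ℂ) (ξ : Space n) :
    ‖(Metric.ball (0 : Space n) R).indicator
      (fun ξ => ((4 * Real.pi ^ 2) * (‖ξ‖ : ℂ) ^ 2) ^ k * g ξ) ξ‖ ≤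
      (4 * Real.pi ^ 2 * R ^ 2) ^ k * ‖g ξ‖ := by
  by_cases h : ξ ∈ Metric.ball (0 : Space n) R
  · rw [indicator_of_mem h, norm_mul, norm_pow]
    have h1 : ‖(4 * (Real.pi : ℂ) ^ 2) * (‖ξ‖ : ℂ) ^ 2‖ = 4 * Real.pi ^ 2 * ‖ξ‖ ^ 2 := by
      simp [abs_of_nonneg Real.pi_nonneg]
    rw [h1]
    have h2 := (mem_ball_zero_iff.1 h).le
    gcongr
  · rw [indicator_of_notMem h, norm_zero]
    positivity

theorem memLp_indicator_pow_mul (R : ℝ) (k : ℕ) (g : LTwo n) :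
    MemLp ((Metric.ball (0 : Space n) R).indicator
      fun ξ => ((4 * Real.pi ^ 2) * (‖ξ‖ : ℂ) ^ 2) ^ k * g ξ) 2 volume :=
  (Lp.memLp g).of_le_mul
    (((by fun_prop : Continuous fun ξ : Space n =>
      ((4 * (Real.pi : ℂ) ^ 2) * (‖ξ‖ : ℂ) ^ 2) ^ k).aestronglyMeasurable.mul
      (Lp.aestronglyMeasurable g)).indicator measurableSet_ball)
    (Eventually.of_forall fun ξ => norm_indicator_pow_mul_le R k g ξ)

/-- The function `(4π²|ξ|²)ᵏ g`, cut off to a ball. -/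
noncomputable def bandPower (R : ℝ) (k : ℕ) (g : LTwo n) : LTwo n :=
  (memLp_indicator_pow_mul R k g).toLp _

theorem bandPower_coe (R : ℝ) (k : ℕ) (g : LTwo n) : bandPower R k g =ᵐ[volume]
    (Metric.ball (0 : Space n) R).indicator
      fun ξ => ((4 * Real.pi ^ 2) * (‖ξ‖ : ℂ) ^ 2) ^ k * g ξ :=
  MemLp.coeFn_toLp _

theorem norm_bandPower_le (R : ℝ) (k : ℕ) (g : LTwo n) :
    ‖bandPower R k g‖ ≤ (4 * Real.pi ^ 2 * R ^ 2) ^ k * ‖g‖ := by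
  refine Lp.norm_le_mul_norm_of_ae_le_mul ?_
  filter_upwards [bandPower_coe R k g] with ξ h
  rw [h]
  exact norm_indicator_pow_mul_le R k g ξ

theorem tendsto_bandPower_zero (g : LTwo n) :
    Tendsto (fun R : ℕ => bandPower R 0 g) atTop (𝓝 g) := by
  refine tendsto_lpTwo_of_dominated (f := g) (Lp.memLp g).norm
    (Eventually.of_forall fun R => bandPower_coe R 0 g) EventuallyEq.rfl
    (Eventually.of_forall fun R => Eventually.of_forall fun ξ => ?_)
    (Eventually.of_forall fun ξ => tendsto_const_nhds.congr' ?_)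
  · simpa using norm_indicator_pow_mul_le R 0 g ξ
  · obtain ⟨N, hN⟩ := exists_nat_gt ‖ξ‖
    filter_upwards [eventually_ge_atTop N] with R hR
    have : ξ ∈ Metric.ball (0 : Space n) R :=
      mem_ball_zero_iff.2 (hN.trans_le (by exact_mod_cast hR))
    rw [indicator_of_mem this, pow_zero, one_mul]

/-- The real factor `4π²|ξ|²` moves across the inner product and raises `k` by one: this produces
the hierarchy. -/
theorem inner_bandPower_eq {A B : LTwo n} {κ : ℂ}
    (h : ∀ᵐ ξ, κ * ((4 * Real.pi ^ 2) * (‖ξ‖ : ℂ) ^ 2) * A ξ = B ξ) (R : ℝ) (k : ℕ) (g : LTwo n) :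
    inner ℂ (bandPower R k g) B = κ * inner ℂ (bandPower R (k + 1) g) A := by
  rw [L2.inner_def, L2.inner_def, ← integral_const_mul]
  refine integral_congr_ae ?_
  filter_upwards [h, bandPower_coe R k g, bandPower_coe R (k + 1) g] with ξ h1 h2 h3
  rw [RCLike.inner_apply, RCLike.inner_apply, h2, h3, ← h1]
  by_cases hξ : ξ ∈ Metric.ball (0 : Space n) R
  · rw [indicator_of_mem hξ, indicator_of_mem hξ]
    simp only [map_mul, map_pow, Complex.conj_ofReal, map_ofNat]
    ring
  · rw [indicator_of_notMem hξ, indicator_of_notMem hξ]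
    simp

end FrequencySide

/-! ### Uniqueness of weak solutions. -/

section Uniqueness

variable {n : ℕ} {T C : ℝ}

/-- A bounded curve in `L²` solving the free equation weakly, with vanishing initial value,
vanishes. -/
theorem ae_eq_zero_of_weak_schrodinger (hT : 0 < T) {w : ℝ → LTwo n}
    (hw : IntegrableOn w (Ioo 0 T)) (hwC : ∀ᵐ t ∂(volume.restrict (Ioo 0 T)), ‖w t‖ ≤ C)
    (hw0 : Tendsto w (𝓝[>] 0) (𝓝 0)) {a b : ℂ} (hb : b ≠ 0)
    (h : ∀ θ : ℝ → ℝ, ContDiff ℝ (⊤ : ℕ∞) θ → HasCompactSupport θ → tsupport θ ⊆ Ioo 0 T →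
      ∀ ψ : 𝓢(Space n, ℂ),
      a * inner ℂ ((Laplacian.laplacian ψ : 𝓢(Space n, ℂ)).toLp 2 volume)
        (∫ t in Ioo 0 T, θ t • w t) =
      b * inner ℂ (ψ.toLp 2 volume) (∫ t in Ioo 0 T, deriv θ t • w t)) :
    w =ᵐ[volume.restrict (Ioo 0 T)] 0 := by
  have hinv : ∀ g x : LTwo n, inner ℂ (𝓕⁻ g : LTwo n) x = inner ℂ g (𝓕 x : LTwo n) := fun g x => by
    rw [← Lp.inner_fourier_eq, FourierTransform.fourier_fourierInv_eq]
  have hband : ∀ (R : ℕ) (g : LTwo n), ∀ᵐ t ∂(volume.restrict (Ioo 0 T)),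
      inner ℂ (𝓕⁻ (bandPower R 0 g) : LTwo n) (w t) = 0 := by
    intro R g
    -- `Λ` is the supremum of the symbol on the ball of radius `R`; the sign in `-(a / b)` is that
    -- of the symbol of the Laplacian.
    refine ae_eq_zero_of_weakDeriv_hierarchy (C := ‖g‖ * C) (Λ := 4 * Real.pi ^ 2 * (R : ℝ) ^ 2)
      hT (-(a / b)) (p := fun k t => inner ℂ (𝓕⁻ (bandPower R k g) : LTwo n) (w t))
      (fun k => hw.const_inner _) (fun k => ?_) (fun k => ?_) fun k θ hθ hθc hθs => ?_
    · filter_upwards [hwC] with t ht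
      have h1 : ‖(𝓕⁻ (bandPower R k g) : LTwo n)‖ = ‖bandPower R k g‖ :=
        (Lp.fourierTransformₗᵢ (Space n) ℂ).symm.norm_map _
      calc _ ≤ ‖(𝓕⁻ (bandPower R k g) : LTwo n)‖ * ‖w t‖ := norm_inner_le_norm _ _
        _ ≤ ((4 * Real.pi ^ 2 * (R : ℝ) ^ 2) ^ k * ‖g‖) * C := by
            rw [h1]
            gcongr
            exact norm_bandPower_le R k g
        _ = _ := by ring
    · have := (tendsto_const_nhds (x := (𝓕⁻ (bandPower R k g) : LTwo n))).inner (𝕜 := ℂ) hw0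
      rwa [inner_zero_right] at this
    · simp only [← inner_smul_real_lpTwo]
      rw [integral_inner (integrableOn_smul_lpTwo (hθ.continuous_deriv (by simp)) hθc.deriv hw),
        integral_inner (integrableOn_smul_lpTwo hθ.continuous hθc hw), hinv, hinv]
      refine inner_bandPower_eq ?_ _ _ _
      filter_upwards [fourier_ae_eq_of_inner_laplacian_eq (h θ hθ hθc hθs)] with ξ hξ
      rw [← mul_right_inj' hb, ← hξ]
      field_simp
  -- The finite exponent makes L² separable, so countably many pairings detect the vanishing of `w`.
  have : Fact ((2 : ENNReal) ≠ ⊤) := ⟨by norm_num⟩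
  refine ae_eq_zero_of_forall_inner (𝕜 := ℂ) fun g => ?_
  filter_upwards [ae_all_iff.2 fun R : ℕ => hband R (𝓕 g)] with t ht
  have hlim : Tendsto (fun R : ℕ => inner ℂ (𝓕⁻ (bandPower R 0 (𝓕 g)) : LTwo n) (w t)) atTop
      (𝓝 (inner ℂ g (w t))) := by
    have h1 := ((Lp.fourierTransformₗᵢ (Space n) ℂ).symm.continuous.tendsto (𝓕 g : LTwo n)).comp
      (tendsto_bandPower_zero (𝓕 g : LTwo n))
    have h2 : (Lp.fourierTransformₗᵢ (Space n) ℂ).symm (𝓕 g : LTwo n) = g :=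
      (Lp.fourierTransformₗᵢ (Space n) ℂ).symm_apply_apply g
    rw [h2] at h1
    exact h1.inner tendsto_const_nhds
  simp only [ht] at hlim
  exact tendsto_nhds_unique hlim tendsto_const_nhds

variable {ħ m : ℝ} {B : Type*} [NormedAddCommGroup B] [NormedSpace ℂ B]
  {j : B →L[ℂ] LTwo n} {f : B} {F u v : ℝ → B}

/-- Weak solutions are unique. -/
theorem IsSolution.ae_eq (hj : Function.Injective j) (hħ : 0 < ħ) (hT : 0 < T)
    (hv : IsSolution ħ m T j f F v) (hu : IsSolution ħ m T j f F u) :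
    v =ᵐ[volume.restrict (Ioo 0 T)] u := by
  have hb : Complex.I * (ħ : ℂ) ≠ 0 :=
    mul_ne_zero Complex.I_ne_zero (by exact_mod_cast hħ.ne')
  have hmem := hv.memLp.sub hu.memLp
  have hbound : ∀ᵐ t ∂(volume.restrict (Ioo 0 T)), ‖j (v t) - j (u t)‖ ≤
      ‖j‖ * (eLpNorm (v - u) ⊤ (volume.restrict (Ioo 0 T))).toReal := by
    filter_upwards [ae_norm_le_of_eLpNorm_top_le (F := v - u) (ξ := fun t => ‖(v - u) t‖)
      ENNReal.toReal_nonneg (Eventually.of_forall fun t => le_rfl)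
      (by rw [ENNReal.ofReal_toReal hmem.eLpNorm_ne_top, eLpNorm_norm])] with t ht
    rw [← map_sub]
    exact j.le_opNorm_of_le ht
  have hlim : ∀ {y : ℝ → B}, IsSolution ħ m T j f F y →
      Tendsto (fun t => j (y t)) (𝓝[>] 0) (𝓝 (j f)) := by
    intro y hy
    have h1 := hy.continuous_initial
    rw [ContinuousWithinAt, hy.initial] at h1
    exact (j.continuous.tendsto f).comp (h1.mono_left (nhdsWithin_mono _ Ioi_subset_Ici_self))
  have h0 : Tendsto (fun t => j (v t) - j (u t)) (𝓝[>] 0) (𝓝 0) := by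
    simpa using (hlim hv).sub (hlim hu)
  filter_upwards [ae_eq_zero_of_weak_schrodinger hT (hv.integrableOn.sub hu.integrableOn) hbound h0
    hb fun θ hθ hθc hθs ψ => hu.inner_sub_eq hv ψ hθ hθc hθs] with t ht
  exact hj (sub_eq_zero.1 ht)

end Uniqueness

/-! ### Assembly of the theorem. -/

theorem theorem2 {n : ℕ} (ħ m T M : ℝ) (hħ : 0 < ħ) (hm : 0 < m) (hT : 0 < T) (hM : 0 < M)
    -- the Banach space of functions on which the free propagators act
    {B : Type*} [NormedAddCommGroup B] [NormedSpace ℂ B] [CompleteSpace B]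
    (j : B →L[ℂ] LTwo n) (hj : Function.Injective j)
    (U : ℝ → B →L[ℂ] B) (hU : IsFreePropagator ħ m j U)
    -- the initial value
    (f : Space n → ℂ) (hf : Integrable fun y => ((1 + ‖y‖ ^ 2 : ℝ) : ℂ) * f y)
    (fB : B) (hfB : ∀ᵐ x, j fB x = f x)
    -- the source
    (F : ℝ → B) (hF : AEStronglyMeasurable F (volume.restrict (Ioo 0 T)))
    (ξ : ℝ → ℝ) (hξ : ∀ᵐ t ∂(volume.restrict (Ioo 0 T)), ‖F t‖ ≤ ξ t)
    (hξM : eLpNorm ξ ⊤ (volume.restrict (Ioo 0 T)) ≤ ENNReal.ofReal M) :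
    -- the solution exists, is unique, and is the sum of the two terms
    (∃ u : ℝ → B, IsSolution ħ m T j fB F u ∧
      (∀ t ∈ Ioo 0 T, ∀ᵐ x,
        j (u t) x = poissonIntegral ħ m f x t + j (sourceTerm ħ U F t) x) ∧
      ∀ v : ℝ → B, IsSolution ħ m T j fB F v → v =ᵐ[volume.restrict (Ioo 0 T)] u) ∧
    -- the Poisson integral converges absolutely and solves the homogeneous equation pointwise
    (∀ t : ℝ, t ≠ 0 → ∀ x : Space n,
      Integrable (fun y => freeKernel ħ m x y t * f y) ∧
      ContDiffAt ℝ 2 (fun z => poissonIntegral ħ m f z t) x ∧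
      DifferentiableAt ℝ (fun s => poissonIntegral ħ m f x s) t ∧
      ((ħ ^ 2 / (2 * m) : ℝ) : ℂ) * Laplacian.laplacian (fun z => poissonIntegral ħ m f z t) x
        + Complex.I * ħ * deriv (fun s => poissonIntegral ħ m f x s) t = 0) ∧
    -- the time integral in the source term converges in `B`
    (∀ t ∈ Icc 0 T, IntervalIntegrable (fun τ => U (t - τ) (F τ)) volume 0 t) ∧
    -- the source term is the literal double integral as soon as the inner integral converges
    -- absolutely
    ((∀ᵐ τ ∂(volume.restrict (Ioo 0 T)), Integrable (j (F τ)) volume) →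
      ∀ t ∈ Ioo 0 T, ∀ᵐ x,
        IntervalIntegrable (fun τ => ∫ y, freeKernel ħ m x y (t - τ) * j (F τ) y) volume 0 t ∧
        j (sourceTerm ħ U F t) x =
          -(Complex.I / ħ) * ∫ τ in (0 : ℝ)..t, ∫ y, freeKernel ħ m x y (t - τ) * j (F τ) y) ∧
    -- the source term is bounded linearly in time, and vanishes as `t → 0+`
    (∀ C : ℝ, (∀ s ∈ Icc 0 T, ‖U s‖ ≤ C) →
      ∀ t ∈ Icc 0 T, ‖sourceTerm ħ U F t‖ ≤ C / ħ * M * t) ∧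
    Tendsto (sourceTerm ħ U F) (𝓝[>] 0) (𝓝 0) ∧
    -- all of this applies to `L²(ℝⁿ)`, where the free propagators are unitary
    (∃ V : ℝ → LTwo n →L[ℂ] LTwo n,
      IsFreePropagator ħ m (ContinuousLinearMap.id ℂ (LTwo n)) V ∧
      ∀ t : ℝ, (∀ g : LTwo n, ‖V t g‖ = ‖g‖) ∧ Function.Surjective (V t)) := by
  have hFM := ae_norm_le_of_eLpNorm_top_le hM.le hξ hξM
  have hfm : AEStronglyMeasurable f volume :=
    (Lp.aestronglyMeasurable (j fB)).congr hfB
  refine ⟨⟨fun t => U t fB + sourceTerm ħ U F t,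
      hU.isSolution hħ hm hT hM.le hF hFM fB, fun t ht => ?_, fun v hv =>
        hv.ae_eq hj hħ hT (hU.isSolution hħ hm hT hM.le hF hFM fB)⟩,
    fun t ht x => poissonIntegral_classical hħ hm hfm hf ht x,
    fun t ht => hU.intervalIntegrable hF hFM ht,
    fun hi t ht => hU.sourceTerm_ae_eq hħ hm hF hFM hi ht,
    fun C hC t ht => norm_sourceTerm_le hħ hC hFM ht,
    (hU.tendsto_sourceTerm hħ hT hFM).mono_left (nhdsWithin_mono _ Ioi_subset_Ici_self),
    _, isFreePropagator_freeGroup hħ hm, fun t =>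
      ⟨fun g => (freeGroup n _).norm_map g, freeGroup_surjective _⟩⟩
  have hc : ħ / (2 * m) * t ≠ 0 := mul_ne_zero (by positivity) ht.1.ne'
  -- The weight is at least one, so `f` is in L¹ ∩ L² and `U t fB` is given by the absolutely
  -- convergent Poisson integral.
  have hfi : Integrable f volume := by
    simpa using integrable_mul_of_le_weight hfm hf (continuous_const (y := (1 : ℂ))) (C := 1)
      fun y => by simp
  have hji : Integrable (j fB) volume := hfi.congr (EventuallyEq.symm hfB)
  simp only [map_add]
  filter_upwards [Lp.coeFn_add (j (U t fB)) (j (sourceTerm ħ U F t)),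
    freeGroup_ae_eq_integral hc (j fB) hji] with x h1 h2
  rw [h1, Pi.add_apply, hU.apply_eq hħ hm, h2, poissonIntegral]
  congr 1
  refine integral_congr_ae ?_
  filter_upwards [hfB] with y hy
  rw [hy, freeKernel_eq_gaussKernel hħ hm]
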